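/- Let $\Sigma$ be a closed (compact, without boundary, not necessarily orientable) surface with a smooth Riemannian metric $g_\Sigma$, and let $n\in\mathbb N$. A map $f:\Sigma\to\mathbb R^n$ is called a $W^{2,2}$-conformal immersion, $f\in W^{2,2}_{conf}(\Sigma,\mathbb R^n)$, if $f\in W^{2,2}_{loc}(\Sigma,\mathbb R^n)$ and in any local coordinates $(U,z)$ which are conformal for $g_\Sigma$ one has $\langle\partial_i f,\partial_j f\rangle=e^{2w}\delta_{ij}$ almost everywhere for some $w\in L^\infty_{loc}(U)$. The conformal factor of $f$ is the function $u:\Sigma\to\mathbb R$ (unique up to null sets) with $f^\ast g_{euc}=e^{2u}g_\Sigma$ almost everywhere. Let $f_k\in W^{2,2}_{conf}(\Sigma,\mathbb R^n)$, $k\in\mathbb N$, have the conformal factors $u_k$, and let $f\in W^{2,2}_{conf}(\Sigma,\mathbb R^n)$ have the conformal factor $u$. Assume that $f_k\to f$ strongly in $W^{2,2}(\Sigma,\mathbb R^n)$ and that there is a constant $C<\infty$ with $\|u_k\|_{L^\infty(\Sigma)}\le C$ for all $k$. Then $$\|u_k-u\|_{L^\infty(\Sigma)}\to 0\qquad (k\to\infty).$$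 -/

import Mathlib

open Set Filter MeasureTheory Manifold
open scoped Topology ContDiff NNReal ENNReal

noncomputable section

/-! ### Local Sobolev spaces on open subsets of the plane -/

section Plane

variable {V : Type*} [NormedAddCommGroup V] [InnerProductSpace ℝ V]

/-- The Euclidean plane, on which surfaces are modelled. -/
abbrev Plane : Type := EuclideanSpace ℝ (Fin 2)

/-- The `i`-th standard basis vector of the plane. -/
def planeBasis (i : Fin 2) : Plane := EuclideanSpace.single i (1 : ℝ)

/-- `G` is a weak `i`-th partial derivative of `F` on `U`: both are locally integrable on `U`,
and integration by parts holds against all smooth test functions compactly supported in `U`. -/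
structure IsWeakPartial (U : Set Plane) (i : Fin 2) (F G : Plane → V) : Prop where
  locInt : LocallyIntegrableOn F U volume
  locInt_deriv : LocallyIntegrableOn G U volume
  byParts : ∀ ζ : Plane → ℝ, ContDiff ℝ ∞ ζ → HasCompactSupport ζ → tsupport ζ ⊆ U →
    ∫ y in U, (fderiv ℝ ζ y (planeBasis i)) • F y = - ∫ y in U, ζ y • G y

/-- `F` has a weak `i`-th partial derivative on `U`. -/
def HasWeakPartial (U : Set Plane) (i : Fin 2) (F : Plane → V) : Prop :=
  ∃ G : Plane → V, IsWeakPartial U i F G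

open Classical in
/-- A representative of the weak `i`-th partial derivative of `F` on `U` (which is unique up to
null sets of an open set `U`), and `0` if there is none. -/
def weakPartial (U : Set Plane) (i : Fin 2) (F : Plane → V) : Plane → V :=
  if h : HasWeakPartial U i F then h.choose else 0

theorem isWeakPartial_weakPartial {U : Set Plane} {i : Fin 2} {F : Plane → V}
    (h : HasWeakPartial U i F) : IsWeakPartial U i F (weakPartial U i F) := by
  rw [weakPartial, dif_pos h]
  exact h.choose_spec

/-- `F ∈ L^p_loc(U)`. -/
def MemLpLoc (p : ℝ≥0∞) (U : Set Plane) (F : Plane → V) : Prop :=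
  ∀ K : Set Plane, IsCompact K → K ⊆ U → MemLp F p (volume.restrict K)

/-- `F ∈ W^{2,2}_loc(U)`: the function and its weak partial derivatives of orders one and two
exist and lie in `L^2_loc(U)`. -/
structure MemW22Loc (U : Set Plane) (F : Plane → V) : Prop where
  memLp_zero : MemLpLoc 2 U F
  hasWeakPartial_one : ∀ i, HasWeakPartial U i F
  memLp_one : ∀ i, MemLpLoc 2 U (weakPartial U i F)
  hasWeakPartial_two : ∀ i j, HasWeakPartial U j (weakPartial U i F)
  memLp_two : ∀ i j, MemLpLoc 2 U (weakPartial U j (weakPartial U i F))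

/-- The `W^{2,2}`-norm over `K ⊆ U` of a function in `W^{2,2}_loc(U)`. -/
def w22Norm (U K : Set Plane) (F : Plane → V) : ℝ≥0∞ :=
  eLpNorm F 2 (volume.restrict K)
    + ∑ i, eLpNorm (weakPartial U i F) 2 (volume.restrict K)
    + ∑ i, ∑ j, eLpNorm (weakPartial U j (weakPartial U i F)) 2 (volume.restrict K)

/-- The coefficient `⟨∂_i F, ∂_j F⟩` of the metric induced by `F` on `U`. -/
def inducedMetric (U : Set Plane) (F : Plane → V) (i j : Fin 2) (y : Plane) : ℝ :=
  inner ℝ (weakPartial U i F y) (weakPartial U j F y)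

end Plane

/-! ### Surfaces -/

section Surface

variable {S : Type*} [TopologicalSpace S] [ChartedSpace Plane S]

variable (S) in
/-- The smooth charts of a smooth surface. -/
def smoothCharts : Set (OpenPartialHomeomorph S Plane) :=
  IsManifold.maximalAtlas (𝓡 2) ∞ S

/-- A subset of a smooth surface is null if it is Lebesgue null in every smooth chart;
equivalently, if it is null for the area measure of any Riemannian metric. -/
def IsNullOn (N : Set S) : Prop :=
  ∀ φ ∈ smoothCharts S, volume (φ.target ∩ φ.symm ⁻¹' N) = 0

/-- The `L^∞`-norm (essential supremum of the absolute value) of a function on a surface. -/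
def linftyNorm (u : S → ℝ) : ℝ≥0∞ :=
  sInf {c : ℝ≥0∞ | IsNullOn {p : S | c < ‖u p‖ₑ}}

variable {V : Type*} [NormedAddCommGroup V] [InnerProductSpace ℝ V]

/-- `f ∈ W^{2,2}_loc(S, V)`: `f` is in `W^{2,2}_loc` in all smooth charts.
On a closed surface this is `W^{2,2}(S, V)`. -/
def MemW22 (f : S → V) : Prop :=
  ∀ φ ∈ smoothCharts S, MemW22Loc φ.target (f ∘ φ.symm)

/-- Strong convergence in `W^{2,2}_loc(S, V)`: convergence in the `W^{2,2}`-norm over all compact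
subsets of all smooth charts. On a closed surface, which is covered by finitely many such subsets,
this is norm convergence in `W^{2,2}(S, V)`. -/
def TendstoW22 (f : ℕ → S → V) (f' : S → V) : Prop :=
  ∀ φ ∈ smoothCharts S, ∀ K : Set Plane, IsCompact K → K ⊆ φ.target →
    Tendsto (fun k => w22Norm φ.target K (fun y => f k (φ.symm y) - f' (φ.symm y))) atTop (𝓝 0)

variable [IsManifold (𝓡 2) ∞ S]

variable (S) in
/-- Smooth Riemannian metrics on the surface `S`. -/
abbrev SmoothMetric : Type _ :=
  Bundle.ContMDiffRiemannianMetric (𝓡 2) ∞ Plane (fun p : S => TangentSpace (𝓡 2) p)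

/-- The `i`-th coordinate vector field of the chart `φ`, at the point with coordinates `y`. -/
def coordVector (φ : OpenPartialHomeomorph S Plane) (i : Fin 2) (y : Plane) :
    TangentSpace (𝓡 2) (φ.symm y) :=
  mfderiv (𝓡 2) (𝓡 2) φ.symm y (planeBasis i)

/-- The coefficient `g_ij` of the metric `g` in the chart `φ`, at the point with
coordinates `y`. -/
def SmoothMetric.coeff (g : SmoothMetric S) (φ : OpenPartialHomeomorph S Plane) (i j : Fin 2)
    (y : Plane) : ℝ :=
  g.inner (φ.symm y) (coordVector φ i y) (coordVector φ j y)

/-- `φ` is a local conformal coordinate system for `g`: a smooth chart in which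
`g_ij = ρ δ_ij` for a positive function `ρ`. -/
def IsConformalChart (g : SmoothMetric S) (φ : OpenPartialHomeomorph S Plane) : Prop :=
  φ ∈ smoothCharts S ∧ ∃ ρ : Plane → ℝ, ∀ y ∈ φ.target, 0 < ρ y ∧
    ∀ i j, SmoothMetric.coeff g φ i j y = ρ y * (if i = j then 1 else 0)

/-- `f` is a `W^{2,2}`-conformal immersion of `(S, g)`: it lies in `W^{2,2}_loc`, and in all local
conformal coordinates its induced metric is `e^{2u} δ_ij` for some `u ∈ L^∞_loc`. -/
structure IsW22ConformalImmersion (g : SmoothMetric S) (f : S → V) : Prop where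
  memW22 : MemW22 f
  conformal : ∀ φ : OpenPartialHomeomorph S Plane, IsConformalChart g φ →
    ∃ u : Plane → ℝ, MemLpLoc ∞ φ.target u ∧ ∀ i j, ∀ᵐ y ∂(volume.restrict φ.target),
      inducedMetric φ.target (f ∘ φ.symm) i j y
        = Real.exp (2 * u y) * (if i = j then 1 else 0)

/-- `u` is the conformal factor of `f` with respect to `g`: the induced metric is `e^{2u} g`
almost everywhere, as an identity of the coefficients in all smooth charts. -/
def IsConformalFactor (g : SmoothMetric S) (f : S → V) (u : S → ℝ) : Prop :=
  ∀ φ ∈ smoothCharts S, ∀ i j, ∀ᵐ y ∂(volume.restrict φ.target),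
    inducedMetric φ.target (f ∘ φ.symm) i j y
      = Real.exp (2 * u (φ.symm y)) * SmoothMetric.coeff g φ i j y

end Surface

end

/-!
The proof compares the metrics induced by `f_k` and `f'` directly, in arbitrary smooth charts; no
isothermal coordinates and no exponential integrability are used.

*The equation is linear in `e^{2u}`.* For a map `F` of a plane domain, with induced metric
`hᵢⱼ = ⟨∂ᵢF, ∂ⱼF⟩`, the combination `∂₁∂₁h₀₀ - 2∂₀∂₁h₀₁ + ∂₀∂₀h₁₁` is a sum of Jacobian
determinants of first derivatives of `F` (`integral_cofactorPairing_hess`). If `h = λ g` with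
`λ = e^{2u}`, the left-hand side is a second-order elliptic operator with smooth coefficients, linear
in `λ`. The difference `m = e^{2u_k} - e^{2u'}` satisfies
`m gᵢⱼ = ⟨∂ᵢd, ∂ⱼf'⟩ + ⟨∂ᵢf', ∂ⱼd⟩ + ⟨∂ᵢd, ∂ⱼd⟩` with `d = f_k - f'`, so the corresponding Jacobians
are small as soon as `d` is small in `W^{2,2}`.

*Wente's estimate.* The equation is tested with `greenTest`, the fundamental solution of the operator
with coefficients frozen at `x`, smoothed at scale `ε` and cut off at scale `R`. It is a function of
the values of the quadratic form `Q = g(x)`, so that its rotated gradient generates the flow of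
rotations of `Q`, up to a factor which is constant along the flow. Following a Jacobian along this
flow bounds its integral against the parametrix by the `L²`-norms of the second derivatives, with no
loss as `ε → 0` (`abs_integral_inner_rotation_le`, and
`abs_setIntegral_cofactorPairing_hess_greenTest_le` for weakly differentiable maps). On the other
side, the parametrix turns `m` into its value at the Lebesgue point `x`, up to a multiple of the
`L¹`-norm of `m` from the cut-off and an error `O(ρ)` from freezing the Lipschitz coefficients in a
ball of radius `ρ` (`sqrt_det_mul_abs_le`). Hence `|m|` is bounded almost everywhere by quantities
which are small (`ae_abs_le_of_isWeakJet`).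

*Conclusion.* The bound on `u_k` bounds `e^{2u_k}` and, through the limit in `L¹`, also `e^{2u'}`
from above, so that the first derivatives are bounded. Therefore `e^{2u_k} → e^{2u'}` uniformly on
small balls of charts (`eventually_ae_abs_exp_sub_exp_le`). Finitely many of them cover the compact
surface, null sets are independent of the chart (`isNullOn_of_cover`), and the lower bound on `u_k`
allows taking logarithms (`abs_sub_le_of_abs_exp_sub_exp_le`).
-/

open Set Filter MeasureTheory Manifold
open scoped Topology ContDiff NNReal ENNReal

noncomputable section

/-! ### Wente's estimate along a rotation flow -/

section Wente

variable {V : Type*} [NormedAddCommGroup V] [InnerProductSpace ℝ V]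

/-- Differentiation under the integral sign. -/
theorem hasDerivAt_integral_mul_of_continuous {κ : Plane → ℝ} (hκ : Continuous κ)
    (hκc : HasCompactSupport κ) {G G' : ℝ → Plane → ℝ}
    (hG : Continuous (Function.uncurry G)) (hG' : Continuous (Function.uncurry G'))
    (hd : ∀ t y, HasDerivAt (fun s => G s y) (G' t y) t) (t : ℝ) :
    HasDerivAt (fun s => ∫ y, κ y * G s y) (∫ y, κ y * G' t y) t := by
  obtain ⟨B, hB⟩ := ((isCompact_closedBall t 1).prod hκc).exists_bound_of_continuousOn
    hG'.continuousOn
  have hint : ∀ H : Plane → ℝ, Continuous H → Integrable (fun y => κ y * H y) := fun H hH =>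
    (hκ.mul hH).integrable_of_hasCompactSupport hκc.mul_right
  refine (hasDerivAt_integral_of_dominated_loc_of_deriv_le (s := Metric.ball t 1)
    (F := fun s y => κ y * G s y) (F' := fun s y => κ y * G' s y)
    (bound := fun y => |κ y| * B) (Metric.ball_mem_nhds t one_pos) ?_ ?_ ?_ ?_ ?_ ?_).2
  · exact Eventually.of_forall fun s =>
      (hκ.mul (hG.comp (by fun_prop : Continuous fun y : Plane => (s, y)))).aestronglyMeasurable
  · exact hint _ (hG.comp (by fun_prop : Continuous fun y : Plane => (t, y)))
  · exact (hκ.mul (hG'.comp (by fun_prop : Continuous fun y : Plane => (t, y)))).aestronglyMeasurable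
  · refine Eventually.of_forall fun y s hs => ?_
    rw [norm_mul, Real.norm_eq_abs]
    by_cases hy : y ∈ tsupport κ
    · exact mul_le_mul_of_nonneg_left (hB (s, y) ⟨Metric.ball_subset_closedBall hs, hy⟩)
        (abs_nonneg _)
    · simp [image_eq_zero_of_notMem_tsupport hy]
  · exact (hκ.abs.mul continuous_const).integrable_of_hasCompactSupport
      (hκc.comp_left abs_zero).mul_right
  · exact Eventually.of_forall fun y s _ => (hd s y).const_mul (κ y)

/-- The one-parameter group `exp (t N) = cos t + sin t N` generated by a linear map `N` with
`N² = -1`. -/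
def complexRotation (N : Plane →L[ℝ] Plane) (t : ℝ) : Plane →L[ℝ] Plane :=
  Real.cos t • ContinuousLinearMap.id ℝ Plane + Real.sin t • N

theorem complexRotation_apply (N : Plane →L[ℝ] Plane) (t : ℝ) (y : Plane) :
    complexRotation N t y = Real.cos t • y + Real.sin t • N y := rfl

theorem complexRotation_neg_complexRotation {N : Plane →L[ℝ] Plane} (hN : ∀ y, N (N y) = -y) (t : ℝ)
    (y : Plane) : complexRotation N (-t) (complexRotation N t y) = y := by
  have h := Real.sin_sq_add_cos_sq t
  simp only [complexRotation_apply, map_add, map_smul, hN, Real.cos_neg, Real.sin_neg]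
  have : y = (Real.sin t ^ 2 + Real.cos t ^ 2) • y := by rw [h, one_smul]
  conv_rhs => rw [this]
  module

theorem hasDerivAt_complexRotation {N : Plane →L[ℝ] Plane} (hN : ∀ y, N (N y) = -y) (t : ℝ)
    (y : Plane) : HasDerivAt (fun s => complexRotation N s y) (N (complexRotation N t y)) t := by
  simp only [complexRotation_apply]
  refine (((Real.hasDerivAt_cos t).smul_const y).fun_add
    ((Real.hasDerivAt_sin t).smul_const (N y))).congr_deriv ?_
  simp only [map_add, map_smul, hN]
  module

theorem continuous_complexRotation (N : Plane →L[ℝ] Plane) :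
    Continuous fun p : ℝ × Plane => complexRotation N p.1 p.2 := by
  simp only [complexRotation_apply]
  fun_prop

theorem memLp_two_of_isBounded {E : Set Plane} (hE : Bornology.IsBounded E) {h : Plane → ℝ}
    (hh : Continuous h) : MemLp h 2 (volume.restrict E) := by
  obtain ⟨D, hD⟩ := hE.isCompact_closure.exists_bound_of_continuousOn hh.continuousOn
  have : IsFiniteMeasure (volume.restrict (closure E)) :=
    ⟨by simpa using hE.isCompact_closure.measure_lt_top⟩
  have hm : MemLp h 2 (volume.restrict (closure E)) :=
    MemLp.of_bound hh.aestronglyMeasurable D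
      (ae_restrict_of_forall_mem isClosed_closure.measurableSet hD)
  exact hm.mono_measure (Measure.restrict_mono subset_closure le_rfl)

/-- The Cauchy–Schwarz inequality. -/
theorem setIntegral_mul_le_of_sq_le {E : Set Plane} {p q : Plane → ℝ}
    (hp : MemLp p 2 (volume.restrict E)) (hq : MemLp q 2 (volume.restrict E))
    (hp0 : ∀ y, 0 ≤ p y) (hq0 : ∀ y, 0 ≤ q y) {A B : ℝ} (hA : 0 ≤ A) (hB : 0 ≤ B)
    (hpA : ∫ y in E, p y ^ 2 ≤ A ^ 2) (hqB : ∫ y in E, q y ^ 2 ≤ B ^ 2) :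
    ∫ y in E, p y * q y ≤ A * B := by
  have h := integral_mul_le_Lp_mul_Lq_of_nonneg (μ := volume.restrict E)
    Real.HolderConjugate.two_two (Eventually.of_forall hp0) (Eventually.of_forall hq0)
    (by simpa using hp) (by simpa using hq)
  refine h.trans (mul_le_mul ?_ ?_ (Real.rpow_nonneg
    (integral_nonneg fun y => Real.rpow_nonneg (hq0 y) _) _) hA)
  · rw [← Real.sqrt_eq_rpow]
    exact Real.sqrt_le_iff.2 ⟨hA, by simpa using hpA⟩
  · rw [← Real.sqrt_eq_rpow]
    exact Real.sqrt_le_iff.2 ⟨hB, by simpa using hqB⟩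

/-- Wente's estimate: if `κ` is invariant under the rotations `R_t = exp (t N)`, the integral of
`κ ⟨a, Db(N ·)⟩` is bounded by the `L²`-norms of `Da` and `Db` alone. Consider `c t = ∫ κ ⟨a ∘
R_t, Db(N ·)⟩`. As `R_t` preserves `κ` and the measure, `-c` is the derivative of the
`2π`-periodic function `t ↦ ∫ κ ⟨a, b ∘ R_{-t}⟩`, so `c` vanishes at some point of `(0, 2π)`; on
the other hand the derivative of `c` involves `Da` and `Db` only. -/
theorem abs_integral_inner_rotation_le {N : Plane →L[ℝ] Plane} (hN : ∀ y, N (N y) = -y)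
    (hmp : ∀ t, MeasurePreserving (complexRotation N t)) {κ : Plane → ℝ} (hκ : Continuous κ)
    (hκc : HasCompactSupport κ) (hκN : ∀ t y, κ (complexRotation N t y) = κ y) {S : ℝ}
    (hS : ∀ t y, |κ y| * ‖N y‖ * ‖N (complexRotation N t y)‖ ≤ S)
    {a b : Plane → V} (ha : ContDiff ℝ 1 a) (hb : ContDiff ℝ 1 b) {A B : ℝ} (hA : 0 ≤ A)
    (hB : 0 ≤ B) (hDa : ∫ y in Function.support κ, ‖fderiv ℝ a y‖ ^ 2 ≤ A ^ 2)
    (hDb : ∫ y in Function.support κ, ‖fderiv ℝ b y‖ ^ 2 ≤ B ^ 2) :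
    |∫ y, κ y * inner ℝ (a y) (fderiv ℝ b y (N y))| ≤ 2 * Real.pi * (S * (A * B)) := by
  have hDac : Continuous (fderiv ℝ a) := ha.continuous_fderiv one_ne_zero
  have hDbc : Continuous (fderiv ℝ b) := hb.continuous_fderiv one_ne_zero
  have hac := ha.continuous
  have hbc := hb.continuous
  have hrot := continuous_complexRotation N
  have hrotm : Continuous fun p : ℝ × Plane => complexRotation N (-p.1) p.2 := by
    simp only [complexRotation_apply]
    fun_prop
  set c : ℝ → ℝ := fun t => ∫ y, κ y * inner ℝ (a (complexRotation N t y))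
    (fderiv ℝ b y (N y)) with hc
  have hc0 : c 0 = ∫ y, κ y * inner ℝ (a y) (fderiv ℝ b y (N y)) := by
    simp [hc, complexRotation_apply]
  set c' : ℝ → ℝ := fun t => ∫ y, κ y *
    inner ℝ (fderiv ℝ a (complexRotation N t y) (N (complexRotation N t y)))
      (fderiv ℝ b y (N y)) with hc'
  have hcd : ∀ t, HasDerivAt c (c' t) t := by
    intro t
    refine hasDerivAt_integral_mul_of_continuous hκ hκc
      (G := fun t y => inner ℝ (a (complexRotation N t y)) (fderiv ℝ b y (N y)))
      (G' := fun t y => inner ℝ (fderiv ℝ a (complexRotation N t y) (N (complexRotation N t y)))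
        (fderiv ℝ b y (N y))) ?_ ?_ ?_ t
    · unfold Function.uncurry
      dsimp only
      fun_prop
    · unfold Function.uncurry
      dsimp only
      fun_prop
    · intro t y
      have h1 := ((ha.differentiable one_ne_zero (complexRotation N t y)).hasFDerivAt).comp_hasDerivAt
        t (hasDerivAt_complexRotation hN t y)
      simpa using h1.inner ℝ (hasDerivAt_const t (fderiv ℝ b y (N y)))
  -- `-c` is the derivative of the `2π`-periodic function `P`
  set P : ℝ → ℝ := fun t => ∫ y, κ y * inner ℝ (a y) (b (complexRotation N (-t) y)) with hP
  have hPd : ∀ t, HasDerivAt P (-c t) t := by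
    intro t
    have h := hasDerivAt_integral_mul_of_continuous hκ hκc
      (G := fun t y => inner ℝ (a y) (b (complexRotation N (-t) y)))
      (G' := fun t y => inner ℝ (a y)
        (fderiv ℝ b (complexRotation N (-t) y) (-(N (complexRotation N (-t) y))))) ?_ ?_ ?_ t
    · convert h using 1
      have hemb : MeasurableEmbedding (complexRotation N t) :=
        (complexRotation N t).continuous.measurableEmbedding
          (Function.LeftInverse.injective (complexRotation_neg_complexRotation hN t))
      rw [← (hmp t).integral_comp hemb, hc, ← integral_neg]
      congr 1 with y
      rw [complexRotation_neg_complexRotation hN, hκN]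
      simp
    · unfold Function.uncurry
      dsimp only
      fun_prop
    · unfold Function.uncurry
      dsimp only
      fun_prop
    · intro t y
      have h0 : HasDerivAt (fun s => complexRotation N (-s) y)
          (-(N (complexRotation N (-t) y))) t := by
        have h := (hasDerivAt_complexRotation hN (-t) y).scomp t (hasDerivAt_neg t)
        rw [neg_one_smul] at h
        exact h
      have h1 := ((hb.differentiable one_ne_zero (complexRotation N (-t) y)).hasFDerivAt).comp_hasDerivAt
        t h0
      simpa using (hasDerivAt_const t (a y)).inner ℝ h1
  obtain ⟨t₀, ht₀, hct₀⟩ : ∃ t₀ ∈ Ioo (0 : ℝ) (2 * Real.pi), -c t₀ = 0 := by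
    refine exists_hasDerivAt_eq_zero Real.two_pi_pos
      (fun t _ => (hPd t).continuousAt.continuousWithinAt) ?_ fun t _ => hPd t
    simp [hP, complexRotation_apply]
  have hbd : ∀ t, |c' t| ≤ S * (A * B) := by
    intro t
    have hemb : MeasurableEmbedding (complexRotation N t) :=
      (complexRotation N t).continuous.measurableEmbedding
        (Function.LeftInverse.injective (complexRotation_neg_complexRotation hN t))
    have hrt : Continuous (complexRotation N t) := (complexRotation N t).continuous
    have hbdd : Bornology.IsBounded (Function.support κ) :=
      hκc.isBounded.subset (subset_tsupport κ)
    have hms : MeasurableSet (Function.support κ) := hκ.isOpen_support.measurableSet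
    have h1 : ∫ y in Function.support κ, ‖fderiv ℝ a (complexRotation N t y)‖ * ‖fderiv ℝ b y‖
        ≤ A * B := by
      refine setIntegral_mul_le_of_sq_le (memLp_two_of_isBounded hbdd (by fun_prop))
        (memLp_two_of_isBounded hbdd (by fun_prop))
        (fun _ => norm_nonneg _) (fun _ => norm_nonneg _) hA hB ?_ hDb
      have := (hmp t).setIntegral_preimage_emb hemb (fun y => ‖fderiv ℝ a y‖ ^ 2)
        (Function.support κ)
      have hpre : complexRotation N t ⁻¹' Function.support κ = Function.support κ := by
        ext y; simp [hκN]
      rw [hpre] at this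
      rw [this]; exact hDa
    have hS0 : 0 ≤ S := le_trans (by positivity) (hS 0 0)
    have hint : IntegrableOn (fun y => S * (‖fderiv ℝ a (complexRotation N t y)‖ * ‖fderiv ℝ b y‖))
        (Function.support κ) :=
      ((by fun_prop : Continuous fun y =>
        S * (‖fderiv ℝ a (complexRotation N t y)‖ * ‖fderiv ℝ b y‖)).continuousOn.integrableOn_compact
        hκc).mono_set (subset_tsupport κ)
    have hsupp : c' t = ∫ y in Function.support κ, κ y *
        inner ℝ (fderiv ℝ a (complexRotation N t y) (N (complexRotation N t y)))
          (fderiv ℝ b y (N y)) := by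
      rw [setIntegral_eq_integral_of_forall_compl_eq_zero]
      intro y hy
      simp [Function.notMem_support.1 hy]
    rw [hsupp, ← Real.norm_eq_abs]
    calc _ ≤ ∫ y in Function.support κ,
          S * (‖fderiv ℝ a (complexRotation N t y)‖ * ‖fderiv ℝ b y‖) := by
          refine norm_integral_le_of_norm_le hint (Eventually.of_forall fun y => ?_)
          rw [norm_mul, Real.norm_eq_abs]
          calc _ ≤ |κ y| * ((‖fderiv ℝ a (complexRotation N t y)‖ * ‖N (complexRotation N t y)‖)
                * (‖fderiv ℝ b y‖ * ‖N y‖)) := by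
                refine mul_le_mul_of_nonneg_left ((norm_inner_le_norm _ _).trans ?_) (abs_nonneg _)
                gcongr <;> exact ContinuousLinearMap.le_opNorm _ _
            _ = (|κ y| * ‖N y‖ * ‖N (complexRotation N t y)‖)
                * (‖fderiv ℝ a (complexRotation N t y)‖ * ‖fderiv ℝ b y‖) := by ring
            _ ≤ _ := by gcongr; exact hS t y
      _ ≤ S * (A * B) := by
          rw [integral_const_mul]
          exact mul_le_mul_of_nonneg_left h1 hS0
  have hmv := (convex_univ (𝕜 := ℝ) (E := ℝ)).norm_image_sub_le_of_norm_hasDerivWithin_le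
    (f := c) (f' := c') (C := S * (A * B)) (fun t _ => (hcd t).hasDerivWithinAt)
    (fun t _ => hbd t) (mem_univ t₀) (mem_univ 0)
  rw [neg_eq_zero.1 hct₀, sub_zero, zero_sub, norm_neg, Real.norm_eq_abs, Real.norm_eq_abs,
    abs_of_pos ht₀.1] at hmv
  rw [← hc0]
  have hSAB : 0 ≤ S * (A * B) := (abs_nonneg _).trans (hbd 0)
  calc |c 0| ≤ S * (A * B) * t₀ := hmv
    _ ≤ S * (A * B) * (2 * Real.pi) := mul_le_mul_of_nonneg_left ht₀.2.le hSAB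
    _ = _ := by ring

end Wente

/-! ### The smoothed logarithm -/

section Profile

/-- A smooth function equal to `½ log t` for `t ≥ 1` and to `0` for `t ≤ 1/2`; thus
`y ↦ logProfile (|y|²)` is `log |y|` smoothed near the origin. -/
def logProfile (t : ℝ) : ℝ := Real.log t / 2 * Real.smoothTransition (2 * t - 1)

theorem logProfile_of_le {t : ℝ} (ht : t ≤ 1 / 2) : logProfile t = 0 := by
  rw [logProfile, Real.smoothTransition.zero_of_nonpos (by linarith), mul_zero]

theorem logProfile_of_one_le {t : ℝ} (ht : 1 ≤ t) : logProfile t = Real.log t / 2 := by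
  rw [logProfile, Real.smoothTransition.one_of_one_le (by linarith), mul_one]

theorem logProfile_eventuallyEq_zero {t : ℝ} (ht : t < 1 / 2) : logProfile =ᶠ[𝓝 t] fun _ => 0 := by
  filter_upwards [Iio_mem_nhds ht] with s hs
  exact logProfile_of_le (le_of_lt hs)

theorem contDiff_logProfile : ContDiff ℝ ∞ logProfile := by
  rw [contDiff_iff_contDiffAt]
  intro t
  rcases lt_or_ge t (1 / 2) with ht | ht
  · exact contDiffAt_const.congr_of_eventuallyEq (logProfile_eventuallyEq_zero ht)
  · have ht0 : t ≠ 0 := by linarith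
    refine ((Real.contDiffAt_log.2 ht0).div_const 2).mul ?_
    exact (Real.smoothTransition.contDiff (n := ⊤)).contDiffAt.comp t (by fun_prop)

theorem deriv_logProfile_of_lt {t : ℝ} (ht : t < 1 / 2) : deriv logProfile t = 0 := by
  rw [(logProfile_eventuallyEq_zero ht).deriv_eq, deriv_const]

theorem deriv_deriv_logProfile_of_lt {t : ℝ} (ht : t < 1 / 2) :
    deriv (deriv logProfile) t = 0 := by
  have : deriv logProfile =ᶠ[𝓝 t] fun _ => 0 := by
    filter_upwards [Iio_mem_nhds ht] with s hs
    exact deriv_logProfile_of_lt hs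
  rw [this.deriv_eq, deriv_const]

theorem deriv_logProfile_of_one_lt {t : ℝ} (ht : 1 < t) : deriv logProfile t = (2 * t)⁻¹ := by
  have : logProfile =ᶠ[𝓝 t] fun s => Real.log s / 2 := by
    filter_upwards [Ioi_mem_nhds ht] with s hs
    exact logProfile_of_one_le (le_of_lt hs)
  rw [this.deriv_eq, deriv_div_const, Real.deriv_log, mul_inv, div_eq_mul_inv, mul_comm]

theorem deriv_deriv_logProfile_of_one_lt {t : ℝ} (ht : 1 < t) :
    deriv (deriv logProfile) t = -(2 * t ^ 2)⁻¹ := by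
  have : deriv logProfile =ᶠ[𝓝 t] fun s => 2⁻¹ * s⁻¹ := by
    filter_upwards [Ioi_mem_nhds ht] with s hs
    rw [deriv_logProfile_of_one_lt hs, mul_inv]
  rw [this.deriv_eq, deriv_const_mul _ (differentiableAt_inv (by linarith)), deriv_inv, mul_inv]
  ring

theorem contDiff_deriv_logProfile : ContDiff ℝ ∞ (deriv logProfile) :=
  (contDiff_infty_iff_deriv.1 contDiff_logProfile).2

theorem continuous_deriv_deriv_logProfile : Continuous (deriv (deriv logProfile)) :=
  (contDiff_infty_iff_deriv.1 contDiff_deriv_logProfile).2.continuous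

/-- `|t γ'|` and `|t² γ''|` are bounded for the profile `γ`, since they are constant for large
`t`. -/
theorem exists_logProfile_bound : ∃ S : ℝ, 0 ≤ S ∧ ∀ t, |t * deriv logProfile t| ≤ S ∧
    |t ^ 2 * deriv (deriv logProfile) t| ≤ S := by
  have h1 := contDiff_deriv_logProfile.continuous
  have h2 := continuous_deriv_deriv_logProfile
  obtain ⟨B₁, hB₁⟩ := (isCompact_Icc (a := (1 / 2 : ℝ)) (b := 1)).exists_bound_of_continuousOn
    (f := fun t => t * deriv logProfile t) (by fun_prop)
  obtain ⟨B₂, hB₂⟩ := (isCompact_Icc (a := (1 / 2 : ℝ)) (b := 1)).exists_bound_of_continuousOn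
    (f := fun t => t ^ 2 * deriv (deriv logProfile) t) (by fun_prop)
  refine ⟨max 1 (max B₁ B₂), by positivity, fun t => ?_⟩
  rcases lt_or_ge t (1 / 2) with ht | ht
  · simp [deriv_logProfile_of_lt ht, deriv_deriv_logProfile_of_lt ht]
  rcases lt_or_ge 1 t with ht1 | ht1
  · have h0 : t ≠ 0 := by linarith
    rw [deriv_logProfile_of_one_lt ht1, deriv_deriv_logProfile_of_one_lt ht1]
    have e1 : t * (2 * t)⁻¹ = 1 / 2 := by field_simp
    have e2 : t ^ 2 * -(2 * t ^ 2)⁻¹ = -(1 / 2) := by field_simp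
    rw [e1, e2, abs_neg, abs_of_pos (by norm_num : (0 : ℝ) < 1 / 2)]
    constructor <;> exact le_trans (by norm_num) (le_max_left _ _)
  · exact ⟨(hB₁ t ⟨ht, ht1⟩).trans (le_max_of_le_right (le_max_left _ _)),
      (hB₂ t ⟨ht, ht1⟩).trans (le_max_of_le_right (le_max_right _ _))⟩

/-- The profile `β = 4 (γ' + t γ'')` of the Laplacian of `y ↦ logProfile (|y|²)`: a smoothed
Dirac mass. -/
def deltaProfile (t : ℝ) : ℝ := 4 * (deriv logProfile t + t * deriv (deriv logProfile) t)

theorem continuous_deltaProfile : Continuous deltaProfile := by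
  have h1 := contDiff_deriv_logProfile.continuous
  have h2 := continuous_deriv_deriv_logProfile
  unfold deltaProfile
  fun_prop

theorem deltaProfile_of_one_lt {t : ℝ} (ht : 1 < t) : deltaProfile t = 0 := by
  have h0 : t ≠ 0 := by linarith
  rw [deltaProfile, deriv_logProfile_of_one_lt ht, deriv_deriv_logProfile_of_one_lt ht]
  field_simp
  ring

theorem exists_deltaProfile_bound : ∃ B : ℝ, 0 ≤ B ∧ ∀ t, |deltaProfile t| ≤ B := by
  obtain ⟨B, hB⟩ := (isCompact_Icc (a := (0 : ℝ)) (b := 1)).exists_bound_of_continuousOn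
    continuous_deltaProfile.continuousOn
  refine ⟨max 0 B, le_max_left _ _, fun t => ?_⟩
  rcases lt_or_ge t 0 with ht | ht
  · have ht' : t < 1 / 2 := by linarith
    simp [deltaProfile, deriv_logProfile_of_lt ht', deriv_deriv_logProfile_of_lt ht']
  rcases lt_or_ge 1 t with ht1 | ht1
  · simp [deltaProfile_of_one_lt ht1]
  · exact (hB t ⟨ht, ht1⟩).trans (le_max_right _ _)

/-- In polar coordinates, `r β(r²)` is the derivative of `2 r² γ'(r²)`, which is `1` for large
`r`. -/
theorem integral_deltaProfile_norm_sq :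
    ∫ z : Plane, deltaProfile (‖z‖ ^ 2) = 2 * Real.pi := by
  rw [integral_fun_norm_addHaar volume (fun r => deltaProfile (r ^ 2))]
  have hvol : (volume : Measure Plane).real (Metric.ball 0 1) = Real.pi := by
    simp [Measure.real, EuclideanSpace.volume_ball_fin_two, Real.pi_pos.le]
  have hder : ∀ r : ℝ, HasDerivAt (fun r => 2 * (r ^ 2 * deriv logProfile (r ^ 2)))
      (r ^ (2 - 1) • deltaProfile (r ^ 2)) r := by
    intro r
    have h1 := ((contDiff_deriv_logProfile.differentiable (by simp)) (r ^ 2)).hasDerivAt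
    have h2 : HasDerivAt (fun r : ℝ => r ^ 2) (2 * r) r := by simpa using hasDerivAt_pow 2 r
    have h3 : HasDerivAt (fun r : ℝ => deriv logProfile (r ^ 2))
        (deriv (deriv logProfile) (r ^ 2) * (2 * r)) r :=
      HasDerivAt.comp (h₂ := deriv logProfile) r h1 h2
    refine ((h2.fun_mul h3).const_mul 2).congr_deriv ?_
    simp only [deltaProfile, smul_eq_mul]
    ring
  have hint : ∫ r in Ioi (0 : ℝ), r ^ (2 - 1) • deltaProfile (r ^ 2) = 1 := by
    have h0 : ∫ r in Ioi (0 : ℝ), r ^ (2 - 1) • deltaProfile (r ^ 2)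
        = ∫ r in Ioc (0 : ℝ) 2, r ^ (2 - 1) • deltaProfile (r ^ 2) := by
      refine (setIntegral_eq_of_subset_of_forall_sdiff_eq_zero measurableSet_Ioi
        Ioc_subset_Ioi_self fun r hr => ?_)
      have h2 : 2 < r := by
        by_contra h
        exact hr.2 ⟨hr.1, not_lt.1 h⟩
      rw [deltaProfile_of_one_lt (by nlinarith), smul_zero]
    have hc := continuous_deltaProfile
    rw [h0, ← intervalIntegral.integral_of_le (by norm_num),
      intervalIntegral.integral_eq_sub_of_hasDerivAt (fun r _ => hder r)
        (Continuous.intervalIntegrable (by fun_prop) _ _), deriv_logProfile_of_one_lt (by norm_num)]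
    norm_num
  simp only [finrank_euclideanSpace, Fintype.card_fin, hvol]
  rw [hint]
  simp

/-- The profile `log (r / R)`, as a function of `s = r²`, smoothed below scale `ε` and cut off
above scale `R`. -/
def greenProfile (ε R s : ℝ) : ℝ :=
  logProfile (s / ε ^ 2) - logProfile (s / R ^ 2) - Real.log (R / ε)

theorem contDiff_greenProfile (ε R : ℝ) : ContDiff ℝ ∞ (greenProfile ε R) := by
  have h := contDiff_logProfile
  unfold greenProfile
  fun_prop

theorem greenProfile_of_le {ε R s : ℝ} (hε : 0 < ε) (hεR : ε ≤ R) (hs : R ^ 2 ≤ s) :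
    greenProfile ε R s = 0 := by
  have hR : 0 < R := hε.trans_le hεR
  have hs0 : 0 < s := lt_of_lt_of_le (by positivity) hs
  have h1 : 1 ≤ s / R ^ 2 := by rwa [one_le_div (by positivity)]
  have h2 : 1 ≤ s / ε ^ 2 := by
    rw [one_le_div (by positivity)]
    exact le_trans (by gcongr) hs
  rw [greenProfile, logProfile_of_one_le h1, logProfile_of_one_le h2,
    Real.log_div hs0.ne' (by positivity), Real.log_div hs0.ne' (by positivity),
    Real.log_div hR.ne' hε.ne', Real.log_pow, Real.log_pow]
  push_cast
  ring

theorem deriv_greenProfile (ε R s : ℝ) : deriv (greenProfile ε R) s =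
    deriv logProfile (s / ε ^ 2) / ε ^ 2 - deriv logProfile (s / R ^ 2) / R ^ 2 := by
  have hd : ∀ a : ℝ, HasDerivAt (fun s => logProfile (s / a)) (deriv logProfile (s / a) / a) s := by
    intro a
    have h1 := ((contDiff_logProfile.differentiable (by simp)) (s / a)).hasDerivAt
    have h2 := h1.comp s ((hasDerivAt_id s).div_const a)
    simpa [div_eq_mul_inv, Function.comp_def] using h2
  exact (((hd _).sub (hd _)).sub_const _).deriv

theorem deriv_deriv_greenProfile (ε R s : ℝ) : deriv (deriv (greenProfile ε R)) s =
    deriv (deriv logProfile) (s / ε ^ 2) / (ε ^ 2) ^ 2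
      - deriv (deriv logProfile) (s / R ^ 2) / (R ^ 2) ^ 2 := by
  have hd : ∀ a : ℝ, HasDerivAt (fun s => deriv logProfile (s / a) / a)
      (deriv (deriv logProfile) (s / a) / a ^ 2) s := by
    intro a
    have h1 := ((contDiff_deriv_logProfile.differentiable (by simp)) (s / a)).hasDerivAt
    have h2 := (h1.comp s ((hasDerivAt_id s).div_const a)).div_const a
    refine h2.congr_deriv ?_
    simp [div_eq_mul_inv]
    ring
  have he : deriv (greenProfile ε R) = fun s =>
      deriv logProfile (s / ε ^ 2) / ε ^ 2 - deriv logProfile (s / R ^ 2) / R ^ 2 :=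
    funext fun s => deriv_greenProfile ε R s
  rw [he]
  exact ((hd _).sub (hd _)).deriv

/-- The bounds for the profile are invariant under scaling, hence uniform in `ε` and `R`. -/
theorem greenProfile_bound {S : ℝ} (hS : ∀ t, |t * deriv logProfile t| ≤ S ∧
    |t ^ 2 * deriv (deriv logProfile) t| ≤ S) (ε R s : ℝ) :
    |s * deriv (greenProfile ε R) s| ≤ 2 * S ∧
      |s ^ 2 * deriv (deriv (greenProfile ε R)) s| ≤ 2 * S := by
  rw [deriv_greenProfile, deriv_deriv_greenProfile]
  constructor
  · have : s * (deriv logProfile (s / ε ^ 2) / ε ^ 2 - deriv logProfile (s / R ^ 2) / R ^ 2)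
      = s / ε ^ 2 * deriv logProfile (s / ε ^ 2) - s / R ^ 2 * deriv logProfile (s / R ^ 2) := by
      ring
    rw [this]
    exact (abs_sub _ _).trans (by linarith [(hS (s / ε ^ 2)).1, (hS (s / R ^ 2)).1])
  · have : s ^ 2 * (deriv (deriv logProfile) (s / ε ^ 2) / (ε ^ 2) ^ 2
        - deriv (deriv logProfile) (s / R ^ 2) / (R ^ 2) ^ 2)
      = (s / ε ^ 2) ^ 2 * deriv (deriv logProfile) (s / ε ^ 2)
        - (s / R ^ 2) ^ 2 * deriv (deriv logProfile) (s / R ^ 2) := by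
      ring
    rw [this]
    exact (abs_sub _ _).trans (by linarith [(hS (s / ε ^ 2)).2, (hS (s / R ^ 2)).2])

theorem four_mul_deriv_greenProfile (ε R s : ℝ) :
    4 * (deriv (greenProfile ε R) s + s * deriv (deriv (greenProfile ε R)) s) =
      deltaProfile (s / ε ^ 2) / ε ^ 2 - deltaProfile (s / R ^ 2) / R ^ 2 := by
  rw [deriv_greenProfile, deriv_deriv_greenProfile, deltaProfile, deltaProfile]
  ring

end Profile

/-! ### Positive definite forms and their complex structures -/

section Forms

/-- A positive definite quadratic form on the plane, given by its symmetric matrix. -/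
structure PosForm where
  /-- The matrix of the form. -/
  coef : Fin 2 → Fin 2 → ℝ
  symm : coef 1 0 = coef 0 1
  pos : 0 < coef 0 0
  det_pos : 0 < coef 0 0 * coef 1 1 - coef 0 1 ^ 2

namespace PosForm

variable (Q : PosForm)

/-- The determinant of the matrix. -/
def det : ℝ := Q.coef 0 0 * Q.coef 1 1 - Q.coef 0 1 ^ 2

theorem det_positive : 0 < Q.det := Q.det_pos

/-- The trace of the matrix. -/
def tr : ℝ := Q.coef 0 0 + Q.coef 1 1

/-- The matrix applied to a vector, i.e. half of the gradient of the form. -/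
def grad (z : Plane) (i : Fin 2) : ℝ := Q.coef i 0 * z 0 + Q.coef i 1 * z 1

/-- The value of the form. -/
def eval (z : Plane) : ℝ := z 0 * Q.grad z 0 + z 1 * Q.grad z 1

theorem coef_one_one_pos : 0 < Q.coef 1 1 := by
  by_contra h
  nlinarith [Q.pos, Q.det_pos, sq_nonneg (Q.coef 0 1)]

theorem tr_pos : 0 < Q.tr := add_pos Q.pos Q.coef_one_one_pos

theorem eval_smul (c : ℝ) (z : Plane) : Q.eval (c • z) = c ^ 2 * Q.eval z := by
  simp only [eval, grad, PiLp.smul_apply, smul_eq_mul]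
  ring

/-- The Cayley–Hamilton identity `|Qz|² = tr Q ⟨Qz, z⟩ - det Q |z|²`. -/
theorem grad_sq_add_sq (z : Plane) :
    Q.grad z 0 ^ 2 + Q.grad z 1 ^ 2 = Q.tr * Q.eval z - Q.det * ‖z‖ ^ 2 := by
  rw [EuclideanSpace.real_norm_sq_eq, Fin.sum_univ_two]
  simp only [grad, eval, tr, det, Q.symm]
  ring

theorem det_mul_norm_sq_le (z : Plane) : Q.det * ‖z‖ ^ 2 ≤ Q.tr * Q.eval z := by
  nlinarith [Q.grad_sq_add_sq z, sq_nonneg (Q.grad z 0), sq_nonneg (Q.grad z 1)]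

theorem eval_nonneg (z : Plane) : 0 ≤ Q.eval z := by
  have h1 := Q.det_mul_norm_sq_le z
  have h2 : 0 ≤ Q.det * ‖z‖ ^ 2 := mul_nonneg Q.det_pos.le (by positivity)
  exact nonneg_of_mul_nonneg_right (h2.trans h1) Q.tr_pos

theorem grad_sq_add_sq_le (z : Plane) :
    Q.grad z 0 ^ 2 + Q.grad z 1 ^ 2 ≤ Q.tr * Q.eval z := by
  have h2 : 0 ≤ Q.det * ‖z‖ ^ 2 := mul_nonneg Q.det_pos.le (by positivity)
  linarith [Q.grad_sq_add_sq z]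

theorem abs_coef_le (i j : Fin 2) : |Q.coef i j| ≤ Q.tr := by
  have h0 := Q.pos
  have h1 := Q.coef_one_one_pos
  have h2 : |Q.coef 0 1| ≤ Q.tr := by
    refine abs_le_of_sq_le_sq ?_ Q.tr_pos.le
    have := Q.det_pos
    unfold tr
    nlinarith
  fin_cases i <;> fin_cases j
  · simp only [Fin.zero_eta, abs_of_pos h0, tr]; linarith
  · exact h2
  · simpa [Q.symm] using h2
  · simp only [Fin.mk_one, abs_of_pos h1, tr]; linarith

theorem abs_grad_mul_grad_le (z : Plane) (i j : Fin 2) :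
    |Q.grad z i * Q.grad z j| ≤ Q.tr * Q.eval z := by
  have h := Q.grad_sq_add_sq_le z
  have hk : ∀ k, Q.grad z k ^ 2 ≤ Q.tr * Q.eval z := by
    intro k
    fin_cases k
    · simp only [Fin.zero_eta]; linarith [sq_nonneg (Q.grad z 1)]
    · simp only [Fin.mk_one]; linarith [sq_nonneg (Q.grad z 0)]
  rw [abs_mul]
  nlinarith [hk i, hk j, sq_abs (Q.grad z i), sq_abs (Q.grad z j),
    sq_nonneg (|Q.grad z i| - |Q.grad z j|)]

/-- The complex structure compatible with the form: the rotation by a right angle for the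
inner product with matrix `Q`. -/
def rot : Plane →L[ℝ] Plane :=
  Matrix.toEuclideanCLM (𝕜 := ℝ)
    ((√Q.det)⁻¹ • !![-Q.coef 1 0, -Q.coef 1 1; Q.coef 0 0, Q.coef 0 1])

theorem sqrt_det_pos : 0 < √Q.det := Real.sqrt_pos.2 Q.det_pos

theorem rot_zero (z : Plane) : Q.rot z 0 = -(√Q.det)⁻¹ * Q.grad z 1 := by
  simp only [rot, Matrix.ofLp_toEuclideanCLM, grad]
  simp [Matrix.mulVec, dotProduct, Fin.sum_univ_two]
  ring

theorem rot_one (z : Plane) : Q.rot z 1 = (√Q.det)⁻¹ * Q.grad z 0 := by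
  simp only [rot, Matrix.ofLp_toEuclideanCLM, grad]
  simp [Matrix.mulVec, dotProduct, Fin.sum_univ_two]
  ring

theorem inv_sqrt_det_sq : (√Q.det)⁻¹ ^ 2 * Q.det = 1 := by
  rw [inv_pow, Real.sq_sqrt Q.det_positive.le]
  exact inv_mul_cancel₀ Q.det_pos.ne'

theorem rot_rot (z : Plane) : Q.rot (Q.rot z) = -z := by
  have h := Q.inv_sqrt_det_sq
  ext i
  fin_cases i
  · simp only [Fin.zero_eta, PiLp.neg_apply]
    rw [rot_zero, grad, rot_zero, rot_one, grad, grad]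
    simp only [det, Q.symm] at h ⊢
    linear_combination (-z 0) * h
  · simp only [Fin.mk_one, PiLp.neg_apply]
    rw [rot_one, grad, rot_zero, rot_one, grad, grad]
    simp only [det, Q.symm] at h ⊢
    linear_combination (-z 1) * h

theorem norm_rot_sq (z : Plane) : ‖Q.rot z‖ ^ 2 ≤ Q.tr / Q.det * Q.eval z := by
  have h := Q.inv_sqrt_det_sq
  have hd := Q.det_pos
  have he : (√Q.det)⁻¹ ^ 2 = 1 / Q.det := by
    rw [inv_pow, Real.sq_sqrt Q.det_positive.le, one_div]
  rw [EuclideanSpace.real_norm_sq_eq, Fin.sum_univ_two, rot_zero, rot_one]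
  calc _ = (√Q.det)⁻¹ ^ 2 * (Q.grad z 0 ^ 2 + Q.grad z 1 ^ 2) := by ring
    _ ≤ (√Q.det)⁻¹ ^ 2 * (Q.tr * Q.eval z) :=
        mul_le_mul_of_nonneg_left (Q.grad_sq_add_sq_le z) (by positivity)
    _ = _ := by rw [he]; ring

/-- The rotations generated by the complex structure preserve the form. -/
theorem eval_complexRotation (t : ℝ) (z : Plane) :
    Q.eval (complexRotation Q.rot t z) = Q.eval z := by
  have h := Q.inv_sqrt_det_sq
  have ht := Real.sin_sq_add_cos_sq t
  simp only [eval, grad, complexRotation_apply, PiLp.add_apply, PiLp.smul_apply, smul_eq_mul,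
    rot_zero, rot_one]
  simp only [det, Q.symm] at h ⊢
  set w := (√(Q.coef 0 0 * Q.coef 1 1 - Q.coef 0 1 ^ 2))⁻¹
  linear_combination (z 0 * (Q.coef 0 0 * z 0 + Q.coef 0 1 * z 1) +
    z 1 * (Q.coef 0 1 * z 0 + Q.coef 1 1 * z 1)) * (ht + Real.sin t ^ 2 * h)

theorem det_complexRotation (t : ℝ) :
    LinearMap.det (complexRotation Q.rot t : Plane →ₗ[ℝ] Plane) = 1 := by
  have h := Q.inv_sqrt_det_sq
  have ht := Real.sin_sq_add_cos_sq t
  have : (complexRotation Q.rot t : Plane →ₗ[ℝ] Plane) = Matrix.toEuclideanLin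
      (Real.cos t • (1 : Matrix (Fin 2) (Fin 2) ℝ) + Real.sin t •
        ((√Q.det)⁻¹ • !![-Q.coef 1 0, -Q.coef 1 1; Q.coef 0 0, Q.coef 0 1])) := by
    rw [← Matrix.coe_toEuclideanCLM_eq_toEuclideanLin, map_add, map_smul, map_smul, map_one]
    rfl
  rw [this, LinearMap.det_toLpLin, Matrix.det_fin_two]
  simp
  simp only [det, Q.symm] at h ⊢
  linear_combination ht + Real.sin t ^ 2 * h

theorem measurePreserving_complexRotation (t : ℝ) :
    MeasurePreserving (complexRotation Q.rot t) := by
  refine ⟨(complexRotation Q.rot t).continuous.measurable, ?_⟩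
  have h := Measure.map_linearMap_addHaar_eq_smul_addHaar (volume : Measure Plane)
    (f := (complexRotation Q.rot t : Plane →ₗ[ℝ] Plane))
    (by rw [det_complexRotation]; exact one_ne_zero)
  rw [det_complexRotation] at h
  simpa using h

/-- The linear map with `|A z|² = Q z` obtained from the Cholesky decomposition. -/
def cholesky : Plane →ₗ[ℝ] Plane :=
  Matrix.toEuclideanLin !![√(Q.coef 0 0), Q.coef 0 1 / √(Q.coef 0 0); 0, √(Q.det / Q.coef 0 0)]

theorem det_cholesky : LinearMap.det Q.cholesky = √Q.det := by
  rw [cholesky, LinearMap.det_toLpLin, Matrix.det_fin_two]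
  simp
  rw [← Real.sqrt_mul Q.pos.le, mul_div_cancel₀ _ Q.pos.ne']

theorem norm_cholesky_sq (z : Plane) : ‖Q.cholesky z‖ ^ 2 = Q.eval z := by
  have h0 := Q.pos
  have h1 : √(Q.coef 0 0) ^ 2 = Q.coef 0 0 := Real.sq_sqrt h0.le
  have h2 : √(Q.det / Q.coef 0 0) ^ 2 = Q.det / Q.coef 0 0 :=
    Real.sq_sqrt (div_nonneg Q.det_pos.le h0.le)
  have h3 : √(Q.coef 0 0) ≠ 0 := (Real.sqrt_pos.2 h0).ne'
  rw [EuclideanSpace.real_norm_sq_eq, Fin.sum_univ_two]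
  simp only [cholesky, Matrix.toLpLin_apply]
  simp [Matrix.mulVec, dotProduct, Fin.sum_univ_two]
  rw [mul_pow, h2]
  simp only [eval, grad, det, Q.symm]
  have h4 : (√(Q.coef 0 0) * z 0 + Q.coef 0 1 / √(Q.coef 0 0) * z 1) ^ 2 =
      Q.coef 0 0 * z 0 ^ 2 + 2 * Q.coef 0 1 * z 0 * z 1
        + Q.coef 0 1 ^ 2 / Q.coef 0 0 * z 1 ^ 2 := by
    generalize √(Q.coef 0 0) = s at h1 h3
    rw [← h1]
    field_simp
    ring
  rw [h4]
  field_simp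
  ring

/-- The total mass of the smoothed Dirac mass `β (Q z)`. -/
theorem integral_deltaProfile_eval :
    ∫ z : Plane, deltaProfile (Q.eval z) = 2 * Real.pi / √Q.det := by
  have hdet : LinearMap.det Q.cholesky ≠ 0 := by rw [det_cholesky]; exact Q.sqrt_det_pos.ne'
  have h := Measure.map_linearMap_addHaar_eq_smul_addHaar (volume : Measure Plane) hdet
  have hc : Continuous Q.cholesky := Q.cholesky.continuous_of_finiteDimensional
  have hi := integral_map (μ := (volume : Measure Plane)) hc.aemeasurable
    (f := fun z => deltaProfile (‖z‖ ^ 2))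
    (continuous_deltaProfile.comp (by fun_prop)).aestronglyMeasurable
  simp only [norm_cholesky_sq] at hi
  rw [← hi, h, integral_smul_measure, integral_deltaProfile_norm_sq, det_cholesky,
    ENNReal.toReal_ofReal (abs_nonneg _), abs_of_pos (inv_pos.2 Q.sqrt_det_pos), smul_eq_mul]
  ring

end PosForm

end Forms

/-! ### The double divergence identity -/

section Smooth

variable {V : Type*} [NormedAddCommGroup V] [InnerProductSpace ℝ V]

/-- The classical `i`-th partial derivative. -/
def partialD {W : Type*} [NormedAddCommGroup W] [NormedSpace ℝ W] (i : Fin 2) (F : Plane → W)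
    (y : Plane) : W := fderiv ℝ F y (planeBasis i)

/-- The second partial derivatives of a function on the plane. -/
def hess (ψ : Plane → ℝ) (y : Plane) (i j : Fin 2) : ℝ := partialD j (partialD i ψ) y

/-- The pairing of a matrix with the cofactor matrix of another one. -/
def cofactorPairing (h k : Fin 2 → Fin 2 → ℝ) : ℝ :=
  h 0 0 * k 1 1 - h 0 1 * k 0 1 - h 1 0 * k 1 0 + h 1 1 * k 0 0

section partialD
variable {W : Type*} [NormedAddCommGroup W] [NormedSpace ℝ W]

theorem contDiff_partialD {F : Plane → W} (hF : ContDiff ℝ ∞ F) (i : Fin 2) :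
    ContDiff ℝ ∞ (partialD i F) :=
  (hF.fderiv_right (m := ∞) (by simp)).clm_apply contDiff_const

theorem partialD_comm {F : Plane → W} (hF : ContDiff ℝ ∞ F) (i j : Fin 2) (y : Plane) :
    partialD j (partialD i F) y = partialD i (partialD j F) y := by
  have hsymm : IsSymmSndFDerivAt ℝ F y := hF.contDiffAt.isSymmSndFDerivAt (by
    rw [minSmoothness_of_isRCLikeNormedField]
    exact WithTop.coe_le_coe.2 le_top)
  have hd : DifferentiableAt ℝ (fderiv ℝ F) y :=
    (hF.fderiv_right (m := ∞) (by simp)).differentiable (by simp) y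
  have h : ∀ i j, partialD j (partialD i F) y = fderiv ℝ (fderiv ℝ F) y (planeBasis j)
      (planeBasis i) := by
    intro i j
    change fderiv ℝ (fun w => fderiv ℝ F w (planeBasis i)) y (planeBasis j) = _
    rw [fderiv_clm_apply hd (differentiableAt_const _)]
    simp
  rw [h, h]
  exact hsymm _ _

theorem hasCompactSupport_partialD {F : Plane → W} (hF : HasCompactSupport F) (i : Fin 2) :
    HasCompactSupport (partialD i F) :=
  hF.fderiv_apply (𝕜 := ℝ) _

theorem planeBasis_sum (v : Plane) : v = v 0 • planeBasis 0 + v 1 • planeBasis 1 := by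
  ext i
  fin_cases i <;> simp [planeBasis]

theorem fderiv_apply_eq_partialD (F : Plane → W) (y v : Plane) :
    fderiv ℝ F y v = v 0 • partialD 0 F y + v 1 • partialD 1 F y := by
  conv_lhs => rw [planeBasis_sum v]
  simp [partialD]

end partialD

theorem integral_mul_partialD {h p : Plane → ℝ} (hh : ContDiff ℝ ∞ h) (hp : ContDiff ℝ ∞ p)
    (hpc : HasCompactSupport p) (i : Fin 2) :
    ∫ y, h y * partialD i p y = -∫ y, partialD i h y * p y := by
  have hh' := (contDiff_partialD hh i).continuous
  have hp' := (contDiff_partialD hp i).continuous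
  refine integral_mul_fderiv_eq_neg_fderiv_mul_of_integrable ?_ ?_ ?_
    (fun y _ => hh.differentiable (by simp) y) (fun y _ => hp.differentiable (by simp) y)
  · exact (hh'.mul hp.continuous).integrable_of_hasCompactSupport hpc.mul_left
  · exact (hh.continuous.mul hp').integrable_of_hasCompactSupport
      (hasCompactSupport_partialD hpc i).mul_left
  · exact (hh.continuous.mul hp.continuous).integrable_of_hasCompactSupport hpc.mul_left

theorem partialD_inner {F G : Plane → V} (hF : ContDiff ℝ ∞ F) (hG : ContDiff ℝ ∞ G)
    (i : Fin 2) (y : Plane) : partialD i (fun w => inner ℝ (F w) (G w)) y =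
      inner ℝ (partialD i F y) (G y) + inner ℝ (F y) (partialD i G y) := by
  rw [partialD, fderiv_inner_apply ℝ (hF.differentiable (by simp) y)
    (hG.differentiable (by simp) y), add_comm]
  rfl

/-- The second-order expression `∂₁∂₁h₀₀ - 2∂₀∂₁h₀₁ + ∂₀∂₀h₁₁` in the metric
`hᵢⱼ = ⟨∂ᵢF, ∂ⱼG⟩` is a sum of Jacobian determinants: after integration by parts only
derivatives of `∂G` along the vector field `∂₀ψ ∂₁ - ∂₁ψ ∂₀`, tangent to the level lines of the
test function `ψ`, are left. -/
theorem integral_cofactorPairing_hess {F G : Plane → V} (hF : ContDiff ℝ ∞ F)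
    (hG : ContDiff ℝ ∞ G) {ψ : Plane → ℝ} (hψ : ContDiff ℝ ∞ ψ) (hψc : HasCompactSupport ψ) :
    ∫ y, cofactorPairing (fun i j => inner ℝ (partialD i F y) (partialD j G y)) (hess ψ y) =
      (∫ y, inner ℝ (partialD 0 F y) (partialD 0 ψ y • partialD 1 (partialD 1 G) y
        - partialD 1 ψ y • partialD 0 (partialD 1 G) y)) -
      ∫ y, inner ℝ (partialD 1 F y) (partialD 0 ψ y • partialD 1 (partialD 0 G) y
        - partialD 1 ψ y • partialD 0 (partialD 0 G) y) := by
  have hF1 := fun i => contDiff_partialD hF i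
  have hG1 := fun i => contDiff_partialD hG i
  have hψ1 := fun i => contDiff_partialD hψ i
  have hψ1c := fun i => hasCompactSupport_partialD hψc i
  have hF1c := fun i => (hF1 i).continuous
  have hG1c := fun i => (hG1 i).continuous
  have hψ1cc := fun i => (hψ1 i).continuous
  have hF2c := fun i j => (contDiff_partialD (hF1 i) j).continuous
  have hG2c := fun i j => (contDiff_partialD (hG1 i) j).continuous
  have hψ2c := fun i j => (contDiff_partialD (hψ1 i) j).continuous
  have hh : ∀ i j, ContDiff ℝ ∞ fun y => (inner ℝ (partialD i F y) (partialD j G y) : ℝ) :=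
    fun i j => (hF1 i).inner ℝ (hG1 j)
  -- the integral of a derivative vanishes
  set T : Fin 2 → Fin 2 → Fin 2 → Fin 2 → Plane → ℝ := fun i j k l y =>
    inner ℝ (partialD i F y) (partialD j G y) * partialD l (partialD k ψ) y +
      (inner ℝ (partialD l (partialD i F) y) (partialD j G y)
        + inner ℝ (partialD i F y) (partialD l (partialD j G) y)) * partialD k ψ y with hT
  have int1 : ∀ i j k l, Integrable fun y =>
      inner ℝ (partialD i F y) (partialD j G y) * partialD l (partialD k ψ) y := fun i j k l =>
    (((hF1c i).inner (hG1c j)).mul (hψ2c k l)).integrable_of_hasCompactSupport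
      (hasCompactSupport_partialD (hψ1c k) l).mul_left
  have int2 : ∀ i j k l, Integrable fun y => (inner ℝ (partialD l (partialD i F) y) (partialD j G y)
        + inner ℝ (partialD i F y) (partialD l (partialD j G) y)) * partialD k ψ y :=
    fun i j k l => ((((hF2c i l).inner (hG1c j)).add ((hF1c i).inner (hG2c j l))).mul
      (hψ1cc k)).integrable_of_hasCompactSupport (hψ1c k).mul_left
  have intT : ∀ i j k l, Integrable (T i j k l) := fun i j k l => (int1 i j k l).add (int2 i j k l)
  have hT0 : ∀ i j k l, ∫ y, T i j k l y = 0 := by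
    intro i j k l
    rw [hT, integral_add (int1 i j k l) (int2 i j k l),
      integral_mul_partialD (hh i j) (hψ1 k) (hψ1c k)]
    simp only [partialD_inner (hF1 i) (hG1 j)]
    ring
  set J : Fin 2 → Fin 2 → Plane → ℝ := fun i j y => inner ℝ (partialD i F y)
    (partialD 0 ψ y • partialD 1 (partialD j G) y
      - partialD 1 ψ y • partialD 0 (partialD j G) y) with hJ
  have int3 : ∀ i j, Integrable (J i j) := by
    intro i j
    refine ((hF1c i).inner (((hψ1cc 0).smul (hG2c j 1)).sub
      ((hψ1cc 1).smul (hG2c j 0)))).integrable_of_hasCompactSupport ?_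
    refine ((hψ1c 0).isCompact.union (hψ1c 1).isCompact).of_isClosed_subset
      (isClosed_tsupport _) (closure_minimal (fun y hy => ?_)
        ((isClosed_tsupport _).union (isClosed_tsupport _)))
    by_contra h
    rw [mem_union, not_or] at h
    exact hy (by simp [hJ, image_eq_zero_of_notMem_tsupport h.1,
      image_eq_zero_of_notMem_tsupport h.2])
  have e : (fun y => cofactorPairing (fun i j => inner ℝ (partialD i F y) (partialD j G y))
      (hess ψ y)) = (J 0 1 - J 1 0) + (T 0 0 1 1 - T 0 1 0 1 - T 1 0 1 0 + T 1 1 0 0) := by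
    ext y
    simp only [hT, hJ, cofactorPairing, hess, inner_sub_right, inner_smul_right, Pi.add_apply,
      Pi.sub_apply]
    rw [partialD_comm hF 1 0 y, partialD_comm hG 1 0 y]
    ring
  change _ = (∫ y, J 0 1 y) - ∫ y, J 1 0 y
  rw [e, integral_add' ((int3 0 1).sub (int3 1 0)) ((((intT _ _ _ _).sub (intT _ _ _ _)).sub
    (intT _ _ _ _)).add (intT _ _ _ _)), integral_sub' (int3 0 1) (int3 1 0),
    integral_add' (((intT _ _ _ _).sub (intT _ _ _ _)).sub (intT _ _ _ _)) (intT _ _ _ _),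
    integral_sub' ((intT _ _ _ _).sub (intT _ _ _ _)) (intT _ _ _ _),
    integral_sub' (intT _ _ _ _) (intT _ _ _ _), hT0, hT0, hT0, hT0]
  ring

end Smooth

/-! ### The parametrix -/

section Green

/-- The parametrix at `x`: the fundamental solution, frozen at `x`, of the operator whose
coefficients form the cofactor matrix of `Q`, smoothed at scale `ε` and cut off at scale `R`. -/
def greenTest (Q : PosForm) (x : Plane) (ε R : ℝ) (y : Plane) : ℝ :=
  greenProfile ε R (Q.eval (y - x))

variable (Q : PosForm) (x : Plane) (ε R : ℝ)

theorem PosForm.contDiff_grad (i : Fin 2) : ContDiff ℝ ∞ fun z => Q.grad z i := by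
  unfold PosForm.grad
  fun_prop

theorem PosForm.contDiff_eval : ContDiff ℝ ∞ Q.eval := by
  unfold PosForm.eval PosForm.grad
  fun_prop

theorem PosForm.partialD_grad (x : Plane) (i j : Fin 2) (y : Plane) :
    partialD j (fun y => Q.grad (y - x) i) y = Q.coef i j := by
  have h : HasFDerivAt (fun y : Plane => Q.grad (y - x) i)
      (Q.coef i 0 • (EuclideanSpace.proj 0 : Plane →L[ℝ] ℝ)
        + Q.coef i 1 • (EuclideanSpace.proj 1 : Plane →L[ℝ] ℝ)) y := by
    have hp : ∀ k, HasFDerivAt (fun y : Plane => (y - x) k)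
        (EuclideanSpace.proj k : Plane →L[ℝ] ℝ) y := fun k =>
      ((EuclideanSpace.proj k : Plane →L[ℝ] ℝ).hasFDerivAt.sub_const (x k))
    exact ((hp 0).const_mul _).add ((hp 1).const_mul _)
  rw [partialD, h.fderiv]
  fin_cases j <;> simp [planeBasis]

theorem PosForm.partialD_eval (x : Plane) (i : Fin 2) (y : Plane) :
    partialD i (fun y => Q.eval (y - x)) y = 2 * Q.grad (y - x) i := by
  have hg : ∀ k, DifferentiableAt ℝ (fun y => Q.grad (y - x) k) y := fun k =>
    ((Q.contDiff_grad k).comp (contDiff_id.sub contDiff_const)).differentiable (by simp) y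
  have hp : ∀ k, HasFDerivAt (fun y : Plane => (y - x) k)
      (EuclideanSpace.proj k : Plane →L[ℝ] ℝ) y := fun k =>
    ((EuclideanSpace.proj k : Plane →L[ℝ] ℝ).hasFDerivAt.sub_const (x k))
  have h := ((hp 0).mul (hg 0).hasFDerivAt).add ((hp 1).mul (hg 1).hasFDerivAt)
  have hk : ∀ k, fderiv ℝ (fun y => Q.grad (y - x) k) y (planeBasis i)
      = Q.coef k i := fun k => Q.partialD_grad x k i y
  have e : partialD i (fun y => Q.eval (y - x)) y = _ :=
    congrArg (fun L : Plane →L[ℝ] ℝ => L (planeBasis i)) h.fderiv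
  rw [e]
  simp only [add_apply, smul_apply, hk, smul_eq_mul]
  fin_cases i <;> simp [planeBasis, PosForm.grad, Q.symm] <;> ring

theorem partialD_comp {g : ℝ → ℝ} {q : Plane → ℝ} {y : Plane} (hg : DifferentiableAt ℝ g (q y))
    (hq : DifferentiableAt ℝ q y) (i : Fin 2) :
    partialD i (fun y => g (q y)) y = deriv g (q y) * partialD i q y := by
  have h := hg.hasDerivAt.comp_hasFDerivAt y hq.hasFDerivAt
  have e : partialD i (fun y => g (q y)) y = _ :=
    congrArg (fun L : Plane →L[ℝ] ℝ => L (planeBasis i)) h.fderiv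
  rw [e]
  simp [partialD]

theorem contDiff_greenTest : ContDiff ℝ ∞ (greenTest Q x ε R) :=
  (contDiff_greenProfile ε R).comp (Q.contDiff_eval.comp (contDiff_id.sub contDiff_const))

theorem contDiff_deriv_greenProfile : ContDiff ℝ ∞ (deriv (greenProfile ε R)) :=
  (contDiff_infty_iff_deriv.1 (contDiff_greenProfile ε R)).2

theorem partialD_greenTest (i : Fin 2) (y : Plane) : partialD i (greenTest Q x ε R) y =
    2 * deriv (greenProfile ε R) (Q.eval (y - x)) * Q.grad (y - x) i := by
  have hq : Differentiable ℝ fun y => Q.eval (y - x) :=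
    (Q.contDiff_eval.comp (contDiff_id.sub contDiff_const)).differentiable (by simp)
  unfold greenTest
  rw [partialD_comp ((contDiff_greenProfile ε R).differentiable (by simp) _) (hq y),
    Q.partialD_eval]
  ring

theorem hess_greenTest (i j : Fin 2) (y : Plane) : hess (greenTest Q x ε R) y i j =
    4 * deriv (deriv (greenProfile ε R)) (Q.eval (y - x)) *
      (Q.grad (y - x) i * Q.grad (y - x) j)
      + 2 * deriv (greenProfile ε R) (Q.eval (y - x)) * Q.coef i j := by
  have hq : Differentiable ℝ fun y => Q.eval (y - x) :=
    (Q.contDiff_eval.comp (contDiff_id.sub contDiff_const)).differentiable (by simp)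
  have hg : Differentiable ℝ fun y => Q.grad (y - x) i :=
    ((Q.contDiff_grad i).comp (contDiff_id.sub contDiff_const)).differentiable (by simp)
  have hd : Differentiable ℝ (deriv (greenProfile ε R)) :=
    (contDiff_deriv_greenProfile ε R).differentiable (by simp)
  have he : partialD i (greenTest Q x ε R) = fun y =>
      2 * deriv (greenProfile ε R) (Q.eval (y - x)) * Q.grad (y - x) i :=
    funext fun y => partialD_greenTest Q x ε R i y
  have hdq : Differentiable ℝ fun y => deriv (greenProfile ε R) (Q.eval (y - x)) := hd.comp hq
  have h1 := (hdq y).hasFDerivAt.const_mul 2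
  have h2 := h1.mul (hg y).hasFDerivAt
  have e : partialD j (fun y => 2 * deriv (greenProfile ε R) (Q.eval (y - x)) * Q.grad (y - x) i) y
      = _ := congrArg (fun L : Plane →L[ℝ] ℝ => L (planeBasis j)) h2.fderiv
  rw [hess, he, e]
  have e1 : fderiv ℝ (fun y => deriv (greenProfile ε R) (Q.eval (y - x))) y (planeBasis j) =
      deriv (deriv (greenProfile ε R)) (Q.eval (y - x)) * (2 * Q.grad (y - x) j) := by
    rw [← Q.partialD_eval]
    exact partialD_comp (hd _) (hq y) j
  have e2 : fderiv ℝ (fun y => Q.grad (y - x) i) y (planeBasis j) = Q.coef i j :=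
    Q.partialD_grad x i j y
  simp only [add_apply, smul_apply, e1, e2, smul_eq_mul]
  ring

variable {ε R}

theorem greenTest_eq_zero (hε : 0 < ε) (hεR : ε ≤ R) {y : Plane} (hy : R ^ 2 ≤ Q.eval (y - x)) :
    greenTest Q x ε R y = 0 := greenProfile_of_le hε hεR hy

theorem PosForm.isCompact_eval_le (Q : PosForm) (c : ℝ) : IsCompact {z : Plane | Q.eval z ≤ c} := by
  refine Metric.isCompact_of_isClosed_isBounded
    (isClosed_le Q.contDiff_eval.continuous continuous_const) ?_
  refine (Metric.isBounded_closedBall (x := (0 : Plane)) (r := √(Q.tr * c / Q.det))).subset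
    fun z hz => ?_
  rw [mem_closedBall_zero_iff]
  refine Real.le_sqrt_of_sq_le ?_
  rw [le_div_iff₀ Q.det_positive, mul_comm]
  exact (Q.det_mul_norm_sq_le z).trans (mul_le_mul_of_nonneg_left hz Q.tr_pos.le)

theorem hasCompactSupport_greenTest (hε : 0 < ε) (hεR : ε ≤ R) :
    HasCompactSupport (greenTest Q x ε R) := by
  refine HasCompactSupport.intro ((Q.isCompact_eval_le (R ^ 2)).image
    (f := fun z => z + x) (by fun_prop)) fun y hy => ?_
  refine greenTest_eq_zero Q x hε hεR (le_of_not_ge fun h => hy ⟨y - x, h, by simp⟩)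

theorem deriv_greenProfile_of_lt (hε : 0 < ε) (hεR : ε ≤ R) {s : ℝ} (hs : R ^ 2 < s) :
    deriv (greenProfile ε R) s = 0 := by
  have : greenProfile ε R =ᶠ[𝓝 s] fun _ => 0 := by
    filter_upwards [Ioi_mem_nhds hs] with t ht
    exact greenProfile_of_le hε hεR (le_of_lt ht)
  rw [this.deriv_eq, deriv_const]

theorem deriv_deriv_greenProfile_of_lt (hε : 0 < ε) (hεR : ε ≤ R) {s : ℝ} (hs : R ^ 2 < s) :
    deriv (deriv (greenProfile ε R)) s = 0 := by
  have : deriv (greenProfile ε R) =ᶠ[𝓝 s] fun _ => 0 := by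
    filter_upwards [Ioi_mem_nhds hs] with t ht
    exact deriv_greenProfile_of_lt hε hεR ht
  rw [this.deriv_eq, deriv_const]

theorem hess_greenTest_eq_zero (hε : 0 < ε) (hεR : ε ≤ R) {y : Plane}
    (hy : R ^ 2 < Q.eval (y - x)) (i j : Fin 2) : hess (greenTest Q x ε R) y i j = 0 := by
  rw [hess_greenTest, deriv_greenProfile_of_lt hε hεR hy, deriv_deriv_greenProfile_of_lt hε hεR hy]
  ring

/-- The frozen operator maps the parametrix to the difference of two smoothed Dirac masses. -/
theorem cofactorPairing_hess_greenTest (ε R : ℝ) (y : Plane) :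
    cofactorPairing Q.coef (hess (greenTest Q x ε R) y) = Q.det *
      (deltaProfile (Q.eval (y - x) / ε ^ 2) / ε ^ 2
        - deltaProfile (Q.eval (y - x) / R ^ 2) / R ^ 2) := by
  rw [← four_mul_deriv_greenProfile]
  simp only [cofactorPairing, hess_greenTest, PosForm.det, PosForm.eval, PosForm.grad, Q.symm]
  ring

/-- The second derivatives of the parametrix are of order `|y - x|⁻²`, uniformly in the smoothing
scale `ε`. -/
theorem abs_hess_greenTest_mul_le {S : ℝ} (hS : ∀ t, |t * deriv logProfile t| ≤ S ∧
    |t ^ 2 * deriv (deriv logProfile) t| ≤ S) (ε R : ℝ) (y : Plane) (i j : Fin 2) :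
    |hess (greenTest Q x ε R) y i j| * ‖y - x‖ ^ 2 ≤ 12 * S * Q.tr ^ 2 / Q.det := by
  obtain ⟨h1, h2⟩ := greenProfile_bound hS ε R (Q.eval (y - x))
  have hg := Q.abs_grad_mul_grad_le (y - x) i j
  have hc := Q.abs_coef_le i j
  have hq := Q.eval_nonneg (y - x)
  have ht := Q.tr_pos
  rw [abs_mul, abs_of_nonneg hq] at h1
  rw [abs_mul, abs_of_nonneg (by positivity)] at h2
  set D1 := deriv (greenProfile ε R) (Q.eval (y - x))
  set D2 := deriv (deriv (greenProfile ε R)) (Q.eval (y - x))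
  set q := Q.eval (y - x)
  have key : |hess (greenTest Q x ε R) y i j| * q ≤ 12 * S * Q.tr := by
    rw [hess_greenTest]
    calc _ ≤ (4 * |D2| * (Q.tr * q) + 2 * |D1| * Q.tr) * q := by
          refine mul_le_mul_of_nonneg_right ((abs_add_le _ _).trans ?_) hq
          simp only [abs_mul]
          rw [← abs_mul (Q.grad _ _)]
          simp only [Nat.abs_ofNat]
          gcongr
      _ = (4 * (q ^ 2 * |D2|) + 2 * (q * |D1|)) * Q.tr := by ring
      _ ≤ (4 * (2 * S) + 2 * (2 * S)) * Q.tr := by gcongr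
      _ = _ := by ring
  rw [le_div_iff₀ Q.det_positive]
  calc _ = |hess (greenTest Q x ε R) y i j| * (Q.det * ‖y - x‖ ^ 2) := by ring
    _ ≤ |hess (greenTest Q x ε R) y i j| * (Q.tr * q) :=
      mul_le_mul_of_nonneg_left (Q.det_mul_norm_sq_le _) (abs_nonneg _)
    _ = (|hess (greenTest Q x ε R) y i j| * q) * Q.tr := by ring
    _ ≤ (12 * S * Q.tr) * Q.tr := mul_le_mul_of_nonneg_right key ht.le
    _ = _ := by ring

end Green

/-! ### Wente's estimate for smooth maps -/

section SmoothEstimate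

variable {V : Type*} [NormedAddCommGroup V] [InnerProductSpace ℝ V]

/-- Wente's estimate for a single Jacobian determinant tested with the parametrix `ψ`: the vector
field `∂₀ψ ∂₁ - ∂₁ψ ∂₀` is `κ N`, where `N` is the complex structure of `Q` and `κ` is a function
of the values of `Q`, which is invariant under the rotations generated by `N`. -/
theorem abs_integral_inner_greenTest_le (Q : PosForm) (x : Plane) {ε R ρ S : ℝ} (hε : 0 < ε)
    (hεR : ε ≤ R) (hρ : ∀ z, Q.eval z ≤ R ^ 2 → ‖z‖ < ρ)
    (hS : ∀ t, |t * deriv logProfile t| ≤ S ∧ |t ^ 2 * deriv (deriv logProfile) t| ≤ S)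
    {a b : Plane → V} (ha : ContDiff ℝ ∞ a) (hb : ContDiff ℝ ∞ b) {A B : ℝ} (hA : 0 ≤ A)
    (hB : 0 ≤ B) (hDa : ∫ y in Metric.ball x ρ, ‖fderiv ℝ a y‖ ^ 2 ≤ A ^ 2)
    (hDb : ∫ y in Metric.ball x ρ, ‖fderiv ℝ b y‖ ^ 2 ≤ B ^ 2) :
    |∫ y, inner ℝ (a y) (partialD 0 (greenTest Q x ε R) y • partialD 1 b y
        - partialD 1 (greenTest Q x ε R) y • partialD 0 b y)| ≤
      2 * Real.pi * (4 * S * Q.tr / √Q.det * (A * B)) := by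
  have hcl := contDiff_deriv_greenProfile ε R
  set κ : Plane → ℝ := fun z => 2 * √Q.det * deriv (greenProfile ε R) (Q.eval z) with hκ
  have hκ0 : ∀ z, R ^ 2 < Q.eval z → κ z = 0 := fun z hz => by
    simp [hκ, deriv_greenProfile_of_lt hε hεR hz]
  have hκc : Continuous κ := continuous_const.mul (hcl.continuous.comp Q.contDiff_eval.continuous)
  have hκs : HasCompactSupport κ := HasCompactSupport.intro (Q.isCompact_eval_le (R ^ 2))
    fun z hz => hκ0 z (not_le.1 hz)
  have htrans : ∀ {c : Plane → V}, ContDiff ℝ ∞ c → ∀ {C : ℝ},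
      ∫ y in Metric.ball x ρ, ‖fderiv ℝ c y‖ ^ 2 ≤ C ^ 2 →
      ∫ z in Function.support κ, ‖fderiv ℝ (fun z => c (x + z)) z‖ ^ 2 ≤ C ^ 2 := by
    intro c hc C hC
    refine le_trans ?_ hC
    have hcc : Continuous fun y => ‖fderiv ℝ c y‖ ^ 2 :=
      (hc.continuous_fderiv (by simp)).norm.pow 2
    have e1 := (measurePreserving_add_left (volume : Measure Plane) x).setIntegral_preimage_emb
      (measurableEmbedding_addLeft x) (fun y => ‖fderiv ℝ c y‖ ^ 2) (Metric.ball x ρ)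
    rw [← e1]
    simp only [fderiv_comp_add_left]
    refine setIntegral_mono_set ?_ (Eventually.of_forall fun _ => by positivity)
      (Eventually.of_forall fun z hz => ?_)
    · refine ((hcc.comp (continuous_const_add x)).continuousOn.integrableOn_compact
        (isCompact_closedBall (0 : Plane) ρ)).mono_set fun z hz => ?_
      have : ‖z‖ < ρ := by simpa using hz
      simpa using this.le
    · have : ‖z‖ < ρ := hρ z (le_of_not_gt fun h => hz (hκ0 z h))
      change x + z ∈ Metric.ball x ρ
      simpa using this
  have hw := abs_integral_inner_rotation_le (N := Q.rot) Q.rot_rot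
    Q.measurePreserving_complexRotation hκc hκs
    (fun t y => by simp only [hκ, Q.eval_complexRotation]) (S := 4 * S * Q.tr / √Q.det) ?_
    (a := fun z => a (x + z)) (b := fun z => b (x + z))
    ((ha.comp (contDiff_const.add contDiff_id)).of_le (by simp))
    ((hb.comp (contDiff_const.add contDiff_id)).of_le (by simp))
    hA hB (htrans ha hDa) (htrans hb hDb)
  · refine le_trans (le_of_eq ?_) hw
    rw [← integral_add_left_eq_self _ x]
    congr 2 with z
    rw [fderiv_comp_add_left, fderiv_apply_eq_partialD, partialD_greenTest, partialD_greenTest,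
      Q.rot_zero, Q.rot_one, ← inner_smul_right]
    congr 1
    simp only [add_sub_cancel_left, smul_add, smul_smul, hκ]
    have e := Q.sqrt_det_pos.ne'
    have e1 : 2 * √Q.det * deriv (greenProfile ε R) (Q.eval z) * ((√Q.det)⁻¹ * Q.grad z 0)
        = 2 * deriv (greenProfile ε R) (Q.eval z) * Q.grad z 0 := by field_simp
    have e2 : 2 * √Q.det * deriv (greenProfile ε R) (Q.eval z) * (-(√Q.det)⁻¹ * Q.grad z 1)
        = -(2 * deriv (greenProfile ε R) (Q.eval z) * Q.grad z 1) := by field_simp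
    rw [e1, e2, neg_smul]
    abel
  · intro t z
    have h1 := (greenProfile_bound hS ε R (Q.eval z)).1
    have hq := Q.eval_nonneg z
    have hd := Q.det_positive
    have ht := Q.tr_pos
    rw [abs_mul, abs_of_nonneg hq] at h1
    have n1 := Q.norm_rot_sq z
    have n2 := Q.norm_rot_sq (complexRotation Q.rot t z)
    rw [Q.eval_complexRotation] at n2
    have n3 : ‖Q.rot z‖ * ‖Q.rot (complexRotation Q.rot t z)‖ ≤ Q.tr / Q.det * Q.eval z := by
      nlinarith [sq_nonneg (‖Q.rot z‖ - ‖Q.rot (complexRotation Q.rot t z)‖)]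
    have hs := Q.sqrt_det_pos
    calc _ = |κ z| * (‖Q.rot z‖ * ‖Q.rot (complexRotation Q.rot t z)‖) := by ring
      _ ≤ |κ z| * (Q.tr / Q.det * Q.eval z) := mul_le_mul_of_nonneg_left n3 (abs_nonneg _)
      _ = 2 * (√Q.det / Q.det) * Q.tr * (Q.eval z * |deriv (greenProfile ε R) (Q.eval z)|) := by
          simp only [hκ, abs_mul, Nat.abs_ofNat, abs_of_pos hs]
          ring
      _ ≤ 2 * (√Q.det / Q.det) * Q.tr * (2 * S) := by gcongr
      _ = 4 * S * Q.tr / √Q.det := by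
          rw [Real.sqrt_div_self']
          ring

/-- The double divergence of `⟨∂ᵢF, ∂ⱼG⟩`, tested with the parametrix, is bounded by the `L²`-norms
of the second derivatives, uniformly in the smoothing scale `ε`. -/
theorem abs_integral_cofactorPairing_hess_greenTest_le (Q : PosForm) (x : Plane) {ε R ρ S : ℝ}
    (hε : 0 < ε) (hεR : ε ≤ R) (hρ : ∀ z, Q.eval z ≤ R ^ 2 → ‖z‖ < ρ)
    (hS : ∀ t, |t * deriv logProfile t| ≤ S ∧ |t ^ 2 * deriv (deriv logProfile) t| ≤ S)
    {F G : Plane → V} (hF : ContDiff ℝ ∞ F) (hG : ContDiff ℝ ∞ G) {A B : ℝ} (hA : 0 ≤ A)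
    (hB : 0 ≤ B)
    (hDF : ∀ i, ∫ y in Metric.ball x ρ, ‖fderiv ℝ (partialD i F) y‖ ^ 2 ≤ A ^ 2)
    (hDG : ∀ i, ∫ y in Metric.ball x ρ, ‖fderiv ℝ (partialD i G) y‖ ^ 2 ≤ B ^ 2) :
    |∫ y, cofactorPairing (fun i j => inner ℝ (partialD i F y) (partialD j G y))
        (hess (greenTest Q x ε R) y)| ≤ 16 * Real.pi * S * Q.tr / √Q.det * (A * B) := by
  rw [integral_cofactorPairing_hess hF hG (contDiff_greenTest Q x ε R)
    (hasCompactSupport_greenTest Q x hε hεR)]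
  refine (abs_sub _ _).trans ((add_le_add
    (abs_integral_inner_greenTest_le Q x hε hεR hρ hS (contDiff_partialD hF 0)
      (contDiff_partialD hG 1) hA hB (hDF 0) (hDG 1))
    (abs_integral_inner_greenTest_le Q x hε hεR hρ hS (contDiff_partialD hF 1)
      (contDiff_partialD hG 0) hA hB (hDF 1) (hDG 0))).trans (le_of_eq ?_))
  ring

end SmoothEstimate

/-! ### Mollification of weakly differentiable maps -/

section Mollification

variable {V : Type*} [NormedAddCommGroup V] [InnerProductSpace ℝ V]

/-- The mollification of the restriction of `F` to the compact set `K`. -/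
def mollify (φ : ContDiffBump (0 : Plane)) (K : Set Plane) (F : Plane → V) (y : Plane) : V :=
  ∫ t, φ.normed volume (y - t) • K.indicator F t

variable {φ : ContDiffBump (0 : Plane)} {K : Set Plane} {F G : Plane → V}

theorem mollify_eq_convolution (φ : ContDiffBump (0 : Plane)) (K : Set Plane) (F : Plane → V) :
    mollify φ K F = convolution (φ.normed volume) (K.indicator F)
      (ContinuousLinearMap.lsmul ℝ ℝ) volume := by
  ext1 y
  rw [convolution_lsmul_swap]
  rfl

theorem contDiff_mollify [CompleteSpace V] (φ : ContDiffBump (0 : Plane))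
    (hK : MeasurableSet K) (hF : IntegrableOn F K) : ContDiff ℝ ∞ (mollify φ K F) := by
  rw [mollify_eq_convolution]
  exact φ.hasCompactSupport_normed.contDiff_convolution_left _ φ.contDiff_normed
    ((integrable_indicator_iff hK).2 hF).locallyIntegrable

theorem fderiv_mollify_apply [CompleteSpace V] (φ : ContDiffBump (0 : Plane))
    (hK : MeasurableSet K) (hF : IntegrableOn F K) (y e : Plane) :
    fderiv ℝ (mollify φ K F) y e =
      ∫ t, fderiv ℝ (φ.normed volume) (y - t) e • K.indicator F t := by
  have hloc : LocallyIntegrable (K.indicator F) :=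
    ((integrable_indicator_iff hK).2 hF).locallyIntegrable
  have h := φ.hasCompactSupport_normed.hasFDerivAt_convolution_right
    (ContinuousLinearMap.lsmul ℝ ℝ).flip hloc (φ.contDiff_normed (μ := volume) (n := 1)) y
  rw [mollify_eq_convolution, ← convolution_flip, h.fderiv, convolution_precompR_apply _ hloc
    (φ.hasCompactSupport_normed.fderiv ℝ)
    ((φ.contDiff_normed (μ := volume) (n := 1)).continuous_fderiv one_ne_zero)]
  rfl

/-- Mollification commutes with weak differentiation, at points whose distance to the complement
of `K` exceeds the radius of the mollifier. -/
theorem partialD_mollify [CompleteSpace V] {U : Set Plane} {i : Fin 2}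
    (h : IsWeakPartial U i F G) (hK : IsCompact K) (hKU : K ⊆ U) {y : Plane}
    (hy : Metric.closedBall y φ.rOut ⊆ K) :
    partialD i (mollify φ K F) y = mollify φ K G y := by
  have hFK : IntegrableOn F K := h.locInt.integrableOn_compact_subset hKU hK
  set ζ : Plane → ℝ := fun t => φ.normed volume (y - t) with hζ
  have hφs : ContDiff ℝ ∞ (φ.normed volume) := φ.contDiff_normed
  have hζs : ContDiff ℝ ∞ ζ := hφs.comp (contDiff_const.sub contDiff_id)
  have hζ0 : ∀ t, t ∉ Metric.closedBall y φ.rOut → ζ t = 0 := by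
    intro t ht
    refine image_eq_zero_of_notMem_tsupport (f := φ.normed volume) ?_
    rw [φ.tsupport_normed_eq]
    simpa [dist_eq_norm, norm_sub_rev] using ht
  have hζt : tsupport ζ ⊆ Metric.closedBall y φ.rOut :=
    closure_minimal (fun t ht => by by_contra h; exact ht (hζ0 t h)) Metric.isClosed_closedBall
  have hζc : HasCompactSupport ζ := HasCompactSupport.intro (isCompact_closedBall y φ.rOut) hζ0
  have hd : ∀ t, fderiv ℝ ζ t (planeBasis i)
      = -fderiv ℝ (φ.normed volume) (y - t) (planeBasis i) := by
    intro t
    have h1 := ((hφs.differentiable (by simp) (y - t)).hasFDerivAt).comp t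
      ((hasFDerivAt_const y t).sub (hasFDerivAt_id t))
    have h2 : fderiv ℝ ζ t = _ := h1.fderiv
    rw [h2]
    simp
  have hb := h.byParts ζ hζs hζc (hζt.trans (hy.trans hKU))
  rw [partialD, fderiv_mollify_apply φ hK.measurableSet hFK, mollify]
  have e1 : ∫ t in U, fderiv ℝ ζ t (planeBasis i) • F t =
      -∫ t, fderiv ℝ (φ.normed volume) (y - t) (planeBasis i) • K.indicator F t := by
    rw [setIntegral_eq_integral_of_forall_compl_eq_zero, ← integral_neg]
    · congr 1 with t
      rw [hd]
      by_cases ht : t ∈ K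
      · rw [indicator_of_mem ht, neg_smul]
      · have : fderiv ℝ ζ t = 0 := by
          refine image_eq_zero_of_notMem_tsupport (f := fderiv ℝ ζ) fun h' => ht ?_
          exact hy (hζt (tsupport_fderiv_subset ℝ h'))
        rw [indicator_of_notMem ht, ← neg_smul, ← hd, this]
        simp
    · intro t ht
      have : fderiv ℝ ζ t = 0 := by
        refine image_eq_zero_of_notMem_tsupport (f := fderiv ℝ ζ) fun h' => ht ?_
        exact hKU (hy (hζt (tsupport_fderiv_subset ℝ h')))
      simp [this]
  have e2 : ∫ t in U, ζ t • G t = ∫ t, φ.normed volume (y - t) • K.indicator G t := by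
    rw [setIntegral_eq_integral_of_forall_compl_eq_zero]
    · congr 1 with t
      by_cases ht : t ∈ K
      · rw [indicator_of_mem ht]
      · rw [hζ0 t fun h' => ht (hy h'), indicator_of_notMem ht]
        simp
    · intro t ht
      rw [hζ0 t fun h' => ht (hKU (hy h')), zero_smul]
  rw [e1, e2, neg_inj] at hb
  exact hb

theorem integrable_normed_sub (φ : ContDiffBump (0 : Plane)) (y : Plane) :
    Integrable fun t => φ.normed volume (y - t) :=
  (φ.integrable_normed (μ := volume)).comp_sub_left y

theorem integral_normed_sub (φ : ContDiffBump (0 : Plane)) (y : Plane) :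
    ∫ t, φ.normed volume (y - t) = 1 := by
  rw [integral_sub_left_eq_self (φ.normed volume) volume y, φ.integral_normed]

theorem norm_mollify_le {M : ℝ} (hM : 0 ≤ M) (hK : MeasurableSet K)
    (hF : ∀ᵐ t ∂(volume.restrict K), ‖F t‖ ≤ M) (y : Plane) : ‖mollify φ K F y‖ ≤ M := by
  calc ‖mollify φ K F y‖ ≤ ∫ t, φ.normed volume (y - t) * M := by
        refine norm_integral_le_of_norm_le ((integrable_normed_sub φ y).mul_const M) ?_
        filter_upwards [(ae_restrict_iff' hK).1 hF] with t ht
        rw [norm_smul, Real.norm_of_nonneg (φ.nonneg_normed _)]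
        refine mul_le_mul_of_nonneg_left ?_ (φ.nonneg_normed _)
        by_cases h : t ∈ K
        · rw [indicator_of_mem h]; exact ht h
        · rw [indicator_of_notMem h, norm_zero]; exact hM
    _ = M := by rw [integral_mul_const, integral_normed_sub, one_mul]

/-- Mollification does not increase the `L²`-norm. -/
theorem setIntegral_norm_mollify_sq_le (hK : IsCompact K)
    (hF : MemLp F 2 (volume.restrict K)) (φ : ContDiffBump (0 : Plane)) (E : Set Plane) :
    IntegrableOn (fun y => ‖mollify φ K F y‖ ^ 2) E ∧
      ∫ y in E, ‖mollify φ K F y‖ ^ 2 ≤ ∫ t in K, ‖F t‖ ^ 2 := by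
  have hfin : IsFiniteMeasure (volume.restrict K) := ⟨by simpa using hK.measure_lt_top⟩
  have hF1 : Integrable (K.indicator F) :=
    (integrable_indicator_iff hK.measurableSet).2 (hF.integrable (by norm_num))
  set N : Plane → ℝ := fun t => ‖K.indicator F t‖ with hN
  have hNi : Integrable N := hF1.norm
  have hN2 : (fun t => N t ^ 2) = K.indicator fun t => ‖F t‖ ^ 2 := by
    ext t
    by_cases h : t ∈ K <;> simp [hN, h]
  have hN2i : Integrable fun t => N t ^ 2 := by
    rw [hN2]
    exact (integrable_indicator_iff hK.measurableSet).2 hF.norm.integrable_sq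
  set P : Plane → ℝ := fun y => ∫ t, φ.normed volume (y - t) * N t ^ 2 with hP
  have hPc : P = convolution (φ.normed volume) (fun t => N t ^ 2)
      (ContinuousLinearMap.lsmul ℝ ℝ) volume := by
    ext y
    rw [convolution_lsmul_swap]
    rfl
  have hPi : Integrable P := by
    rw [hPc]
    exact (φ.integrable_normed (μ := volume)).integrable_convolution _ hN2i
  have hPint : ∫ y, P y = ∫ t in K, ‖F t‖ ^ 2 := by
    rw [hPc, integral_convolution _ (φ.integrable_normed (μ := volume)) hN2i, φ.integral_normed,
      hN2, integral_indicator hK.measurableSet]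
    simp
  -- multiplication by a bounded continuous function preserves integrability
  have hbd : ∀ {k : Plane → ℝ}, Integrable k → ∀ y,
      Integrable fun t => φ.normed volume (y - t) * k t := by
    intro k hk y
    obtain ⟨C, hC⟩ := φ.hasCompactSupport_normed.exists_bound_of_continuous
      (φ.continuous_normed (μ := volume))
    exact hk.bdd_smul C ((φ.continuous_normed (μ := volume)).comp
      (continuous_const.sub continuous_id)).aestronglyMeasurable
      (Eventually.of_forall fun t => hC _)
  have hle : ∀ y, ‖mollify φ K F y‖ ^ 2 ≤ P y := by
    intro y
    set m : ℝ := ∫ t, φ.normed volume (y - t) * N t with hm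
    have h1 : ‖mollify φ K F y‖ ≤ m := by
      refine (norm_integral_le_integral_norm _).trans (le_of_eq ?_)
      congr 1 with t
      rw [norm_smul, Real.norm_of_nonneg (φ.nonneg_normed _)]
    -- the variance with respect to the probability density of the mollifier is nonnegative
    have h2 : 0 ≤ ∫ t, (φ.normed volume (y - t) * N t ^ 2
        - 2 * m * (φ.normed volume (y - t) * N t) + m ^ 2 * φ.normed volume (y - t)) := by
      refine integral_nonneg fun t => ?_
      have e : φ.normed volume (y - t) * N t ^ 2
        - 2 * m * (φ.normed volume (y - t) * N t) + m ^ 2 * φ.normed volume (y - t)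
        = φ.normed volume (y - t) * (N t - m) ^ 2 := by ring
      simp only [e]
      exact mul_nonneg (φ.nonneg_normed _) (sq_nonneg _)
    have i1 : Integrable fun t => φ.normed volume (y - t) * N t ^ 2 := hbd hN2i y
    have i2 : Integrable fun t => φ.normed volume (y - t) * N t := hbd hNi y
    have i3 : Integrable fun t => φ.normed volume (y - t) * N t ^ 2
        - 2 * m * (φ.normed volume (y - t) * N t) := i1.sub (i2.const_mul _)
    rw [integral_add i3 ((integrable_normed_sub φ y).const_mul _),
      integral_sub i1 (i2.const_mul _), integral_const_mul, integral_const_mul,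
      integral_normed_sub, ← hm] at h2
    have h3 : ‖mollify φ K F y‖ ^ 2 ≤ m ^ 2 := by gcongr
    have h4 : P y = ∫ t, φ.normed volume (y - t) * N t ^ 2 := rfl
    linarith
  have hmi : Integrable fun y => ‖mollify φ K F y‖ ^ 2 := by
    refine hPi.mono' ?_ (Eventually.of_forall fun y => ?_)
    · rw [mollify_eq_convolution]
      exact (((φ.integrable_normed (μ := volume)).integrable_convolution _
        hF1).aestronglyMeasurable.norm.pow 2)
    · rw [Real.norm_of_nonneg (by positivity)]
      exact hle y
  refine ⟨hmi.integrableOn, ?_⟩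
  calc _ ≤ ∫ y, ‖mollify φ K F y‖ ^ 2 :=
        setIntegral_le_integral hmi (Eventually.of_forall fun y => by positivity)
    _ ≤ ∫ y, P y := integral_mono hmi hPi hle
    _ = _ := hPint

theorem ae_tendsto_mollify [CompleteSpace V] (hK : MeasurableSet K) (hF : IntegrableOn F K)
    {φ : ℕ → ContDiffBump (0 : Plane)} (hφ : Tendsto (fun n => (φ n).rOut) atTop (𝓝 0))
    (hφ' : ∀ n, (φ n).rOut ≤ 2 * (φ n).rIn) :
    ∀ᵐ y ∂(volume.restrict K), Tendsto (fun n => mollify (φ n) K F y) atTop (𝓝 (F y)) := by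
  rw [ae_restrict_iff' hK]
  filter_upwards [ContDiffBump.ae_convolution_tendsto_right_of_locallyIntegrable
    (μ := volume) (K := 2) hφ (Eventually.of_forall hφ')
    ((integrable_indicator_iff hK).2 hF).locallyIntegrable] with y hy hyK
  simp only [mollify_eq_convolution]
  rw [indicator_of_mem hyK] at hy
  exact hy

end Mollification

/-! ### Wente's estimate for weakly differentiable maps -/

section WeakEstimate

variable {V : Type*} [NormedAddCommGroup V] [InnerProductSpace ℝ V]

/-- `F₁ i` and `F₂ i j` are weak first and second partial derivatives of `F` on `U`. -/
structure IsWeakJet (U : Set Plane) (F : Plane → V) (F₁ : Fin 2 → Plane → V)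
    (F₂ : Fin 2 → Fin 2 → Plane → V) : Prop where
  first : ∀ i, IsWeakPartial U i F (F₁ i)
  second : ∀ i j, IsWeakPartial U j (F₁ i) (F₂ i j)

theorem norm_fderiv_le (F : Plane → V) (y : Plane) :
    ‖fderiv ℝ F y‖ ≤ ‖partialD 0 F y‖ + ‖partialD 1 F y‖ := by
  refine ContinuousLinearMap.opNorm_le_bound _ (by positivity) fun v => ?_
  rw [fderiv_apply_eq_partialD]
  refine (norm_add_le _ _).trans ?_
  rw [norm_smul, norm_smul, add_mul, mul_comm, mul_comm ‖v 1‖]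
  gcongr <;> exact PiLp.norm_apply_le v _

theorem setIntegral_fderiv_mollify_sq_le [CompleteSpace V] {U K : Set Plane} (hK : IsCompact K)
    (hKU : K ⊆ U) {F : Plane → V} {F₁ : Fin 2 → Plane → V} {F₂ : Fin 2 → Fin 2 → Plane → V}
    (hF : IsWeakJet U F F₁ F₂) (hF₂ : ∀ i j, MemLp (F₂ i j) 2 (volume.restrict K)) {A : ℝ}
    (hA : ∀ i j, ∫ y in K, ‖F₂ i j y‖ ^ 2 ≤ A ^ 2) (φ : ContDiffBump (0 : Plane)) {x : Plane}
    {ρ : ℝ} (hx : ∀ y ∈ Metric.ball x ρ, Metric.closedBall y φ.rOut ⊆ K) (i : Fin 2) :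
    ∫ y in Metric.ball x ρ, ‖fderiv ℝ (partialD i (mollify φ K F)) y‖ ^ 2 ≤ (2 * A) ^ 2 := by
  have hsecond : ∀ j, ∀ y ∈ Metric.ball x ρ,
      partialD j (partialD i (mollify φ K F)) y = mollify φ K (F₂ i j) y := by
    intro j y hy
    have he : partialD i (mollify φ K F) =ᶠ[𝓝 y] mollify φ K (F₁ i) := by
      filter_upwards [Metric.isOpen_ball.mem_nhds hy] with w hw
      exact partialD_mollify (hF.first i) hK hKU (hx w hw)
    rw [partialD, he.fderiv_eq]
    exact partialD_mollify (hF.second i j) hK hKU (hx y hy)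
  have hm := fun j => setIntegral_norm_mollify_sq_le hK (hF₂ i j) φ (Metric.ball x ρ)
  have hs : ContDiff ℝ ∞ (partialD i (mollify φ K F)) :=
    contDiff_partialD (contDiff_mollify φ hK.measurableSet
      ((hF.first i).locInt.integrableOn_compact_subset hKU hK)) i
  calc _ ≤ ∫ y in Metric.ball x ρ, (2 * ‖mollify φ K (F₂ i 0) y‖ ^ 2
        + 2 * ‖mollify φ K (F₂ i 1) y‖ ^ 2) := by
        refine setIntegral_mono_on ?_ (((hm 0).1.const_mul 2).add ((hm 1).1.const_mul 2))
          measurableSet_ball fun y hy => ?_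
        · exact (((hs.continuous_fderiv (by simp)).norm.pow 2).continuousOn.integrableOn_compact
            (isCompact_closedBall x ρ)).mono_set Metric.ball_subset_closedBall
        · have h := norm_fderiv_le (partialD i (mollify φ K F)) y
          rw [hsecond 0 y hy, hsecond 1 y hy] at h
          have h0 := norm_nonneg (fderiv ℝ (partialD i (mollify φ K F)) y)
          nlinarith [sq_nonneg (‖mollify φ K (F₂ i 0) y‖ - ‖mollify φ K (F₂ i 1) y‖)]
    _ ≤ 2 * A ^ 2 + 2 * A ^ 2 := by
        rw [integral_add ((hm 0).1.const_mul 2) ((hm 1).1.const_mul 2), integral_const_mul,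
          integral_const_mul]
        have h0 := (hm 0).2.trans (hA i 0)
        have h1 := (hm 1).2.trans (hA i 1)
        linarith
    _ = _ := by ring

/-- Wente's estimate for weakly differentiable maps, by mollification. The boundedness of the first
derivatives allows dominated convergence on the left; the bound involves second derivatives only. -/
theorem abs_setIntegral_cofactorPairing_hess_greenTest_le [CompleteSpace V] (Q : PosForm)
    (x : Plane) {ε R ρ S : ℝ} (hε : 0 < ε) (hεR : ε ≤ R)
    (hρ : ∀ z, Q.eval z ≤ R ^ 2 → ‖z‖ < ρ)
    (hS : ∀ t, |t * deriv logProfile t| ≤ S ∧ |t ^ 2 * deriv (deriv logProfile) t| ≤ S)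
    {U K : Set Plane} (hK : IsCompact K) (hKU : K ⊆ U) {δ : ℝ} (hδ : 0 < δ)
    (hxK : ∀ y ∈ Metric.ball x ρ, Metric.closedBall y δ ⊆ K)
    {F G : Plane → V} {F₁ G₁ : Fin 2 → Plane → V} {F₂ G₂ : Fin 2 → Fin 2 → Plane → V}
    (hF : IsWeakJet U F F₁ F₂) (hG : IsWeakJet U G G₁ G₂)
    (hF₂ : ∀ i j, MemLp (F₂ i j) 2 (volume.restrict K))
    (hG₂ : ∀ i j, MemLp (G₂ i j) 2 (volume.restrict K)) {M : ℝ} (hM : 0 ≤ M)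
    (hFM : ∀ i, ∀ᵐ y ∂(volume.restrict K), ‖F₁ i y‖ ≤ M)
    (hGM : ∀ i, ∀ᵐ y ∂(volume.restrict K), ‖G₁ i y‖ ≤ M) {A B : ℝ} (hA : 0 ≤ A) (hB : 0 ≤ B)
    (hFA : ∀ i j, ∫ y in K, ‖F₂ i j y‖ ^ 2 ≤ A ^ 2)
    (hGB : ∀ i j, ∫ y in K, ‖G₂ i j y‖ ^ 2 ≤ B ^ 2) :
    |∫ y in Metric.ball x ρ, cofactorPairing (fun i j => inner ℝ (F₁ i y) (G₁ j y))
        (hess (greenTest Q x ε R) y)| ≤ 64 * Real.pi * S * Q.tr / √Q.det * (A * B) := by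
  set φ : ℕ → ContDiffBump (0 : Plane) := fun n =>
    ⟨δ / (n + 1) / 2, δ / (n + 1), by positivity, half_lt_self (by positivity)⟩ with hφ
  have hφo : ∀ n, (φ n).rOut = δ / (n + 1) := fun n => rfl
  have hφ0 : Tendsto (fun n => (φ n).rOut) atTop (𝓝 0) := by
    simp only [hφo]
    exact tendsto_const_div_atTop_nhds_zero_nat δ |>.comp (tendsto_add_atTop_nat 1) |>.congr
      fun n => by simp
  have hφ2 : ∀ n, (φ n).rOut ≤ 2 * (φ n).rIn := fun n => by
    change δ / (n + 1) ≤ 2 * (δ / (n + 1) / 2)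
    linarith
  have hφδ : ∀ n, (φ n).rOut ≤ δ := fun n => by
    rw [hφo]
    exact div_le_self hδ.le (by linarith [(Nat.cast_nonneg n : (0 : ℝ) ≤ n)])
  have hxn : ∀ n, ∀ y ∈ Metric.ball x ρ, Metric.closedBall y (φ n).rOut ⊆ K := fun n y hy =>
    (Metric.closedBall_subset_closedBall (hφδ n)).trans (hxK y hy)
  have hballK : Metric.ball x ρ ⊆ K := fun y hy => hxK y hy (Metric.mem_closedBall_self hδ.le)
  have hFi : IntegrableOn F K := (hF.first 0).locInt.integrableOn_compact_subset hKU hK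
  have hGi : IntegrableOn G K := (hG.first 0).locInt.integrableOn_compact_subset hKU hK
  have hF1i : ∀ i, IntegrableOn (F₁ i) K := fun i =>
    (hF.first i).locInt_deriv.integrableOn_compact_subset hKU hK
  have hG1i : ∀ i, IntegrableOn (G₁ i) K := fun i =>
    (hG.first i).locInt_deriv.integrableOn_compact_subset hKU hK
  set ψ := greenTest Q x ε R with hψ
  have hψc : ∀ i j, Continuous fun y => hess ψ y i j := fun i j =>
    (contDiff_partialD (contDiff_partialD (contDiff_greenTest Q x ε R) i) j).continuous
  have hψ0 : ∀ y, y ∉ Metric.ball x ρ → ∀ i j, hess ψ y i j = 0 := by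
    intro y hy i j
    refine hess_greenTest_eq_zero Q x hε hεR (not_le.1 fun h => hy ?_) i j
    simpa [dist_eq_norm] using hρ _ h
  have hbound : ∀ n, |∫ y in Metric.ball x ρ, cofactorPairing (fun i j =>
      inner ℝ (mollify (φ n) K (F₁ i) y) (mollify (φ n) K (G₁ j) y)) (hess ψ y)|
      ≤ 64 * Real.pi * S * Q.tr / √Q.det * (A * B) := by
    intro n
    have h := abs_integral_cofactorPairing_hess_greenTest_le Q x hε hεR hρ hS
      (contDiff_mollify (φ n) hK.measurableSet hFi) (contDiff_mollify (φ n) hK.measurableSet hGi)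
      (A := 2 * A) (B := 2 * B) (by positivity) (by positivity)
      (setIntegral_fderiv_mollify_sq_le hK hKU hF hF₂ hFA (φ n) (hxn n))
      (setIntegral_fderiv_mollify_sq_le hK hKU hG hG₂ hGB (φ n) (hxn n))
    refine le_trans (le_of_eq ?_) (h.trans (le_of_eq (by ring)))
    rw [← setIntegral_eq_integral_of_forall_compl_eq_zero (s := Metric.ball x ρ)
      (μ := (volume : Measure Plane)) (f := fun y => cofactorPairing (fun i j =>
        inner ℝ (partialD i (mollify (φ n) K F) y) (partialD j (mollify (φ n) K G) y))
        (hess ψ y))]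
    · congr 1
      refine setIntegral_congr_fun measurableSet_ball fun y hy => ?_
      have e1 : ∀ i, partialD i (mollify (φ n) K F) y = mollify (φ n) K (F₁ i) y := fun i =>
        partialD_mollify (hF.first i) hK hKU (hxn n y hy)
      have e2 : ∀ i, partialD i (mollify (φ n) K G) y = mollify (φ n) K (G₁ i) y := fun i =>
        partialD_mollify (hG.first i) hK hKU (hxn n y hy)
      simp only [e1, e2]
    · intro y hy
      simp only [cofactorPairing, hψ0 y hy]
      ring
  have hlim : Tendsto (fun n => ∫ y in Metric.ball x ρ, cofactorPairing (fun i j =>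
      inner ℝ (mollify (φ n) K (F₁ i) y) (mollify (φ n) K (G₁ j) y)) (hess ψ y)) atTop
      (𝓝 (∫ y in Metric.ball x ρ, cofactorPairing (fun i j => inner ℝ (F₁ i y) (G₁ j y))
        (hess ψ y))) := by
    refine tendsto_integral_of_dominated_convergence
      (fun y => M * M * |hess ψ y 1 1| + M * M * |hess ψ y 0 1| + M * M * |hess ψ y 1 0|
        + M * M * |hess ψ y 0 0|) ?_ ?_ ?_ ?_
    · intro n
      have hFc : ∀ i, Continuous (mollify (φ n) K (F₁ i)) := fun i =>
        (contDiff_mollify (φ n) hK.measurableSet (hF1i i)).continuous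
      have hGc : ∀ i, Continuous (mollify (φ n) K (G₁ i)) := fun i =>
        (contDiff_mollify (φ n) hK.measurableSet (hG1i i)).continuous
      refine Continuous.aestronglyMeasurable ?_
      unfold cofactorPairing
      fun_prop
    · refine (Continuous.continuousOn ?_).integrableOn_compact (isCompact_closedBall x ρ)
        |>.mono_set Metric.ball_subset_closedBall
      fun_prop
    · intro n
      refine Eventually.of_forall fun y => ?_
      have hi : ∀ i j, |inner ℝ (mollify (φ n) K (F₁ i) y) (mollify (φ n) K (G₁ j) y)| ≤ M * M :=
        fun i j => (abs_real_inner_le_norm _ _).trans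
          (mul_le_mul (norm_mollify_le hM hK.measurableSet (hFM i) y)
            (norm_mollify_le hM hK.measurableSet (hGM j) y) (norm_nonneg _) hM)
      rw [cofactorPairing, Real.norm_eq_abs]
      refine (abs_add_le _ _).trans (add_le_add ((abs_sub _ _).trans
        (add_le_add ((abs_sub _ _).trans (add_le_add ?_ ?_)) ?_)) ?_) <;>
      · rw [abs_mul]
        exact mul_le_mul_of_nonneg_right (hi _ _) (abs_nonneg _)
    · have hFt := fun i => ae_restrict_of_ae_restrict_of_subset hballK
        (ae_tendsto_mollify hK.measurableSet (hF1i i) hφ0 hφ2)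
      have hGt := fun i => ae_restrict_of_ae_restrict_of_subset hballK
        (ae_tendsto_mollify hK.measurableSet (hG1i i) hφ0 hφ2)
      filter_upwards [hFt 0, hFt 1, hGt 0, hGt 1] with y f0 f1 g0 g1
      exact ((((f0.inner g0).mul_const _).sub ((f0.inner g1).mul_const _)).sub
        ((f1.inner g0).mul_const _)).add ((f1.inner g1).mul_const _)
  exact le_of_tendsto hlim.abs (Eventually.of_forall hbound)

end WeakEstimate

/-! ### The pointwise bound at Lebesgue points -/

section Pointwise

theorem PosForm.integral_deltaProfile_scaled (Q : PosForm) (x : Plane) {ε : ℝ} (hε : 0 < ε) :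
    ∫ y, deltaProfile (Q.eval (y - x) / ε ^ 2) / ε ^ 2 = 2 * Real.pi / √Q.det := by
  rw [integral_sub_right_eq_self (fun z => deltaProfile (Q.eval z / ε ^ 2) / ε ^ 2) x,
    integral_div]
  have h := Measure.integral_comp_smul (volume : Measure Plane)
    (fun z => deltaProfile (Q.eval z)) ε⁻¹
  have e : ∀ z, Q.eval (ε⁻¹ • z) = Q.eval z / ε ^ 2 := fun z => by
    rw [Q.eval_smul, inv_pow]
    ring
  simp only [e, Q.integral_deltaProfile_eval, finrank_euclideanSpace, Fintype.card_fin,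
    smul_eq_mul] at h
  rw [h, abs_of_pos (by positivity)]
  field_simp

theorem PosForm.norm_le_of_eval_le (Q : PosForm) {z : Plane} {ε : ℝ} (hε : 0 ≤ ε)
    (hz : Q.eval z ≤ ε ^ 2) : ‖z‖ ≤ √(Q.tr / Q.det) * ε := by
  have h1 := Q.det_mul_norm_sq_le z
  have hd := Q.det_positive
  have ht := Q.tr_pos
  refine le_of_sq_le_sq ?_ (by positivity)
  rw [mul_pow, Real.sq_sqrt (by positivity), div_mul_eq_mul_div, le_div_iff₀ hd, mul_comm]
  exact h1.trans (mul_le_mul_of_nonneg_left hz ht.le)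

/-- The smoothed Dirac masses recover the value of an integrable function at its Lebesgue
points. -/
theorem tendsto_integral_deltaProfile (Q : PosForm) {m : Plane → ℝ} (hm : Integrable m)
    {x : Plane}
    (hx : Tendsto (fun δ => ⨍ y in Metric.closedBall x δ, ‖m y - m x‖) (𝓝[>] 0) (𝓝 0)) :
    Tendsto (fun ε => ∫ y, m y * (deltaProfile (Q.eval (y - x) / ε ^ 2) / ε ^ 2)) (𝓝[>] 0)
      (𝓝 (m x * (2 * Real.pi / √Q.det))) := by
  obtain ⟨B, hB0, hB⟩ := exists_deltaProfile_bound
  have hd := Q.det_positive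
  have ht := Q.tr_pos
  set k : ℝ := √(Q.tr / Q.det) with hk
  have hk0 : 0 < k := Real.sqrt_pos.2 (div_pos ht hd)
  have hlim : Tendsto (fun ε : ℝ => B * (Real.pi * k ^ 2) *
      ⨍ y in Metric.closedBall x (k * ε), ‖m y - m x‖) (𝓝[>] 0) (𝓝 0) := by
    have h1 : Tendsto (fun ε : ℝ => k * ε) (𝓝[>] 0) (𝓝[>] 0) := by
      refine tendsto_nhdsWithin_iff.2 ⟨?_, ?_⟩
      · have : Tendsto (fun ε : ℝ => k * ε) (𝓝 0) (𝓝 (k * 0)) := (continuous_const_mul k).tendsto 0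
        rw [mul_zero] at this
        exact this.mono_left nhdsWithin_le_nhds
      · filter_upwards [self_mem_nhdsWithin] with ε hε
        exact mul_pos hk0 hε
    simpa using (hx.comp h1).const_mul (B * (Real.pi * k ^ 2))
  refine tendsto_iff_dist_tendsto_zero.2 (squeeze_zero' (Eventually.of_forall fun _ => dist_nonneg)
    ?_ hlim)
  filter_upwards [self_mem_nhdsWithin] with ε hε
  have hε : 0 < ε := hε
  have hc : Continuous fun y => deltaProfile (Q.eval (y - x) / ε ^ 2) / ε ^ 2 := by
    have h1 := continuous_deltaProfile
    have h2 := Q.contDiff_eval.continuous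
    fun_prop
  have h0 : ∀ y, y ∉ Metric.closedBall x (k * ε) →
      deltaProfile (Q.eval (y - x) / ε ^ 2) / ε ^ 2 = 0 := by
    intro y hy
    have : ε ^ 2 < Q.eval (y - x) := by
      refine not_le.1 fun h => hy ?_
      rw [mem_closedBall_iff_norm]
      exact Q.norm_le_of_eval_le hε.le h
    rw [deltaProfile_of_one_lt ((one_lt_div (by positivity)).2 this), zero_div]
  have hcs : HasCompactSupport fun y => deltaProfile (Q.eval (y - x) / ε ^ 2) / ε ^ 2 :=
    HasCompactSupport.intro (isCompact_closedBall x (k * ε)) h0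
  have hbd : ∀ y, |deltaProfile (Q.eval (y - x) / ε ^ 2) / ε ^ 2| ≤ B / ε ^ 2 := fun y => by
    rw [abs_div, abs_of_pos (by positivity : 0 < ε ^ 2)]
    gcongr
    exact hB _
  have i1 : Integrable fun y => m y * (deltaProfile (Q.eval (y - x) / ε ^ 2) / ε ^ 2) :=
    hm.mul_bdd (c := B / ε ^ 2) hc.aestronglyMeasurable (Eventually.of_forall hbd)
  have i2 : Integrable fun y => m x * (deltaProfile (Q.eval (y - x) / ε ^ 2) / ε ^ 2) :=
    (hc.integrable_of_hasCompactSupport hcs).const_mul _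
  rw [← Q.integral_deltaProfile_scaled x hε, ← integral_const_mul, Real.dist_eq,
    ← integral_sub i1 i2, ← setIntegral_eq_integral_of_forall_compl_eq_zero
      (s := Metric.closedBall x (k * ε)) (fun y hy => by rw [h0 y hy]; ring), ← Real.norm_eq_abs]
  have hfin : IntegrableOn (fun y => ‖m y - m x‖) (Metric.closedBall x (k * ε)) :=
    (hm.integrableOn.sub (integrableOn_const (by
      exact (isCompact_closedBall x (k * ε)).measure_lt_top.ne))).norm
  have hvol : (volume : Measure Plane).real (Metric.closedBall x (k * ε))
      = Real.pi * k ^ 2 * ε ^ 2 := by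
    rw [Measure.real, EuclideanSpace.volume_closedBall_fin_two]
    have : 0 < k * ε := by positivity
    simp [ENNReal.toReal_ofReal this.le, Real.pi_pos.le]
    ring
  calc _ ≤ ∫ y in Metric.closedBall x (k * ε), B / ε ^ 2 * ‖m y - m x‖ := by
        refine norm_integral_le_of_norm_le (hfin.const_mul _) (Eventually.of_forall fun y => ?_)
        rw [← sub_mul, norm_mul, mul_comm]
        exact mul_le_mul_of_nonneg_right (hbd y) (norm_nonneg _)
    _ = _ := by
        rw [integral_const_mul, setAverage_eq, hvol, smul_eq_mul]
        field_simp

theorem integrableOn_inv_norm_sub (x : Plane) (ρ : ℝ) :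
    IntegrableOn (fun y => ‖y - x‖⁻¹) (Metric.ball x ρ) := by
  have h0 : IntegrableOn (fun z : Plane => ‖z‖⁻¹) (Metric.ball 0 ρ) := by
    refine (integrableOn_fun_norm_addHaar volume (f := fun r => r⁻¹)).2 ?_
    refine (integrableOn_const (C := (1 : ℝ)) (by simp)).congr_fun (fun r hr => ?_)
      measurableSet_Ioo
    have : r ≠ 0 := hr.1.ne'
    simp [this]
  have := ((measurePreserving_sub_right (volume : Measure Plane) x).integrableOn_comp_preimage
    (MeasurableEquiv.subRight x).measurableEmbedding (f := fun z : Plane => ‖z‖⁻¹)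
    (s := Metric.ball 0 ρ)).2 h0
  refine this.mono_set fun y hy => ?_
  simpa [dist_eq_norm] using hy

theorem integral_inv_norm_sub (x : Plane) {ρ : ℝ} (hρ : 0 ≤ ρ) :
    ∫ y in Metric.ball x ρ, ‖y - x‖⁻¹ = 2 * Real.pi * ρ := by
  have hvol : (volume : Measure Plane).real (Metric.ball 0 1) = Real.pi := by
    simp [Measure.real, EuclideanSpace.volume_ball_fin_two, Real.pi_pos.le]
  have h := integral_fun_norm_addHaar (volume : Measure Plane)
    ((Iio ρ).indicator fun r : ℝ => r⁻¹)
  rw [← integral_indicator measurableSet_ball]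
  have e1 : (Metric.ball x ρ).indicator (fun y => ‖y - x‖⁻¹)
      = fun y => (Iio ρ).indicator (fun r : ℝ => r⁻¹) ‖y - x‖ := by
    ext y
    simp [indicator, dist_eq_norm]
  have e2 : ∫ r in Ioi (0 : ℝ), r ^ (2 - 1) • (Iio ρ).indicator (fun r : ℝ => r⁻¹) r = ρ := by
    have : EqOn (fun r : ℝ => r ^ (2 - 1) • (Iio ρ).indicator (fun r : ℝ => r⁻¹) r)
        ((Iio ρ).indicator fun _ => 1) (Ioi 0) := by
      intro r hr
      have : r ≠ 0 := (ne_of_gt hr)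
      by_cases h : r < ρ <;> simp [h, this]
    rw [setIntegral_congr_fun measurableSet_Ioi this, setIntegral_indicator measurableSet_Iio,
      Ioi_inter_Iio]
    simp [hρ]
  rw [e1, integral_sub_right_eq_self (fun z : Plane =>
    (Iio ρ).indicator (fun r : ℝ => r⁻¹) ‖z‖) x, h]
  simp only [finrank_euclideanSpace, Fintype.card_fin, hvol]
  rw [e2]
  simp
  ring

theorem abs_cofactorPairing_le {h k : Fin 2 → Fin 2 → ℝ} {a b : ℝ} (ha : 0 ≤ a)
    (hh : ∀ i j, |h i j| ≤ a) (hk : ∀ i j, |k i j| ≤ b) : |cofactorPairing h k| ≤ 4 * (a * b) := by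
  have H : ∀ i j i' j', |h i j * k i' j'| ≤ a * b := fun i j i' j' => by
    rw [abs_mul]
    exact mul_le_mul (hh i j) (hk i' j') (abs_nonneg _) ha
  unfold cofactorPairing
  refine ((abs_add_le _ _).trans (add_le_add ((abs_sub _ _).trans
    (add_le_add ((abs_sub _ _).trans (add_le_add (H _ _ _ _) (H _ _ _ _))) (H _ _ _ _)))
    (H _ _ _ _))).trans (le_of_eq (by ring))

/-- The pointwise bound for the solution `m` of the double divergence form equation with
Lipschitz coefficients `g`, at a Lebesgue point `x`, obtained from the parametrix frozen at `x`:
`T` bounds the right-hand side. -/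
theorem sqrt_det_mul_abs_le (Q : PosForm) (x : Plane) {R ρ S Bβ M L T : ℝ} (hR : 0 < R)
    (hρ0 : 0 ≤ ρ) (hρ : ∀ z, Q.eval z ≤ R ^ 2 → ‖z‖ < ρ)
    (hS : ∀ t, |t * deriv logProfile t| ≤ S ∧ |t ^ 2 * deriv (deriv logProfile) t| ≤ S)
    (hBβ : ∀ t, |deltaProfile t| ≤ Bβ) {m : Plane → ℝ} (hm : Integrable m) (hM : 0 ≤ M)
    (hmM : ∀ᵐ y ∂(volume.restrict (Metric.ball x ρ)), |m y| ≤ M)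
    (hx : Tendsto (fun δ => ⨍ y in Metric.closedBall x δ, ‖m y - m x‖) (𝓝[>] 0) (𝓝 0))
    {g : Plane → Fin 2 → Fin 2 → ℝ} (hgc : ∀ i j, ContinuousOn (fun y => g y i j) (Metric.ball x ρ))
    (hL : 0 ≤ L) (hg : ∀ y ∈ Metric.ball x ρ, ∀ i j, |g y i j - Q.coef i j| ≤ L * ‖y - x‖)
    (hT : ∀ ε, 0 < ε → ε ≤ R → |∫ y in Metric.ball x ρ,
      m y * cofactorPairing (g y) (hess (greenTest Q x ε R) y)| ≤ T) :
    2 * Real.pi * √Q.det * |m x| ≤ T + Q.det * (Bβ / R ^ 2) * (∫ y in Metric.ball x ρ, |m y|)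
      + M * (4 * L * (12 * S * Q.tr ^ 2 / Q.det)) * (2 * Real.pi * ρ) := by
  have hd := Q.det_positive
  have ht := Q.tr_pos
  set Ch : ℝ := 12 * S * Q.tr ^ 2 / Q.det with hCh
  have hS0 : 0 ≤ S := (abs_nonneg _).trans (hS 0).1
  have hCh0 : 0 ≤ Ch := by positivity
  have hBβ0 : 0 ≤ Bβ := (abs_nonneg _).trans (hBβ 0)
  have hqc := Q.contDiff_eval.continuous
  have hdc := continuous_deltaProfile
  have hinv := integrableOn_inv_norm_sub x ρ
  have key : ∀ ε, 0 < ε → ε ≤ R →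
      Q.det * |∫ y, m y * (deltaProfile (Q.eval (y - x) / ε ^ 2) / ε ^ 2)| ≤
        T + Q.det * (Bβ / R ^ 2) * (∫ y in Metric.ball x ρ, |m y|)
          + M * (4 * L * Ch) * (2 * Real.pi * ρ) := by
    intro ε hε hεR
    have h0 : ∀ y, y ∉ Metric.ball x ρ → deltaProfile (Q.eval (y - x) / ε ^ 2) / ε ^ 2 = 0 := by
      intro y hy
      have h1 : R ^ 2 < Q.eval (y - x) := by
        refine not_le.1 fun h => hy ?_
        rw [mem_ball_iff_norm]
        exact hρ _ h
      have h2 : ε ^ 2 < Q.eval (y - x) := lt_of_le_of_lt (by gcongr) h1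
      rw [deltaProfile_of_one_lt ((one_lt_div (by positivity)).2 h2), zero_div]
    have hm' : IntegrableOn m (Metric.ball x ρ) := hm.integrableOn
    have hdelta : ∀ a : ℝ, IntegrableOn
        (fun y => m y * (deltaProfile (Q.eval (y - x) / a ^ 2) / a ^ 2)) (Metric.ball x ρ) := fun a =>
      hm'.mul_bdd (c := Bβ / a ^ 2) (by fun_prop : Continuous fun y =>
        deltaProfile (Q.eval (y - x) / a ^ 2) / a ^ 2).aestronglyMeasurable
        (Eventually.of_forall fun y => by
          rw [norm_div, Real.norm_eq_abs, Real.norm_of_nonneg (by positivity : 0 ≤ a ^ 2)]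
          gcongr
          exact hBβ _)
    have hhc : ∀ i j, Continuous fun y => hess (greenTest Q x ε R) y i j := fun i j =>
      (contDiff_partialD (contDiff_partialD (contDiff_greenTest Q x ε R) i) j).continuous
    -- the error made by freezing the coefficients at `x`
    have hEb : ∀ᵐ y ∂(volume.restrict (Metric.ball x ρ)), ‖m y * cofactorPairing
        (fun i j => g y i j - Q.coef i j) (hess (greenTest Q x ε R) y)‖ ≤
          M * (4 * L * Ch) * ‖y - x‖⁻¹ := by
      filter_upwards [hmM, ae_restrict_mem measurableSet_ball] with y hy hyb
      rw [norm_mul, mul_assoc]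
      refine mul_le_mul hy ?_ (norm_nonneg _) hM
      rcases eq_or_ne y x with rfl | hyx
      · have hz : ∀ i j, g y i j - Q.coef i j = 0 := fun i j => by
          have := hg y hyb i j
          rw [sub_self, norm_zero, mul_zero] at this
          exact abs_nonpos_iff.1 this
        simp [cofactorPairing, hz]
      · have hn : 0 < ‖y - x‖ := norm_pos_iff.2 (sub_ne_zero.2 hyx)
        have h1 := abs_cofactorPairing_le (h := fun i j => g y i j - Q.coef i j)
          (k := hess (greenTest Q x ε R) y) (b := Ch / ‖y - x‖ ^ 2) (by positivity) (hg y hyb)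
          (fun i j => by
            rw [le_div_iff₀ (by positivity)]
            exact abs_hess_greenTest_mul_le Q x hS ε R y i j)
        refine h1.trans (le_of_eq ?_)
        field_simp
    have hEi : IntegrableOn (fun y => m y * cofactorPairing
        (fun i j => g y i j - Q.coef i j) (hess (greenTest Q x ε R) y)) (Metric.ball x ρ) := by
      refine (hinv.const_mul (M * (4 * L * Ch))).mono' ?_ hEb
      refine hm'.aestronglyMeasurable.mul (ContinuousOn.aestronglyMeasurable ?_ measurableSet_ball)
      have hhc' := fun i j => (hhc i j).continuousOn (s := Metric.ball x ρ)
      unfold cofactorPairing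
      fun_prop
    have hE : |∫ y in Metric.ball x ρ, m y * cofactorPairing
        (fun i j => g y i j - Q.coef i j) (hess (greenTest Q x ε R) y)|
        ≤ M * (4 * L * Ch) * (2 * Real.pi * ρ) := by
      refine (norm_integral_le_of_norm_le (hinv.const_mul (M * (4 * L * Ch))) hEb).trans
        (le_of_eq ?_)
      rw [integral_const_mul, integral_inv_norm_sub x hρ0]
    have hRb : |∫ y in Metric.ball x ρ, m y * (deltaProfile (Q.eval (y - x) / R ^ 2) / R ^ 2)|
        ≤ Bβ / R ^ 2 * ∫ y in Metric.ball x ρ, |m y| := by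
      rw [← integral_const_mul, ← Real.norm_eq_abs]
      refine norm_integral_le_of_norm_le (hm'.abs.const_mul _) (Eventually.of_forall fun y => ?_)
      rw [norm_mul, mul_comm, norm_div, Real.norm_eq_abs, Real.norm_eq_abs, Real.norm_eq_abs,
        abs_of_nonneg (by positivity : 0 ≤ R ^ 2)]
      gcongr
      exact hBβ _
    have hsplit : Q.det * ∫ y, m y * (deltaProfile (Q.eval (y - x) / ε ^ 2) / ε ^ 2) =
        (∫ y in Metric.ball x ρ, m y * cofactorPairing (g y) (hess (greenTest Q x ε R) y))
        + Q.det * (∫ y in Metric.ball x ρ,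
            m y * (deltaProfile (Q.eval (y - x) / R ^ 2) / R ^ 2))
        - ∫ y in Metric.ball x ρ, m y * cofactorPairing
            (fun i j => g y i j - Q.coef i j) (hess (greenTest Q x ε R) y) := by
      rw [← setIntegral_eq_integral_of_forall_compl_eq_zero (s := Metric.ball x ρ)
        (μ := (volume : Measure Plane))
        (f := fun y => m y * (deltaProfile (Q.eval (y - x) / ε ^ 2) / ε ^ 2))
        (fun y hy => by rw [h0 y hy, mul_zero])]
      have e : (fun y => m y * cofactorPairing (g y) (hess (greenTest Q x ε R) y)) =
          ((fun y => Q.det * (m y * (deltaProfile (Q.eval (y - x) / ε ^ 2) / ε ^ 2)))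
          - fun y => Q.det * (m y * (deltaProfile (Q.eval (y - x) / R ^ 2) / R ^ 2)))
          + fun y => m y * cofactorPairing
            (fun i j => g y i j - Q.coef i j) (hess (greenTest Q x ε R) y) := by
        ext y
        have := cofactorPairing_hess_greenTest Q x ε R y
        simp only [Pi.add_apply, Pi.sub_apply]
        rw [← mul_left_comm, ← mul_left_comm (m y), ← mul_sub, ← mul_sub, ← this]
        simp only [cofactorPairing]
        ring
      rw [e, integral_add' (((hdelta ε).const_mul _).sub ((hdelta R).const_mul _)) hEi,
        integral_sub' ((hdelta ε).const_mul _) ((hdelta R).const_mul _), integral_const_mul,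
        integral_const_mul]
      ring
    rw [← abs_of_pos hd, ← abs_mul, abs_of_pos hd, hsplit]
    refine (abs_sub _ _).trans
      (add_le_add ((abs_add_le _ _).trans (add_le_add (hT ε hε hεR) ?_)) hE)
    rw [abs_mul, abs_of_pos hd, mul_assoc]
    exact mul_le_mul_of_nonneg_left hRb hd.le
  have hlim := ((tendsto_integral_deltaProfile Q hm hx).abs.const_mul Q.det)
  -- the estimate is uniform in `ε`, and the Dirac masses at scale `ε` converge to the value at `x`
  have hfin := le_of_tendsto hlim (by
    filter_upwards [Ioc_mem_nhdsGT hR] with ε hε using key ε hε.1 hε.2)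
  refine le_trans (le_of_eq ?_) hfin
  rw [abs_mul, abs_of_pos (by have := Q.sqrt_det_pos; positivity : 0 < 2 * Real.pi / √Q.det)]
  have h1 : Q.det / √Q.det = √Q.det := Real.div_sqrt
  calc _ = 2 * Real.pi * (Q.det / √Q.det) * |m x| := by rw [h1]
    _ = _ := by ring

end Pointwise

/-! ### Smooth metrics in charts -/

section Metric

variable {S : Type*} [TopologicalSpace S] [ChartedSpace Plane S]

theorem coordVector_combination_ne_zero {φ : OpenPartialHomeomorph S Plane}
    (hφ : φ ∈ smoothCharts S) {y : Plane} (hy : y ∈ φ.target) {a b : ℝ} (hab : a ≠ 0 ∨ b ≠ 0) :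
    a • coordVector φ 0 y + b • coordVector φ 1 y ≠ 0 := by
  have hmd : φ.MDifferentiable (𝓡 2) (𝓡 2) :=
    ⟨(contMDiffOn_of_mem_maximalAtlas hφ).mdifferentiableOn (by simp),
      (contMDiffOn_symm_of_mem_maximalAtlas hφ).mdifferentiableOn (by simp)⟩
  have hinj := hmd.symm.mfderiv_injective hy
  intro h
  have e : mfderiv (𝓡 2) (𝓡 2) φ.symm y (a • planeBasis 0 + b • planeBasis 1) = 0 := by
    rw [← h]
    exact (map_add _ _ _).trans (congrArg₂ _ (map_smul _ _ _) (map_smul _ _ _))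
  have h0 : (a • planeBasis 0 + b • planeBasis 1 : Plane) = 0 := hinj (e.trans (map_zero _).symm)
  have ha := congrArg (fun z : Plane => z 0) h0
  have hb := congrArg (fun z : Plane => z 1) h0
  simp [planeBasis] at ha hb
  tauto

variable [IsManifold (𝓡 2) ∞ S]

/-- The coefficients are smooth: the coordinate vector fields are the image of constant fields under
the tangent map of the inverse chart, and the metric is a smooth section. -/
theorem contDiffOn_coeff (g : SmoothMetric S) {φ : OpenPartialHomeomorph S Plane}
    (hφ : φ ∈ smoothCharts S) (i j : Fin 2) :
    ContDiffOn ℝ ∞ (SmoothMetric.coeff g φ i j) φ.target := by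
  have hsymm : ContMDiffOn (𝓡 2) (𝓡 2) ∞ φ.symm φ.target :=
    contMDiffOn_symm_of_mem_maximalAtlas hφ
  have hv : ∀ i, ContMDiffOn (𝓡 2) ((𝓡 2).prod 𝓘(ℝ, Plane)) ∞
      (fun y => (Bundle.TotalSpace.mk' Plane (φ.symm y) (coordVector φ i y) :
        TangentBundle (𝓡 2) S)) φ.target := by
    intro i
    have hconst : ContMDiff 𝓘(ℝ, Plane) (𝓘(ℝ, Plane).prod 𝓘(ℝ, Plane)) ∞
        (fun y : Plane => (Bundle.TotalSpace.mk' Plane y (planeBasis i) :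
          TangentBundle 𝓘(ℝ, Plane) Plane)) := fun y =>
      contMDiffAt_vectorSpace_iff_contDiffAt.2 (contDiffAt_const (c := planeBasis i))
    have h := (hsymm.contMDiffOn_tangentMapWithin (m := ∞) (by simp)
      φ.open_target.uniqueMDiffOn).comp hconst.contMDiffOn (fun y hy => hy)
    refine h.congr fun y hy => ?_
    simp only [Function.comp_apply, tangentMapWithin, coordVector]
    rw [mfderivWithin_of_isOpen φ.open_target hy]
  have hg : ContMDiffOn (𝓡 2) ((𝓡 2).prod 𝓘(ℝ, Plane →L[ℝ] Plane →L[ℝ] ℝ)) ∞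
      (fun y => Bundle.TotalSpace.mk' (Plane →L[ℝ] Plane →L[ℝ] ℝ)
        (E := fun p : S => TangentSpace (𝓡 2) p →L[ℝ] TangentSpace (𝓡 2) p →L[ℝ] ℝ)
        (φ.symm y) (g.inner (φ.symm y))) φ.target :=
    g.contMDiff.comp_contMDiffOn hsymm
  have h := hg.clm_bundle_apply₂ (F₃ := ℝ) (E₃ := fun _ : S => ℝ) (hv i) (hv j)
  rw [← contMDiffOn_iff_contDiffOn]
  intro y hy
  exact (Bundle.contMDiffWithinAt_totalSpace.1 (h y hy)).2

/-- The Riemannian metric in the coordinates given by a chart, at a point. -/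
def metricForm (g : SmoothMetric S) {φ : OpenPartialHomeomorph S Plane}
    (hφ : φ ∈ smoothCharts S) {y : Plane} (hy : y ∈ φ.target) : PosForm where
  coef i j := SmoothMetric.coeff g φ i j y
  symm := g.symm _ _ _
  pos := by
    refine g.pos _ _ ?_
    have := coordVector_combination_ne_zero hφ hy (a := 1) (b := 0) (Or.inl one_ne_zero)
    simpa using this
  det_pos := by
    have hpos : 0 < SmoothMetric.coeff g φ 0 0 y := by
      refine g.pos _ _ ?_
      have := coordVector_combination_ne_zero hφ hy (a := 1) (b := 0) (Or.inl one_ne_zero)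
      simpa using this
    -- for `v = -g₀₁ e₀ + g₀₀ e₁` one has `g(v, v) = g₀₀ det g`
    have h := g.pos _ _ (coordVector_combination_ne_zero hφ hy
      (a := -SmoothMetric.coeff g φ 0 1 y) (b := SmoothMetric.coeff g φ 0 0 y) (Or.inr hpos.ne'))
    have hs : SmoothMetric.coeff g φ 1 0 y = SmoothMetric.coeff g φ 0 1 y := g.symm _ _ _
    have e : g.inner (φ.symm y)
        (-SmoothMetric.coeff g φ 0 1 y • coordVector φ 0 y
          + SmoothMetric.coeff g φ 0 0 y • coordVector φ 1 y)
        (-SmoothMetric.coeff g φ 0 1 y • coordVector φ 0 y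
          + SmoothMetric.coeff g φ 0 0 y • coordVector φ 1 y)
        = SmoothMetric.coeff g φ 0 0 y * (SmoothMetric.coeff g φ 0 0 y *
          SmoothMetric.coeff g φ 1 1 y - SmoothMetric.coeff g φ 0 1 y ^ 2) := by
      have h00 : g.inner (φ.symm y) (coordVector φ 0 y) (coordVector φ 0 y)
        = SmoothMetric.coeff g φ 0 0 y := rfl
      have h01 : g.inner (φ.symm y) (coordVector φ 0 y) (coordVector φ 1 y)
        = SmoothMetric.coeff g φ 0 1 y := rfl
      have h10 : g.inner (φ.symm y) (coordVector φ 1 y) (coordVector φ 0 y)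
        = SmoothMetric.coeff g φ 0 1 y := hs
      have h11 : g.inner (φ.symm y) (coordVector φ 1 y) (coordVector φ 1 y)
        = SmoothMetric.coeff g φ 1 1 y := rfl
      simp only [map_add, map_smul, add_apply, smul_apply, smul_eq_mul, h00, h01, h10, h11]
      ring
    rw [e] at h
    exact pos_of_mul_pos_right h hpos.le

/-- On a compact ball in a chart domain, the coefficients of the metric are bounded, uniformly
elliptic and Lipschitz continuous. -/
theorem exists_metric_bounds (g : SmoothMetric S) {φ : OpenPartialHomeomorph S Plane}
    (hφ : φ ∈ smoothCharts S) {x₀ : Plane} {r : ℝ} (hr : Metric.closedBall x₀ r ⊆ φ.target) :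
    ∃ Λ d L : ℝ, 0 < Λ ∧ 0 < d ∧ 0 ≤ L ∧
      (∀ y (hy : y ∈ Metric.closedBall x₀ r), (metricForm g hφ (hr hy)).tr ≤ Λ ∧
        d ≤ (metricForm g hφ (hr hy)).det ∧ d ≤ (metricForm g hφ (hr hy)).coef 0 0) ∧
      ∀ x ∈ Metric.closedBall x₀ r, ∀ y ∈ Metric.closedBall x₀ r, ∀ i j,
        |SmoothMetric.coeff g φ i j y - SmoothMetric.coeff g φ i j x| ≤ L * ‖y - x‖ := by
  have hK := isCompact_closedBall x₀ r
  have hc : ∀ i j, ContinuousOn (SmoothMetric.coeff g φ i j) (Metric.closedBall x₀ r) :=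
    fun i j => (contDiffOn_coeff g hφ i j).continuousOn.mono hr
  obtain ⟨Λ, hΛ⟩ := hK.exists_bound_of_continuousOn ((hc 0 0).add (hc 1 1))
  have hdet : ∃ d, 0 < d ∧ ∀ y ∈ Metric.closedBall x₀ r,
      d ≤ min (SmoothMetric.coeff g φ 0 0 y * SmoothMetric.coeff g φ 1 1 y
        - SmoothMetric.coeff g φ 0 1 y ^ 2) (SmoothMetric.coeff g φ 0 0 y) := by
    rcases (Metric.closedBall x₀ r).eq_empty_or_nonempty with he | hne
    · exact ⟨1, one_pos, by simp [he]⟩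
    · obtain ⟨y, hy, hmin⟩ := hK.exists_isMinOn hne
        ((((hc 0 0).mul (hc 1 1)).sub ((hc 0 1).pow 2)).inf (hc 0 0))
      exact ⟨_, lt_min (metricForm g hφ (hr hy)).det_pos (metricForm g hφ (hr hy)).pos,
        fun z hz => hmin hz⟩
  obtain ⟨d, hd0, hd⟩ := hdet
  have hLip : ∀ i j, ∃ L : ℝ≥0, LipschitzOnWith L (SmoothMetric.coeff g φ i j)
      (Metric.closedBall x₀ r) := by
    intro i j
    have hs := contDiffOn_coeff g hφ i j
    have hf : ContinuousOn (fderiv ℝ (SmoothMetric.coeff g φ i j)) (Metric.closedBall x₀ r) :=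
      (hs.continuousOn_fderiv_of_isOpen φ.open_target (by simp)).mono hr
    obtain ⟨L, hL⟩ := hK.exists_bound_of_continuousOn hf
    refine ⟨L.toNNReal, (convex_closedBall x₀ r).lipschitzOnWith_of_nnnorm_fderiv_le (𝕜 := ℝ)
      (fun y hy => ((hs.contDiffAt (φ.open_target.mem_nhds (hr hy))).differentiableAt (by simp)))
      fun y hy => ?_⟩
    exact NNReal.le_toNNReal_of_coe_le (hL y hy)
  choose L hL using hLip
  refine ⟨max Λ 1, d, ∑ i, ∑ j, (L i j : ℝ), by positivity, hd0, by positivity,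
    fun y hy => ⟨?_, (hd y hy).trans (min_le_left _ _), (hd y hy).trans (min_le_right _ _)⟩,
    fun x hx y hy i j => ?_⟩
  · exact (le_abs_self _).trans ((hΛ y hy).trans (le_max_left _ _))
  · have h1 := (hL i j).dist_le_mul y hy x hx
    rw [Real.dist_eq, dist_eq_norm] at h1
    refine h1.trans (mul_le_mul_of_nonneg_right ?_ (norm_nonneg _))
    calc (L i j : ℝ) ≤ ∑ j, (L i j : ℝ) :=
          Finset.single_le_sum (f := fun j => (L i j : ℝ)) (fun _ _ => NNReal.coe_nonneg _)
            (Finset.mem_univ j)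
      _ ≤ _ := Finset.single_le_sum (f := fun i => ∑ j, (L i j : ℝ))
            (fun _ _ => by positivity) (Finset.mem_univ i)

end Metric

/-! ### Calculus in local Sobolev spaces -/

section SquareIntegrable

variable {V : Type*} [NormedAddCommGroup V] {U : Set Plane} {F F' : Plane → V}

theorem memLp_of_ae_eq_restrict {K : Set Plane} (hKU : K ⊆ U) (hF : MemLp F 2 (volume.restrict K))
    (he : F' =ᵐ[volume.restrict U] F) : MemLp F' 2 (volume.restrict K) :=
  (memLp_congr_ae (ae_restrict_of_ae_restrict_of_subset hKU he)).2 hF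

theorem integral_norm_sq_le_of_eLpNorm_le {K : Set Plane} (hF : MemLp F 2 (volume.restrict K))
    {c : ℝ≥0∞} (hc : c ≠ ⊤) (h : eLpNorm F 2 (volume.restrict K) ≤ c) :
    ∫ y in K, ‖F y‖ ^ 2 ≤ c.toReal ^ 2 := by
  have h1 := hF.eLpNorm_eq_integral_rpow_norm (by norm_num) (by norm_num)
  rw [h1] at h
  have h2 := ENNReal.ofReal_le_iff_le_toReal hc |>.1 h
  have h0 : 0 ≤ ∫ y in K, ‖F y‖ ^ 2 := integral_nonneg fun _ => by positivity
  simp only [ENNReal.toReal_ofNat, Real.rpow_ofNat] at h2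
  rw [show ((2 : ℝ)⁻¹) = 1 / 2 by norm_num, ← Real.sqrt_eq_rpow] at h2
  exact (Real.sqrt_le_left ENNReal.toReal_nonneg).1 h2

end SquareIntegrable

section WeakPartials

variable {V : Type*} [NormedAddCommGroup V] [InnerProductSpace ℝ V] {U : Set Plane} {i : Fin 2}
  {F F' G G' : Plane → V}

theorem integrableOn_smul_of_tsupport_subset
    (hF : LocallyIntegrableOn F U volume) {k : Plane → ℝ} (hk : Continuous k)
    (hkc : HasCompactSupport k) (hkU : tsupport k ⊆ U) : IntegrableOn (fun y => k y • F y) U := by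
  have hK : IntegrableOn F (tsupport k) := hF.integrableOn_compact_subset hkU hkc
  have h1 : IntegrableOn (fun y => k y • F y) (tsupport k) :=
    hK.continuousOn_smul hk.continuousOn hkc
  have h2 : Integrable fun y => k y • F y := by
    rw [← integrableOn_iff_integrable_of_support_subset (s := tsupport k)]
    · exact h1
    · intro y hy
      exact subset_tsupport k fun h0 => hy (by simp [h0])
  exact h2.integrableOn

theorem IsWeakPartial.sub (h : IsWeakPartial U i F G)
    (h' : IsWeakPartial U i F' G') :
    IsWeakPartial U i (fun y => F y - F' y) (fun y => G y - G' y) := by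
  refine ⟨h.locInt.sub h'.locInt, h.locInt_deriv.sub h'.locInt_deriv, fun ζ hζ hζc hζU => ?_⟩
  have hd : Continuous fun y => fderiv ℝ ζ y (planeBasis i) :=
    (contDiff_partialD hζ i).continuous
  have hdc : HasCompactSupport fun y => fderiv ℝ ζ y (planeBasis i) :=
    hasCompactSupport_partialD hζc i
  have hdU : tsupport (fun y => fderiv ℝ ζ y (planeBasis i)) ⊆ U :=
    (tsupport_fderiv_apply_subset ℝ (planeBasis i)).trans hζU
  simp only [smul_sub]
  rw [integral_sub (integrableOn_smul_of_tsupport_subset h.locInt hd hdc hdU)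
    (integrableOn_smul_of_tsupport_subset h'.locInt hd hdc hdU),
    integral_sub (integrableOn_smul_of_tsupport_subset h.locInt_deriv hζ.continuous hζc hζU)
    (integrableOn_smul_of_tsupport_subset h'.locInt_deriv hζ.continuous hζc hζU),
    h.byParts ζ hζ hζc hζU, h'.byParts ζ hζ hζc hζU]
  abel

theorem IsWeakPartial.congr (h : IsWeakPartial U i F G) (hF' : LocallyIntegrableOn F' U volume)
    (he : F' =ᵐ[volume.restrict U] F) : IsWeakPartial U i F' G := by
  refine ⟨hF', h.locInt_deriv, fun ζ hζ hζc hζU => ?_⟩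
  rw [← h.byParts ζ hζ hζc hζU]
  refine integral_congr_ae ?_
  filter_upwards [he] with y hy
  rw [hy]

/-- Weak partial derivatives are unique up to null sets. -/
theorem IsWeakPartial.ae_eq [CompleteSpace V] (hU : IsOpen U) (h : IsWeakPartial U i F G)
    (h' : IsWeakPartial U i F G') : G =ᵐ[volume.restrict U] G' := by
  have hz := hU.ae_eq_zero_of_integral_contDiff_smul_eq_zero (μ := volume)
    (h.locInt_deriv.sub h'.locInt_deriv) (fun ζ hζ hζc hζU => by
      have e := (h.byParts ζ hζ hζc hζU).symm.trans (h'.byParts ζ hζ hζc hζU)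
      rw [neg_inj] at e
      rw [← setIntegral_eq_integral_of_forall_compl_eq_zero (s := U) (fun y hy => by
        rw [image_eq_zero_of_notMem_tsupport fun h' => hy (hζU h'), zero_smul])]
      simp only [Pi.sub_apply, smul_sub]
      rw [integral_sub (integrableOn_smul_of_tsupport_subset h.locInt_deriv
        hζ.continuous hζc hζU)
        (integrableOn_smul_of_tsupport_subset h'.locInt_deriv hζ.continuous hζc hζU), e, sub_self])
  rw [EventuallyEq, ae_restrict_iff' hU.measurableSet]
  filter_upwards [hz] with y hy hyU
  exact sub_eq_zero.1 (hy hyU)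

theorem MemW22Loc.isWeakJet (h : MemW22Loc U F) :
    IsWeakJet U F (fun i => weakPartial U i F) (fun i j => weakPartial U j (weakPartial U i F)) :=
  ⟨fun i => isWeakPartial_weakPartial (h.hasWeakPartial_one i),
    fun i j => isWeakPartial_weakPartial (h.hasWeakPartial_two i j)⟩

theorem weakPartial_sub_ae_eq [CompleteSpace V] (hU : IsOpen U) (h : MemW22Loc U F)
    (h' : MemW22Loc U F') (i : Fin 2) : weakPartial U i (fun y => F y - F' y)
      =ᵐ[volume.restrict U] fun y => weakPartial U i F y - weakPartial U i F' y := by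
  have hs := (h.isWeakJet.first i).sub (h'.isWeakJet.first i)
  exact (isWeakPartial_weakPartial ⟨_, hs⟩).ae_eq hU hs

/-- The chosen representative of a first derivative of a difference is only almost everywhere the
difference of the chosen representatives, but it has the same weak derivatives. -/
theorem weakPartial_weakPartial_sub [CompleteSpace V] (hU : IsOpen U) (h : MemW22Loc U F)
    (h' : MemW22Loc U F') (i j : Fin 2) :
    IsWeakPartial U j (weakPartial U i (fun y => F y - F' y))
      (fun y => weakPartial U j (weakPartial U i F) y
        - weakPartial U j (weakPartial U i F') y) := by
  have hs := (h.isWeakJet.first i).sub (h'.isWeakJet.first i)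
  exact ((h.isWeakJet.second i j).sub (h'.isWeakJet.second i j)).congr
    (isWeakPartial_weakPartial ⟨_, hs⟩).locInt_deriv (weakPartial_sub_ae_eq hU h h' i)

/-- Differences of functions in `W^{2,2}_loc` are in `W^{2,2}_loc`. -/
theorem MemW22Loc.sub [CompleteSpace V] (hU : IsOpen U) (h : MemW22Loc U F)
    (h' : MemW22Loc U F') : MemW22Loc U (fun y => F y - F' y) := by
  have hs := fun i => (h.isWeakJet.first i).sub (h'.isWeakJet.first i)
  have hs2 := weakPartial_weakPartial_sub hU h h'
  refine ⟨fun K hK hKU => (h.memLp_zero K hK hKU).sub (h'.memLp_zero K hK hKU),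
    fun i => ⟨_, hs i⟩, fun i K hK hKU => ?_, fun i j => ⟨_, hs2 i j⟩, fun i j K hK hKU => ?_⟩
  · exact memLp_of_ae_eq_restrict hKU ((h.memLp_one i K hK hKU).sub (h'.memLp_one i K hK hKU))
      (weakPartial_sub_ae_eq hU h h' i)
  · exact memLp_of_ae_eq_restrict hKU ((h.memLp_two i j K hK hKU).sub (h'.memLp_two i j K hK hKU))
      ((isWeakPartial_weakPartial ⟨_, hs2 i j⟩).ae_eq hU (hs2 i j))

end WeakPartials

/-! ### The local estimate for conformal factors -/

section LocalEstimate

variable {V : Type*} [NormedAddCommGroup V] [InnerProductSpace ℝ V]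

theorem integrable_inner_of_memLp {ν : Measure Plane} {a b : Plane → V} (ha : MemLp a 2 ν)
    (hb : MemLp b 2 ν) : Integrable (fun y => (inner ℝ (a y) (b y) : ℝ)) ν := by
  refine (ha.norm.integrable_mul hb.norm).mono' (ha.1.inner hb.1) (Eventually.of_forall fun y => ?_)
  exact norm_inner_le_norm _ _

theorem integrableOn_cofactorPairing {E K : Set Plane} (hK : IsCompact K) (hE : E ⊆ K)
    {a b : Fin 2 → Plane → V} (ha : ∀ i, MemLp (a i) 2 (volume.restrict K))
    (hb : ∀ i, MemLp (b i) 2 (volume.restrict K)) {k : Plane → Fin 2 → Fin 2 → ℝ}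
    (hk : ∀ i j, Continuous fun y => k y i j) :
    IntegrableOn (fun y => cofactorPairing (fun i j => inner ℝ (a i y) (b j y)) (k y)) E := by
  refine IntegrableOn.mono_set ?_ hE
  have h : ∀ i j i' j', IntegrableOn (fun y => inner ℝ (a i y) (b j y) * k y i' j') K :=
    fun i j i' j' => IntegrableOn.mul_continuousOn (integrable_inner_of_memLp (ha i) (hb j))
      (hk i' j').continuousOn hK
  exact (((h _ _ _ _).sub (h _ _ _ _)).sub (h _ _ _ _)).add (h _ _ _ _)

/-- The pointwise estimate: if `m g` is the difference of the metrics induced by `F + G` and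
`G`, with Lipschitz coefficients `g`, then `m` is controlled by the `L²`-norm of the second
derivatives of `F` and the `L¹`-norm of `m`, up to a term which is small with `ρ`. -/
theorem ae_abs_le_of_isWeakJet [CompleteSpace V] {U : Set Plane} {x₀ : Plane} {r : ℝ} (hr : 0 < r)
    (hrU : Metric.closedBall x₀ r ⊆ U) {g : Plane → Fin 2 → Fin 2 → ℝ} {Λ d L : ℝ}
    (hΛ : 0 < Λ) (hd : 0 < d) (hL : 0 ≤ L)
    (hQ : ∀ x ∈ Metric.closedBall x₀ r, ∃ Q : PosForm, Q.coef = g x ∧ Q.tr ≤ Λ ∧ d ≤ Q.det)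
    (hg : ∀ x ∈ Metric.closedBall x₀ r, ∀ y ∈ Metric.closedBall x₀ r, ∀ i j,
      |g y i j - g x i j| ≤ L * ‖y - x‖)
    {F G : Plane → V} (hF : MemW22Loc U F) (hG : MemW22Loc U G) {M₁ : ℝ} (hM₁ : 0 ≤ M₁)
    (hFM : ∀ i, ∀ᵐ y ∂(volume.restrict (Metric.closedBall x₀ r)), ‖weakPartial U i F y‖ ≤ M₁)
    (hGM : ∀ i, ∀ᵐ y ∂(volume.restrict (Metric.closedBall x₀ r)), ‖weakPartial U i G y‖ ≤ M₁)
    {A B : ℝ} (hA : 0 ≤ A) (hB : 0 ≤ B)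
    (hFA : ∀ i j, ∫ y in Metric.closedBall x₀ r,
      ‖weakPartial U j (weakPartial U i F) y‖ ^ 2 ≤ A ^ 2)
    (hGB : ∀ i j, ∫ y in Metric.closedBall x₀ r,
      ‖weakPartial U j (weakPartial U i G) y‖ ^ 2 ≤ B ^ 2)
    {m : Plane → ℝ} (hm : IntegrableOn m (Metric.closedBall x₀ r)) {M : ℝ} (hM : 0 ≤ M)
    (hmM : ∀ᵐ y ∂(volume.restrict (Metric.closedBall x₀ r)), |m y| ≤ M)
    (hmg : ∀ i j, ∀ᵐ y ∂(volume.restrict (Metric.closedBall x₀ r)), m y * g y i j =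
      inner ℝ (weakPartial U i F y) (weakPartial U j G y)
        + inner ℝ (weakPartial U i G y) (weakPartial U j F y)
        + inner ℝ (weakPartial U i F y) (weakPartial U j F y))
    {S Bβ : ℝ} (hS : ∀ t, |t * deriv logProfile t| ≤ S ∧ |t ^ 2 * deriv (deriv logProfile) t| ≤ S)
    (hBβ : ∀ t, |deltaProfile t| ≤ Bβ) {ρ : ℝ} (hρ : 0 < ρ) (hρr : ρ ≤ r / 4) :
    ∀ᵐ x ∂(volume.restrict (Metric.ball x₀ (r / 4))), 2 * Real.pi * √d * |m x| ≤
      64 * Real.pi * S * Λ / √d * (2 * (A * B) + A * A)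
        + Λ ^ 2 * (Bβ / (ρ / (2 * √(Λ / d))) ^ 2) * (∫ y in Metric.closedBall x₀ r, |m y|)
        + M * (4 * L * (12 * S * Λ ^ 2 / d)) * (2 * Real.pi * ρ) := by
  set K := Metric.closedBall x₀ r with hKdef
  have hK : IsCompact K := isCompact_closedBall x₀ r
  have hmK : MeasurableSet K := hK.measurableSet
  -- for this `R`, the ellipses `Q ≤ R²` are contained in the ball of radius `ρ`
  set R := ρ / (2 * √(Λ / d)) with hR
  have hsq : 0 < √(Λ / d) := Real.sqrt_pos.2 (div_pos hΛ hd)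
  have hR0 : 0 < R := by positivity
  have hS0 : 0 ≤ S := (abs_nonneg _).trans (hS 0).1
  have hBβ0 : 0 ≤ Bβ := (abs_nonneg _).trans (hBβ 0)
  have hmi : Integrable (K.indicator m) := (integrable_indicator_iff hmK).2 hm
  have hball : Metric.ball x₀ (r / 4) ⊆ K :=
    Metric.ball_subset_closedBall.trans (Metric.closedBall_subset_closedBall (by linarith))
  rw [ae_restrict_iff' measurableSet_ball]
  filter_upwards [IsUnifLocDoublingMeasure.ae_tendsto_average_norm_sub (μ := volume)
    hmi.locallyIntegrable 1] with x hx hxb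
  have hxK : x ∈ K := hball hxb
  have hleb := hx (l := 𝓝[>] (0 : ℝ)) (fun _ => x) (fun δ => δ) tendsto_id (by
    filter_upwards [self_mem_nhdsWithin] with δ hδ
    exact Metric.mem_closedBall_self (by simpa using (le_of_lt hδ)))
  obtain ⟨Q, hQg, hQΛ, hQd⟩ := hQ x hxK
  have hdet := Q.det_positive
  have htr := Q.tr_pos
  have hxball : ∀ y ∈ Metric.ball x ρ, Metric.closedBall y (r / 4) ⊆ K := by
    intro y hy
    refine Metric.closedBall_subset_closedBall' ?_
    have h1 : dist y x < ρ := hy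
    have h2 : dist x x₀ < r / 4 := hxb
    linarith [dist_triangle y x x₀]
  have hbK : Metric.ball x ρ ⊆ K := fun y hy =>
    hxball y hy (Metric.mem_closedBall_self (by positivity))
  have hρQ : ∀ z, Q.eval z ≤ R ^ 2 → ‖z‖ < ρ := by
    intro z hz
    have h1 := Q.norm_le_of_eval_le hR0.le hz
    have h2 : √(Q.tr / Q.det) ≤ √(Λ / d) := Real.sqrt_le_sqrt (by gcongr)
    calc ‖z‖ ≤ √(Λ / d) * R := h1.trans (mul_le_mul_of_nonneg_right h2 hR0.le)
      _ = ρ / 2 := by rw [hR]; field_simp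
      _ < ρ := by linarith
  have hF1 := fun i => hF.memLp_one i K hK hrU
  have hG1 := fun i => hG.memLp_one i K hK hrU
  have hF2 := fun i j => hF.memLp_two i j K hK hrU
  have hG2 := fun i j => hG.memLp_two i j K hK hrU
  have hC : 64 * Real.pi * S * Q.tr / √Q.det ≤ 64 * Real.pi * S * Λ / √d := by
    have := Real.sqrt_le_sqrt hQd
    have := Real.sqrt_pos.2 hd
    gcongr
  set T := 64 * Real.pi * S * Λ / √d * (2 * (A * B) + A * A) with hT
  have key := sqrt_det_mul_abs_le Q x (T := T) (M := M) (L := L) hR0 hρ.le hρQ hS hBβ hmi hM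
    (by
      filter_upwards [ae_restrict_of_ae_restrict_of_subset hbK hmM,
        ae_restrict_mem measurableSet_ball] with y hy hyb
      rwa [indicator_of_mem (hbK hyb)])
    hleb (g := g)
    (by
      intro i j
      have : LipschitzOnWith L.toNNReal (fun y => g y i j) (Metric.ball x ρ) := by
        refine LipschitzOnWith.of_dist_le_mul fun y hy w hw => ?_
        rw [Real.dist_eq, dist_eq_norm, Real.coe_toNNReal _ hL]
        exact hg w (hbK hw) y (hbK hy) i j
      exact this.continuousOn)
    hL (by
      intro y hy i j
      rw [hQg]
      exact hg x hxK y (hbK hy) i j)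
    (by
      intro ε hε hεR
      have hψc : ∀ i j, Continuous fun y => hess (greenTest Q x ε R) y i j := fun i j =>
        (contDiff_partialD (contDiff_partialD (contDiff_greenTest Q x ε R) i) j).continuous
      have hw := fun {H H' : Plane → V} {a b : ℝ} (hH : MemW22Loc U H) (hH' : MemW22Loc U H')
          h1 h2 (ha : 0 ≤ a) (hb : 0 ≤ b) h3 h4 =>
        abs_setIntegral_cofactorPairing_hess_greenTest_le Q x hε hεR hρQ hS hK hrU
          (by positivity : 0 < r / 4) hxball hH.isWeakJet hH'.isWeakJet
          (fun i j => hH.memLp_two i j K hK hrU) (fun i j => hH'.memLp_two i j K hK hrU) hM₁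
          h1 h2 (A := a) (B := b) ha hb h3 h4
      have wFG := hw hF hG hFM hGM hA hB hFA hGB
      have wGF := hw hG hF hGM hFM hB hA hGB hFA
      have wFF := hw hF hF hFM hFM hA hA hFA hFA
      have iFG := integrableOn_cofactorPairing hK hbK hF1 hG1 hψc
      have iGF := integrableOn_cofactorPairing hK hbK hG1 hF1 hψc
      have iFF := integrableOn_cofactorPairing hK hbK hF1 hF1 hψc
      have e : ∫ y in Metric.ball x ρ, K.indicator m y *
          cofactorPairing (g y) (hess (greenTest Q x ε R) y) =
          (∫ y in Metric.ball x ρ, cofactorPairing (fun i j =>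
            inner ℝ (weakPartial U i F y) (weakPartial U j G y)) (hess (greenTest Q x ε R) y))
          + (∫ y in Metric.ball x ρ, cofactorPairing (fun i j =>
            inner ℝ (weakPartial U i G y) (weakPartial U j F y)) (hess (greenTest Q x ε R) y))
          + ∫ y in Metric.ball x ρ, cofactorPairing (fun i j =>
            inner ℝ (weakPartial U i F y) (weakPartial U j F y)) (hess (greenTest Q x ε R) y) := by
        refine Eq.trans ?_ ((integral_add' (iFG.add iGF) iFF).trans
          (congrArg (· + _) (integral_add' iFG iGF)))
        refine integral_congr_ae ?_
        have hmg' := fun i j => ae_restrict_of_ae_restrict_of_subset hbK (hmg i j)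
        filter_upwards [hmg' 0 0, hmg' 0 1, hmg' 1 0, hmg' 1 1,
          ae_restrict_mem measurableSet_ball] with y h00 h01 h10 h11 hyb
        rw [indicator_of_mem (hbK hyb)]
        simp only [cofactorPairing, Pi.add_apply]
        linear_combination hess (greenTest Q x ε R) y 1 1 * h00
          - hess (greenTest Q x ε R) y 0 1 * h01 - hess (greenTest Q x ε R) y 1 0 * h10
          + hess (greenTest Q x ε R) y 0 0 * h11
      rw [e]
      refine (abs_add_le _ _).trans ((add_le_add ((abs_add_le _ _).trans (add_le_add wFG wGF))
        wFF).trans ?_)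
      calc _ = 64 * Real.pi * S * Q.tr / √Q.det * (2 * (A * B) + A * A) := by ring
        _ ≤ T := by
          rw [hT]
          exact mul_le_mul_of_nonneg_right hC (by positivity))
  rw [indicator_of_mem hxK] at key
  have hDet : Q.det ≤ Λ ^ 2 := by
    have h1 := Q.pos
    have h2 := Q.coef_one_one_pos
    have h3 : Q.det ≤ Q.tr ^ 2 := by
      unfold PosForm.det PosForm.tr
      nlinarith [sq_nonneg (Q.coef 0 1)]
    exact h3.trans (by gcongr)
  have hInt : ∫ y in Metric.ball x ρ, |K.indicator m y| ≤ ∫ y in K, |m y| := by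
    rw [setIntegral_congr_fun measurableSet_ball (g := fun y => |m y|)
      (fun y hy => by simp only [indicator_of_mem (hbK hy)])]
    exact setIntegral_mono_set hm.abs (Eventually.of_forall fun _ => abs_nonneg _)
      (Eventually.of_forall fun y hy => hbK hy)
  have hI0 : 0 ≤ ∫ y in Metric.ball x ρ, |K.indicator m y| :=
    integral_nonneg fun _ => abs_nonneg _
  calc 2 * Real.pi * √d * |m x| ≤ 2 * Real.pi * √Q.det * |m x| := by
        have := Real.sqrt_le_sqrt hQd
        gcongr
    _ ≤ _ := key
    _ ≤ _ := by gcongr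

end LocalEstimate

/-! ### Bounds by the Sobolev norm -/

section SobolevNorm

variable {V : Type*} [NormedAddCommGroup V] [InnerProductSpace ℝ V] {U K : Set Plane}
  {F G : Plane → V}

theorem eLpNorm_weakPartial_le_w22Norm (i : Fin 2) :
    eLpNorm (weakPartial U i F) 2 (volume.restrict K) ≤ w22Norm U K F := by
  refine le_trans ?_ (le_trans le_add_self le_self_add)
  exact Finset.single_le_sum
    (f := fun i => eLpNorm (weakPartial U i F) 2 (volume.restrict K)) (fun _ _ => zero_le)
    (Finset.mem_univ i)

theorem eLpNorm_weakPartial_weakPartial_le_w22Norm (i j : Fin 2) :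
    eLpNorm (weakPartial U j (weakPartial U i F)) 2 (volume.restrict K) ≤ w22Norm U K F := by
  refine le_trans ?_ le_add_self
  refine (Finset.single_le_sum
    (f := fun j => eLpNorm (weakPartial U j (weakPartial U i F)) 2 (volume.restrict K))
    (fun _ _ => zero_le) (Finset.mem_univ j)).trans ?_
  exact Finset.single_le_sum (f := fun i => ∑ j,
    eLpNorm (weakPartial U j (weakPartial U i F)) 2 (volume.restrict K)) (fun _ _ => zero_le)
    (Finset.mem_univ i)

theorem MemW22Loc.w22Norm_ne_top (h : MemW22Loc U F) (hK : IsCompact K) (hKU : K ⊆ U) :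
    w22Norm U K F ≠ ⊤ := by
  have h0 := (h.memLp_zero K hK hKU).eLpNorm_lt_top
  have h1 := fun i => (h.memLp_one i K hK hKU).eLpNorm_lt_top
  have h2 := fun i j => (h.memLp_two i j K hK hKU).eLpNorm_lt_top
  unfold w22Norm
  refine ENNReal.add_ne_top.2 ⟨ENNReal.add_ne_top.2 ⟨h0.ne, ?_⟩, ?_⟩
  · exact ENNReal.sum_ne_top.2 fun i _ => (h1 i).ne
  · exact ENNReal.sum_ne_top.2 fun i _ => ENNReal.sum_ne_top.2 fun j _ => (h2 i j).ne

theorem integral_norm_mul_norm_le {E : Type*} [NormedAddCommGroup E] {F G : Plane → E}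
    (hF : MemLp F 2 (volume.restrict K))
    (hG : MemLp G 2 (volume.restrict K)) {A B : ℝ} (hA : 0 ≤ A) (hB : 0 ≤ B)
    (hFA : ∫ y in K, ‖F y‖ ^ 2 ≤ A ^ 2) (hGB : ∫ y in K, ‖G y‖ ^ 2 ≤ B ^ 2) :
    ∫ y in K, ‖F y‖ * ‖G y‖ ≤ A * B :=
  setIntegral_mul_le_of_sq_le hF.norm hG.norm (fun _ => norm_nonneg _) (fun _ => norm_nonneg _)
    hA hB hFA hGB

/-- The difference of the conformal factors is controlled in `L¹` by the `L²`-norm of the first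
derivatives. -/
theorem integral_abs_le_of_mul_eq_inner {a b : Plane → V} {m q : Plane → ℝ}
    (ha : MemLp a 2 (volume.restrict K)) (hb : MemLp b 2 (volume.restrict K)) {A B d : ℝ}
    (hA : 0 ≤ A) (hB : 0 ≤ B) (haA : ∫ y in K, ‖a y‖ ^ 2 ≤ A ^ 2)
    (hbB : ∫ y in K, ‖b y‖ ^ 2 ≤ B ^ 2) (hm : IntegrableOn m K) (hd : 0 < d)
    (hq : ∀ᵐ y ∂(volume.restrict K), d ≤ q y)
    (hmq : ∀ᵐ y ∂(volume.restrict K),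
      m y * q y = inner ℝ (a y) (b y) + inner ℝ (b y) (a y) + inner ℝ (a y) (a y)) :
    ∫ y in K, |m y| ≤ d⁻¹ * (2 * (A * B) + A * A) := by
  have i1 : IntegrableOn (fun y => ‖a y‖ * ‖b y‖) K := ha.norm.integrable_mul hb.norm
  have i2 : IntegrableOn (fun y => ‖a y‖ * ‖a y‖) K := ha.norm.integrable_mul ha.norm
  calc ∫ y in K, |m y|
      ≤ ∫ y in K, d⁻¹ * (2 * (‖a y‖ * ‖b y‖) + ‖a y‖ * ‖a y‖) := by
        refine integral_mono_ae hm.abs (((i1.const_mul 2).add i2).const_mul d⁻¹) ?_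
        filter_upwards [hq, hmq] with y hqy hmy
        rw [inv_mul_eq_div, le_div_iff₀ hd]
        calc |m y| * d ≤ |m y| * q y := mul_le_mul_of_nonneg_left hqy (abs_nonneg _)
          _ = |m y * q y| := by rw [abs_mul, abs_of_pos (hd.trans_le hqy)]
          _ ≤ ‖a y‖ * ‖b y‖ + ‖b y‖ * ‖a y‖ + ‖a y‖ * ‖a y‖ := by
            rw [hmy]
            exact (abs_add_le _ _).trans (add_le_add ((abs_add_le _ _).trans
              (add_le_add (abs_real_inner_le_norm _ _) (abs_real_inner_le_norm _ _)))
              (abs_real_inner_le_norm _ _))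
          _ = _ := by ring
    _ = d⁻¹ * (2 * (∫ y in K, ‖a y‖ * ‖b y‖) + ∫ y in K, ‖a y‖ * ‖a y‖) := by
        rw [integral_const_mul]
        congr 1
        exact (integral_add (i1.const_mul 2) i2).trans
          (congrArg (· + _) (integral_const_mul _ _))
    _ ≤ _ := by
        have h1 := integral_norm_mul_norm_le ha hb hA hB haA hbB
        have h2 := integral_norm_mul_norm_le ha ha hA hA haA haA
        gcongr

/-- Pointwise upper bounds pass to limits in `L¹`. -/
theorem ae_le_of_forall_exists_integral_abs_le {a : Plane → ℝ} {M : ℝ} (ha : IntegrableOn a K)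
    (hM : IntegrableOn (fun _ => M) K)
    (h : ∀ ε > 0, ∃ m : Plane → ℝ, IntegrableOn m K ∧ ∫ y in K, |m y| ≤ ε ∧
      ∀ᵐ y ∂(volume.restrict K), a y + m y ≤ M) :
    ∀ᵐ y ∂(volume.restrict K), a y ≤ M := by
  have hi : IntegrableOn (fun y => max (a y - M) 0) K := (ha.sub hM).pos_part
  have h0 : ∫ y in K, max (a y - M) 0 = 0 := by
    refine le_antisymm (le_of_forall_pos_le_add fun ε hε => ?_)
      (integral_nonneg fun _ => le_max_right _ _)
    obtain ⟨m, hm, hmε, hma⟩ := h ε hε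
    rw [zero_add]
    refine (integral_mono_ae hi hm.abs ?_).trans hmε
    filter_upwards [hma] with y hy
    exact max_le (by linarith [neg_abs_le (m y)]) (abs_nonneg _)
  replace h0 := (integral_eq_zero_iff_of_nonneg (fun y => le_max_right (a y - M) 0) hi).1 h0
  filter_upwards [h0] with y hy
  have := (le_max_left (a y - M) 0).trans_eq hy
  simpa using this

theorem exists_pos_mul_le {c B ε : ℝ} (hc : 0 ≤ c) (hB : 0 ≤ B) (hε : 0 < ε) :
    ∃ α, 0 < α ∧ c * (2 * (α * B) + α * α) ≤ ε := by
  have hp : 0 < c * (2 * B + 1) + 1 := by positivity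
  refine ⟨min 1 (ε / (c * (2 * B + 1) + 1)), by positivity, ?_⟩
  set α := min 1 (ε / (c * (2 * B + 1) + 1)) with hα
  have h0 : 0 < α := by positivity
  have h1 : α ≤ 1 := min_le_left _ _
  have h2 : α * (c * (2 * B + 1) + 1) ≤ ε := (le_div_iff₀ hp).1 (min_le_right _ _)
  calc c * (2 * (α * B) + α * α) ≤ c * (2 * (α * B) + α * 1) := by gcongr
    _ ≤ α * (c * (2 * B + 1) + 1) := by linarith
    _ ≤ ε := h2

end SobolevNorm

/-! ### Local uniform convergence of the conformal factors -/

section ConformalFactors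

variable {S : Type*} [TopologicalSpace S] [ChartedSpace Plane S] [IsManifold (𝓡 2) ∞ S]
  {V : Type*} [NormedAddCommGroup V] [InnerProductSpace ℝ V]
  {g : SmoothMetric S} {φ : OpenPartialHomeomorph S Plane}

theorem IsConformalFactor.integrableOn_exp {f : S → V} {u : S → ℝ} (hu : IsConformalFactor g f u)
    (hf : MemW22 f) (hφ : φ ∈ smoothCharts S) {K : Set Plane} (hK : IsCompact K)
    (hKU : K ⊆ φ.target) : IntegrableOn (fun y => Real.exp (2 * u (φ.symm y))) K := by
  have hc : ContinuousOn (fun y => (SmoothMetric.coeff g φ 0 0 y)⁻¹) K :=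
    ((contDiffOn_coeff g hφ 0 0).continuousOn.mono hKU).inv₀
      fun y hy => (metricForm g hφ (hKU hy)).pos.ne'
  have h1 := (hf φ hφ).memLp_one 0 K hK hKU
  have h2 : IntegrableOn (fun y => inner ℝ (weakPartial φ.target 0 (f ∘ φ.symm) y)
      (weakPartial φ.target 0 (f ∘ φ.symm) y) * (SmoothMetric.coeff g φ 0 0 y)⁻¹) K :=
    IntegrableOn.mul_continuousOn (integrable_inner_of_memLp h1 h1) hc hK
  refine h2.congr ?_
  filter_upwards [ae_restrict_of_ae_restrict_of_subset hKU (hu φ hφ 0 0),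
    ae_restrict_mem hK.measurableSet] with y hy hyK
  have hp : SmoothMetric.coeff g φ 0 0 y ≠ 0 := (metricForm g hφ (hKU hyK)).pos.ne'
  rw [inducedMetric] at hy
  rw [hy, mul_assoc, mul_inv_cancel₀ hp, mul_one]

/-- The difference of the induced metrics, expressed by the difference of the immersions. -/
theorem IsConformalFactor.sub_mul_coeff_ae_eq [CompleteSpace V] {f f' : S → V} {u u' : S → ℝ}
    (hu : IsConformalFactor g f u) (hu' : IsConformalFactor g f' u') (hf : MemW22 f)
    (hf' : MemW22 f') (hφ : φ ∈ smoothCharts S) (i j : Fin 2) :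
    ∀ᵐ y ∂(volume.restrict φ.target),
      (Real.exp (2 * u (φ.symm y)) - Real.exp (2 * u' (φ.symm y))) *
        SmoothMetric.coeff g φ i j y =
      inner ℝ (weakPartial φ.target i (fun y => f (φ.symm y) - f' (φ.symm y)) y)
          (weakPartial φ.target j (f' ∘ φ.symm) y)
        + inner ℝ (weakPartial φ.target i (f' ∘ φ.symm) y)
          (weakPartial φ.target j (fun y => f (φ.symm y) - f' (φ.symm y)) y)
        + inner ℝ (weakPartial φ.target i (fun y => f (φ.symm y) - f' (φ.symm y)) y)
          (weakPartial φ.target j (fun y => f (φ.symm y) - f' (φ.symm y)) y) := by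
  have hs : ∀ i, weakPartial φ.target i (fun y => f (φ.symm y) - f' (φ.symm y))
      =ᵐ[volume.restrict φ.target] fun y => weakPartial φ.target i (f ∘ φ.symm) y
        - weakPartial φ.target i (f' ∘ φ.symm) y := fun i =>
    weakPartial_sub_ae_eq φ.open_target (hf φ hφ) (hf' φ hφ) i
  filter_upwards [hu φ hφ i j, hu' φ hφ i j, hs i, hs j] with y h h' hi hj
  rw [sub_mul, ← h, ← h', hi, hj]
  simp only [inducedMetric, inner_sub_left, inner_sub_right]
  ring

theorem IsConformalFactor.norm_weakPartial_le {f : S → V} {u : S → ℝ}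
    (hu : IsConformalFactor g f u) (hφ : φ ∈ smoothCharts S) {K : Set Plane}
    (hK : MeasurableSet K) (hKU : K ⊆ φ.target) {Λ M : ℝ}
    (hΛ : ∀ y (hy : y ∈ K), (metricForm g hφ (hKU hy)).tr ≤ Λ)
    (hM : ∀ᵐ y ∂(volume.restrict K), Real.exp (2 * u (φ.symm y)) ≤ M) (i : Fin 2) :
    ∀ᵐ y ∂(volume.restrict K), ‖weakPartial φ.target i (f ∘ φ.symm) y‖ ≤ √(M * Λ) := by
  filter_upwards [ae_restrict_of_ae_restrict_of_subset hKU (hu φ hφ i i),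
    ae_restrict_mem hK, hM] with y hy hyK hyM
  have h1 : SmoothMetric.coeff g φ i i y ≤ Λ :=
    (le_abs_self _).trans (((metricForm g hφ (hKU hyK)).abs_coef_le i i).trans (hΛ y hyK))
  have hΛ0 : 0 ≤ Λ := (metricForm g hφ (hKU hyK)).tr_pos.le.trans (hΛ y hyK)
  rw [inducedMetric, real_inner_self_eq_norm_sq] at hy
  refine Real.le_sqrt_of_sq_le ?_
  rw [hy]
  calc _ ≤ Real.exp (2 * u (φ.symm y)) * Λ :=
        mul_le_mul_of_nonneg_left h1 (Real.exp_pos _).le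
    _ ≤ M * Λ := mul_le_mul_of_nonneg_right hyM hΛ0

/-- The functions `exp (2 u_k)` converge uniformly to `exp (2 u')` on small balls in the chart
domains. -/
theorem eventually_ae_abs_exp_sub_exp_le [CompleteSpace V] {f : ℕ → S → V} {f' : S → V}
    {u : ℕ → S → ℝ} {u' : S → ℝ} (hf : ∀ k, MemW22 (f k))
    (hu : ∀ k, IsConformalFactor g (f k) (u k)) (hf' : MemW22 f')
    (hu' : IsConformalFactor g f' u') (hconv : TendstoW22 f f') (hφ : φ ∈ smoothCharts S)
    {M : ℝ} (hM : ∀ k, ∀ᵐ y ∂(volume.restrict φ.target), Real.exp (2 * u k (φ.symm y)) ≤ M)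
    {x₀ : Plane} {r : ℝ} (hr : 0 < r) (hrU : Metric.closedBall x₀ r ⊆ φ.target)
    {η : ℝ} (hη : 0 < η) :
    ∀ᶠ k in atTop, ∀ᵐ y ∂(volume.restrict (Metric.ball x₀ (r / 4))),
      |Real.exp (2 * u k (φ.symm y)) - Real.exp (2 * u' (φ.symm y))| ≤ η := by
  obtain ⟨Λ, d, L, hΛ, hd, hL, hQ, hg⟩ := exists_metric_bounds g hφ hrU
  obtain ⟨s, hs0, hs⟩ := exists_logProfile_bound
  obtain ⟨b, hb0, hb⟩ := exists_deltaProfile_bound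
  set U := φ.target with hU
  set K := Metric.closedBall x₀ r with hKdef
  have hK : IsCompact K := isCompact_closedBall x₀ r
  have hKm : MeasurableSet K := hK.measurableSet
  set G : Plane → V := f' ∘ φ.symm with hGdef
  set F : ℕ → Plane → V := fun k y => f k (φ.symm y) - f' (φ.symm y) with hFdef
  set m : ℕ → Plane → ℝ := fun k y =>
    Real.exp (2 * u k (φ.symm y)) - Real.exp (2 * u' (φ.symm y)) with hmdef
  have hG : MemW22Loc U G := hf' φ hφ
  have hF : ∀ k, MemW22Loc U (F k) := fun k => (hf k φ hφ).sub φ.open_target (hf' φ hφ)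
  have hmi : ∀ k, IntegrableOn (m k) K := fun k =>
    ((hu k).integrableOn_exp (hf k) hφ hK hrU).sub (hu'.integrableOn_exp hf' hφ hK hrU)
  have hmg := fun k i j => ae_restrict_of_ae_restrict_of_subset hrU
    ((hu k).sub_mul_coeff_ae_eq hu' (hf k) hf' hφ i j)
  have hMK := fun k => ae_restrict_of_ae_restrict_of_subset hrU (hM k)
  set B := (w22Norm U K G).toReal with hBdef
  have hB : 0 ≤ B := ENNReal.toReal_nonneg
  have hGtop := hG.w22Norm_ne_top hK hrU
  have hG1 : ∀ i, ∫ y in K, ‖weakPartial U i G y‖ ^ 2 ≤ B ^ 2 := fun i =>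
    integral_norm_sq_le_of_eLpNorm_le (hG.memLp_one i K hK hrU) hGtop
      (eLpNorm_weakPartial_le_w22Norm i)
  have hG2 : ∀ i j, ∫ y in K, ‖weakPartial U j (weakPartial U i G) y‖ ^ 2 ≤ B ^ 2 := fun i j =>
    integral_norm_sq_le_of_eLpNorm_le (hG.memLp_two i j K hK hrU) hGtop
      (eLpNorm_weakPartial_weakPartial_le_w22Norm i j)
  have hsmall : ∀ α, 0 < α → ∀ᶠ k in atTop,
      (∀ i j, ∫ y in K, ‖weakPartial U j (weakPartial U i (F k)) y‖ ^ 2 ≤ α ^ 2) ∧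
        ∫ y in K, |m k y| ≤ d⁻¹ * (2 * (α * B) + α * α) := by
    intro α hα
    filter_upwards [ENNReal.tendsto_nhds_zero.1 (hconv φ hφ K hK hrU) (ENNReal.ofReal α)
      (ENNReal.ofReal_pos.2 hα)] with k hk
    have e : (ENNReal.ofReal α).toReal = α := ENNReal.toReal_ofReal hα.le
    refine ⟨fun i j => ?_, ?_⟩
    · have h := integral_norm_sq_le_of_eLpNorm_le ((hF k).memLp_two i j K hK hrU)
        ENNReal.ofReal_ne_top ((eLpNorm_weakPartial_weakPartial_le_w22Norm i j).trans hk)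
      rwa [e] at h
    · have h := integral_norm_sq_le_of_eLpNorm_le ((hF k).memLp_one 0 K hK hrU)
        ENNReal.ofReal_ne_top ((eLpNorm_weakPartial_le_w22Norm 0).trans hk)
      rw [e] at h
      refine integral_abs_le_of_mul_eq_inner ((hF k).memLp_one 0 K hK hrU)
        (hG.memLp_one 0 K hK hrU) hα.le hB h (hG1 0) (hmi k) hd ?_ (hmg k 0 0)
      filter_upwards [ae_restrict_mem hKm] with y hy
      exact (hQ y hy).2.2
  -- the upper bound passes to the limit, as `exp (2 u_k)` converges in `L¹`
  have hM' : ∀ᵐ y ∂(volume.restrict K), Real.exp (2 * u' (φ.symm y)) ≤ M := by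
    refine ae_le_of_forall_exists_integral_abs_le (hu'.integrableOn_exp hf' hφ hK hrU)
      (integrableOn_const hK.measure_lt_top.ne) fun ε hε => ?_
    obtain ⟨α, hα, hαε⟩ := exists_pos_mul_le (inv_pos.2 hd).le hB hε
    obtain ⟨k, -, hk⟩ := (hsmall α hα).exists
    refine ⟨m k, hmi k, hk.trans hαε, ?_⟩
    filter_upwards [hMK k] with y hy
    simpa [hmdef] using hy
  have hmM : ∀ k, ∀ᵐ y ∂(volume.restrict K), |m k y| ≤ |M| := fun k => by
    filter_upwards [hMK k, hM'] with y h1 h2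
    have e1 := Real.exp_pos (2 * u k (φ.symm y))
    have e2 := Real.exp_pos (2 * u' (φ.symm y))
    rw [abs_le]
    constructor <;> simp only [hmdef] <;> linarith [le_abs_self M]
  set N := √(M * Λ) with hN
  have hN0 : 0 ≤ N := Real.sqrt_nonneg _
  have hGN : ∀ i, ∀ᵐ y ∂(volume.restrict K), ‖weakPartial U i G y‖ ≤ 2 * N := fun i => by
    filter_upwards [hu'.norm_weakPartial_le hφ hKm hrU (fun y hy => (hQ y hy).1) hM' i]
      with y hy
    exact hy.trans (by linarith)
  have hFN : ∀ k i, ∀ᵐ y ∂(volume.restrict K), ‖weakPartial U i (F k) y‖ ≤ 2 * N :=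
    fun k i => by
    have hsub := ae_restrict_of_ae_restrict_of_subset hrU
      (weakPartial_sub_ae_eq φ.open_target (hf k φ hφ) (hf' φ hφ) i)
    filter_upwards [hu'.norm_weakPartial_le hφ hKm hrU (fun y hy => (hQ y hy).1) hM' i,
      (hu k).norm_weakPartial_le hφ hKm hrU (fun y hy => (hQ y hy).1) (hMK k) i, hsub]
      with y h1 h2 h3
    refine (congrArg norm h3).trans_le ((norm_sub_le _ _).trans ?_)
    linarith
  have hd' : 0 < √d := Real.sqrt_pos.2 hd
  have hε : 0 < Real.pi * √d * η := by positivity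
  -- first `ρ` is chosen to make the error of freezing the coefficients small, then `α`
  obtain ⟨ρ, hρ, hρr, hρε⟩ : ∃ ρ, 0 < ρ ∧ ρ ≤ r / 4 ∧
      |M| * (4 * L * (12 * s * Λ ^ 2 / d)) * (2 * Real.pi * ρ) ≤ Real.pi * √d * η := by
    have hc : 0 ≤ |M| * (4 * L * (12 * s * Λ ^ 2 / d)) * (2 * Real.pi) := by positivity
    set c := |M| * (4 * L * (12 * s * Λ ^ 2 / d)) * (2 * Real.pi) with hcdef
    refine ⟨min (r / 4) (Real.pi * √d * η / (c + 1)), by positivity, min_le_left _ _, ?_⟩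
    have h1 := (le_div_iff₀ (by positivity)).1
      (min_le_right (r / 4) (Real.pi * √d * η / (c + 1)))
    have h2 : 0 < min (r / 4) (Real.pi * √d * η / (c + 1)) := by positivity
    calc _ = c * min (r / 4) (Real.pi * √d * η / (c + 1)) := by rw [hcdef]; ring
      _ ≤ _ := by linarith
  obtain ⟨α, hα, hαε⟩ := exists_pos_mul_le (B := B) (ε := Real.pi * √d * η)
    (c := 64 * Real.pi * s * Λ / √d + Λ ^ 2 * (b / (ρ / (2 * √(Λ / d))) ^ 2) * d⁻¹)
    (by positivity) hB hε
  filter_upwards [hsmall α hα] with k hk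
  have key := ae_abs_le_of_isWeakJet hr hrU hΛ hd hL
    (fun x hx => ⟨metricForm g hφ (hrU hx), rfl, (hQ x hx).1, (hQ x hx).2.1⟩) hg (hF k) hG
    (by positivity : 0 ≤ 2 * N) (hFN k) hGN hα.le hB hk.1 hG2 (hmi k) (abs_nonneg M) (hmM k)
    (hmg k) hs hb hρ hρr
  filter_upwards [key] with y hy
  have h1 : 2 * Real.pi * √d * |m k y| ≤ 2 * Real.pi * √d * η := by
    refine hy.trans ?_
    have h2 : Λ ^ 2 * (b / (ρ / (2 * √(Λ / d))) ^ 2) * (∫ y in K, |m k y|) ≤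
        Λ ^ 2 * (b / (ρ / (2 * √(Λ / d))) ^ 2) * (d⁻¹ * (2 * (α * B) + α * α)) :=
      mul_le_mul_of_nonneg_left hk.2 (by positivity)
    linarith
  exact le_of_mul_le_mul_left h1 (by positivity)

end ConformalFactors

/-! ### Null sets and the essential supremum on a surface -/

section NullSets

variable {S : Type*} [TopologicalSpace S] [ChartedSpace Plane S]

theorem ae_abs_le_of_linftyNorm_lt {u : S → ℝ} {c : ℝ} (h : linftyNorm u < ENNReal.ofReal c)
    {φ : OpenPartialHomeomorph S Plane} (hφ : φ ∈ smoothCharts S) :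
    ∀ᵐ y ∂(volume.restrict φ.target), |u (φ.symm y)| ≤ c := by
  obtain ⟨b, hb, hbc⟩ := sInf_lt_iff.1 h
  rw [ae_restrict_iff' φ.open_target.measurableSet]
  refine measure_mono_null (fun y hy => ?_) (hb φ hφ)
  simp only [mem_compl_iff, mem_ofPred_eq, Classical.not_imp, not_le] at hy
  refine ⟨hy.1, hbc.trans_le ?_⟩
  rw [← ofReal_norm]
  exact ENNReal.ofReal_le_ofReal hy.2.le

theorem linftyNorm_le_of_isNullOn {u : S → ℝ} {c : ℝ} (hc : 0 ≤ c)
    (h : IsNullOn {p | c < |u p|}) : linftyNorm u ≤ ENNReal.ofReal c := by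
  have e : {p | ENNReal.ofReal c < ‖u p‖ₑ} = {p | c < |u p|} := by
    ext p
    change ENNReal.ofReal c < ‖u p‖ₑ ↔ c < |u p|
    rw [← ofReal_norm, ENNReal.ofReal_lt_ofReal_iff_of_nonneg hc, Real.norm_eq_abs]
  refine sInf_le ?_
  change IsNullOn {p | ENNReal.ofReal c < ‖u p‖ₑ}
  rwa [e]

/-- A set is null as soon as it is null in a covering family of charts, since transition maps
are differentiable. -/
theorem isNullOn_of_cover [IsManifold (𝓡 2) ∞ S] {ι : Type*} {t : Set ι} (ht : t.Countable)
    {φ : ι → OpenPartialHomeomorph S Plane} (hφ : ∀ i, φ i ∈ smoothCharts S) {B : ι → Set Plane}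
    (hB : ∀ p, ∃ i ∈ t, p ∈ (φ i).source ∧ φ i p ∈ B i) {N : Set S}
    (hN : ∀ i ∈ t, volume (B i ∩ (φ i).symm ⁻¹' N) = 0) : IsNullOn N := by
  intro ψ hψ
  refine measure_mono_null (t := ⋃ i ∈ t, (ψ ∘ (φ i).symm) ''
    (((φ i).symm.trans ψ).source ∩ (B i ∩ (φ i).symm ⁻¹' N))) ?_ ?_
  · rintro y ⟨hy, hyN⟩
    obtain ⟨i, hi, hs, hb⟩ := hB (ψ.symm y)
    refine mem_biUnion hi ⟨φ i (ψ.symm y), ⟨?_, hb, ?_⟩, ?_⟩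
    · rw [OpenPartialHomeomorph.trans_source]
      refine ⟨(φ i).map_source hs, ?_⟩
      simpa [(φ i).left_inv hs] using ψ.map_target hy
    · simpa [(φ i).left_inv hs] using hyN
    · simp [(φ i).left_inv hs, ψ.right_inv hy]
  · rw [measure_biUnion_null_iff ht]
    intro i hi
    refine addHaar_image_eq_zero_of_differentiableOn_of_addHaar_eq_zero volume ?_
      (measure_mono_null inter_subset_right (hN i hi))
    have h : ContMDiffOn (𝓡 2) (𝓡 2) ∞ (ψ ∘ (φ i).symm) ((φ i).symm.trans ψ).source := by
      rw [OpenPartialHomeomorph.trans_source]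
      exact (contMDiffOn_of_mem_maximalAtlas hψ).comp
        ((contMDiffOn_symm_of_mem_maximalAtlas (hφ i)).mono inter_subset_left)
        fun y hy => hy.2
    exact ((contMDiffOn_iff_contDiffOn.1 h).differentiableOn (by simp)).mono inter_subset_left

end NullSets

/-! ### From exponentials to exponents -/

section Logarithm

/-- Closeness of exponentials forces closeness of the exponents, if one of them is bounded
below. -/
theorem abs_sub_le_of_abs_exp_sub_exp_le {a b c τ : ℝ} (ha : -c ≤ a)
    (h : |Real.exp (2 * a) - Real.exp (2 * b)| ≤
      Real.exp (-(2 * c)) * (1 - Real.exp (-(2 * τ)))) : |a - b| ≤ τ := by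
  have hexp : Real.exp (-(2 * c)) ≤ Real.exp (2 * a) := Real.exp_le_exp.2 (by linarith)
  have hc := Real.exp_pos (-(2 * c))
  have h1 : 0 ≤ 1 - Real.exp (-(2 * τ)) :=
    nonneg_of_mul_nonneg_right ((abs_nonneg _).trans h) hc
  have h2 : Real.exp (-(2 * c)) * (1 - Real.exp (-(2 * τ))) ≤
      Real.exp (2 * a) * (1 - Real.exp (-(2 * τ))) := mul_le_mul_of_nonneg_right hexp h1
  obtain ⟨h3, h4⟩ := abs_le.1 (h.trans h2)
  have ea := Real.exp_pos (2 * a)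
  have et := Real.exp_pos (2 * τ)
  have e1 : Real.exp (-(2 * τ)) * Real.exp (2 * τ) = 1 := by rw [← Real.exp_add]; simp
  rw [abs_le]
  constructor
  · have h5 : Real.exp (2 * b) ≤ Real.exp (2 * a + 2 * τ) := by
      rw [Real.exp_add]
      nlinarith [sq_nonneg (Real.exp (2 * τ) - 1)]
    linarith [Real.exp_le_exp.1 h5]
  · have h5 : Real.exp (2 * a + -(2 * τ)) ≤ Real.exp (2 * b) := by
      rw [Real.exp_add]
      linarith
    linarith [Real.exp_le_exp.1 h5]

end Logarithm

end

theorem theoremA1 {S : Type*} [TopologicalSpace S] [ChartedSpace Plane S]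
    [IsManifold (𝓡 2) ∞ S] [T2Space S] [CompactSpace S]
    (g : SmoothMetric S) (n : ℕ)
    (f : ℕ → S → EuclideanSpace ℝ (Fin n)) (f' : S → EuclideanSpace ℝ (Fin n))
    (u : ℕ → S → ℝ) (u' : S → ℝ) (C : ℝ≥0)
    (hf : ∀ k, IsW22ConformalImmersion g (f k))
    (hu : ∀ k, IsConformalFactor g (f k) (u k))
    (hf' : IsW22ConformalImmersion g f')
    (hu' : IsConformalFactor g f' u')
    (hconv : TendstoW22 f f')
    (hC : ∀ k, linftyNorm (u k) ≤ (C : ℝ≥0∞)) :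
    Tendsto (fun k => linftyNorm (fun p => u k p - u' p)) atTop (𝓝 0) := by
  set c : ℝ := C + 1 with hc
  have hcC : (C : ℝ≥0∞) < ENNReal.ofReal c := by
    rw [← ENNReal.ofReal_coe_nnreal]
    exact (ENNReal.ofReal_lt_ofReal_iff (by positivity)).2 (lt_add_one _)
  have hbd : ∀ k, ∀ φ ∈ smoothCharts S, ∀ᵐ y ∂(volume.restrict φ.target),
      |u k (φ.symm y)| ≤ c := fun k φ hφ => ae_abs_le_of_linftyNorm_lt ((hC k).trans_lt hcC) hφ
  have hchart : ∀ p : S, chartAt Plane p ∈ smoothCharts S := fun p =>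
    IsManifold.chart_mem_maximalAtlas p
  have hball : ∀ p : S, ∃ r, 0 < r ∧
      Metric.closedBall (chartAt Plane p p) r ⊆ (chartAt Plane p).target := fun p =>
    Metric.nhds_basis_closedBall.mem_iff.1
      ((chartAt Plane p).open_target.mem_nhds (mem_chart_target Plane p))
  choose r hr hrU using hball
  -- finitely many small coordinate balls cover the compact surface
  obtain ⟨t, ht⟩ := isCompact_univ.elim_nhds_subcover
    (fun p : S => (chartAt Plane p).source ∩
      chartAt Plane p ⁻¹' Metric.ball (chartAt Plane p p) (r p / 4))
    (fun p _ => ((chartAt Plane p).isOpen_inter_preimage Metric.isOpen_ball).mem_nhds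
      ⟨mem_chart_source Plane p, Metric.mem_ball_self (by linarith [hr p])⟩)
  refine ENNReal.tendsto_nhds_zero.2 fun ε hε => ?_
  obtain ⟨τ, hτ, hτε⟩ : ∃ τ : ℝ, 0 < τ ∧ ENNReal.ofReal τ ≤ ε := by
    obtain ⟨τ, hτ, hτε⟩ := ENNReal.lt_iff_exists_nnreal_btwn.1 hε
    exact ⟨τ, by exact_mod_cast hτ, by simpa using hτε.le⟩
  -- the distance of the exponentials which forces the exponents to differ by at most `τ`
  have hη : 0 < Real.exp (-(2 * c)) * (1 - Real.exp (-(2 * τ))) :=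
    mul_pos (Real.exp_pos _) (sub_pos.2 (Real.exp_lt_one_iff.2 (by linarith)))
  have hloc : ∀ p ∈ t, ∀ᶠ k in atTop, ∀ᵐ y ∂(volume.restrict
      (Metric.ball (chartAt Plane p p) (r p / 4))),
      |Real.exp (2 * u k ((chartAt Plane p).symm y)) - Real.exp (2 * u' ((chartAt Plane p).symm y))|
        ≤ Real.exp (-(2 * c)) * (1 - Real.exp (-(2 * τ))) := fun p _ =>
    eventually_ae_abs_exp_sub_exp_le (fun k => (hf k).memW22) hu hf'.memW22 hu' hconv (hchart p)
      (M := Real.exp (2 * c)) (fun k => by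
        filter_upwards [hbd k _ (hchart p)] with y hy
        exact Real.exp_le_exp.2 (by linarith [le_abs_self (u k ((chartAt Plane p).symm y))]))
      (hr p) (hrU p) hη
  filter_upwards [t.eventually_all.2 hloc] with k hk
  refine (linftyNorm_le_of_isNullOn hτ.le ?_).trans hτε
  refine isNullOn_of_cover t.countable_toSet (φ := fun p => chartAt Plane p) hchart
    (B := fun p => Metric.ball (chartAt Plane p p) (r p / 4)) (fun q => ?_) fun p hp => ?_
  · obtain ⟨p, hp, hq⟩ := mem_iUnion₂.1 (ht.2 (mem_univ q))
    exact ⟨p, hp, hq.1, hq.2⟩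
  · have hsub : Metric.ball (chartAt Plane p p) (r p / 4) ⊆ (chartAt Plane p).target :=
      (Metric.ball_subset_closedBall.trans
        (Metric.closedBall_subset_closedBall (by linarith [hr p]))).trans (hrU p)
    have h := (ae_restrict_iff' measurableSet_ball).1 ((hk p hp).and
      (ae_restrict_of_ae_restrict_of_subset hsub (hbd k _ (hchart p))))
    refine measure_mono_null (fun y hy => ?_) h
    intro hy'
    obtain ⟨h1, h2⟩ := hy' hy.1
    exact absurd (abs_sub_le_of_abs_exp_sub_exp_le (neg_le_of_abs_le h2) h1) (not_le.2 hy.2)
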